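/- Let $k$ be a field and let $A=\bigoplus_{i\ge 0}A_i$ be a positively graded $k$-algebra with $\dim_k A_i<\infty$ and $A_1A_i=A_{i+1}$ for all $i\ge 0$. Write $A_0$ also for the graded left $A$-module $A/\bigoplus_{i\ge 1}A_i$, concentrated in degree $0$. A Koszul $A$-module is a $\mathbb Z$-graded left $A$-module $M$ with all $\dim_k M_n<\infty$, generated in degree $0$, that has a graded projective resolution $\cdots\to P^1\to P^0\to M\to 0$ with $P^i$ generated in degree $i$ for every $i\ge 0$; the morphisms of Koszul modules are the homomorphisms of degree $0$. Koszul modules over other positively graded $k$-algebras are defined in the same way. Suppose that (S) every exact sequence $0\to P\to Q\to R\to 0$ of left $A_0$-modules with $P$ and $Q$ projective splits, and the same holds for right $A_0$-modules; and that $A$ is a Koszul algebra, i.e. $A_0$ is a Koszul $A$-module. Let $\Gamma=\operatorname{Ext}_A^*(A_0,A_0)=\bigoplus_{i\ge 0}\operatorname{Ext}_A^i(A_0,A_0)$, graded by $i$, with the Yoneda product, and for a graded $A$-module $M$ let $E(M)=\operatorname{Ext}_A^*(M,A_0)=\bigoplus_{i\ge 0}\operatorname{Ext}_A^i(M,A_0)$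 be the graded left $\Gamma$-module on which $\Gamma$ acts by the Yoneda product. Let $\Gamma_0$ also denote the graded $\Gamma$-module $\Gamma/\bigoplus_{i\ge 1}\Gamma_i$. Then: 1. If $M$ is a Koszul $A$-module, then $E(M)$ is a Koszul $\Gamma$-module. 2. $E$ is a duality, i.e. a contravariant equivalence, between the category of Koszul $A$-modules and the category of Koszul $\Gamma$-modules. 3. There is an isomorphism of graded $k$-algebras $A\cong\operatorname{Ext}_\Gamma^*(\Gamma_0,\Gamma_0)$ such that, when $\operatorname{Ext}_\Gamma^*(E(M),\Gamma_0)$ is regarded as a graded $A$-module through it, $\operatorname{Ext}_\Gamma^*(E(M),\Gamma_0)\cong M$ as graded $A$-modules for every Koszul $A$-module $M$, naturally in $M$. -/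

import Mathlib

open CategoryTheory DirectSum

universe w v u

namespace GenKoszul

/-! ## Yoneda products on total `Ext` groups -/

/-- For `V = ⨁ i, V i` (`i : ℕ`) and a map `e : ℕ → ι`, the elements of `V` that are
homogeneous of degree `n : ι`, when `V i` is placed in degree `e i`. -/
def homogeneous (k : Type*) [Field k] (V : ℕ → Type*) [∀ i, AddCommGroup (V i)]
    [∀ i, Module k (V i)] {ι : Type*} (e : ℕ → ι) (n : ι) : Submodule k (⨁ i, V i) where
  carrier := {x | ∀ i, e i ≠ n → x i = 0}
  add_mem' hx hy i hi := by rw [DirectSum.add_apply, hx i hi, hy i hi, add_zero]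
  zero_mem' _ _ := rfl
  smul_mem' r x hx i hi := by rw [DirectSum.smul_apply, hx i hi, smul_zero]

theorem of_mem_homogeneous (k : Type*) [Field k] (V : ℕ → Type*) [∀ i, AddCommGroup (V i)]
    [∀ i, Module k (V i)] {ι : Type*} (e : ℕ → ι) (i : ℕ) (v : V i) :
    DirectSum.of V i v ∈ homogeneous k V e (e i) := fun j hj =>
  DirectSum.of_eq_of_ne _ _ _ (fun h => hj (by rw [h]))

theorem eq_of_of_mem_homogeneous {k : Type*} [Field k] {V : ℕ → Type*} [∀ i, AddCommGroup (V i)]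
    [∀ i, Module k (V i)] {ι : Type*} {e : ℕ → ι} (he : Function.Injective e) {i : ℕ}
    {x : ⨁ i, V i} (hx : x ∈ homogeneous k V e (e i)) : DirectSum.of V i (x i) = x := by
  refine DFinsupp.ext fun j => ?_
  by_cases h : j = i
  · subst h; exact DirectSum.of_eq_same _ _
  · rw [hx j (fun h' => h (he h'))]; exact DirectSum.of_eq_of_ne _ _ _ h

theorem homogeneous_isInternal (k : Type*) [Field k] (V : ℕ → Type*) [∀ i, AddCommGroup (V i)]
    [∀ i, Module k (V i)] {ι : Type*} [DecidableEq ι] (e : ℕ → ι) :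
    DirectSum.IsInternal (homogeneous k V e) := by
  have key : ∀ (x : ⨁ n, homogeneous k V e n) (i : ℕ),
      (DirectSum.coeAddMonoidHom (homogeneous k V e) x) i = (x (e i)).1 i := by
    intro x i
    induction x using DirectSum.induction_on with
    | zero => rw [map_zero]; rfl
    | of n y =>
      rw [DirectSum.coeAddMonoidHom_of]
      by_cases h : e i = n
      · subst h; rw [DirectSum.of_eq_same]
      · rw [DirectSum.of_eq_of_ne _ _ _ h, y.2 i h]; rfl
    | add x y hx hy =>
      rw [map_add, DirectSum.add_apply, hx, hy]; rfl
  refine ⟨(injective_iff_map_eq_zero _).2 fun x hx => ?_, fun x => ?_⟩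
  · refine DFinsupp.ext fun n => Subtype.ext (DFinsupp.ext fun i => ?_)
    by_cases h : e i = n
    · subst h; rw [← key, hx]; rfl
    · exact (x n).2 i h
  · induction x using DirectSum.induction_on with
    | zero => exact ⟨0, map_zero _⟩
    | of i v =>
      exact ⟨DirectSum.of (fun n => homogeneous k V e n) (e i)
        ⟨_, of_mem_homogeneous k V e i v⟩, DirectSum.coeAddMonoidHom_of _ _ _⟩
    | add x y hx hy =>
      obtain ⟨x, rfl⟩ := hx
      obtain ⟨y, rfl⟩ := hy
      exact ⟨x + y, map_add _ _ _⟩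

section Yoneda

open Abelian

variable {C : Type u} [Category.{v} C] [Abelian C] [HasExt.{w} C]

/-- `Ext^*(X, X) = ⨁ n, Ext^n(X, X)`; it carries the Yoneda product. -/
def ExtAlg (X : C) : Type w := ⨁ n : ℕ, Ext X X n

/-- `Ext^*(M, X) = ⨁ n, Ext^n(M, X)`, a left module over `Ext^*(X, X)`. -/
def ExtMod (M X : C) : Type w := ⨁ n : ℕ, Ext M X n

theorem gradedMonoid_mk_comp_id {X Y : C} {i c : ℕ} (a : Ext X Y i) (h : i + 0 = c) :
    (GradedMonoid.mk c (a.comp (Ext.mk₀ (𝟙 Y)) h) : GradedMonoid (fun n => Ext X Y n)) =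
      GradedMonoid.mk i a := by
  subst h; simp

theorem gradedMonoid_mk_id_comp {X Y : C} {i c : ℕ} (a : Ext X Y i) (h : 0 + i = c) :
    (GradedMonoid.mk c ((Ext.mk₀ (𝟙 X)).comp a h) : GradedMonoid (fun n => Ext X Y n)) =
      GradedMonoid.mk i a := by
  have : c = i := by omega
  subst this; simp

theorem gradedMonoid_mk_assoc {X Y Z W : C} {i j k : ℕ} (a : Ext Z W i) (b : Ext Y Z j)
    (c : Ext X Y k) :
    (GradedMonoid.mk (i + j + k) (c.comp (b.comp a (add_comm j i)) (add_comm k (i + j))) :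
        GradedMonoid (fun n => Ext X W n)) =
      GradedMonoid.mk (i + (j + k)) ((c.comp b (add_comm k j)).comp a (add_comm (j + k) i)) := by
  refine Sigma.ext (add_assoc i j k) ?_
  rw [Ext.comp_assoc c b a (add_comm k j) (add_comm j i) (by omega)]
  have key : ∀ (m : ℕ) (h : k + (i + j) = m) (n : ℕ) (h' : k + (i + j) = n),
      HEq (c.comp (b.comp a (add_comm j i)) h) (c.comp (b.comp a (add_comm j i)) h') := by
    intro m h n h'; subst h; subst h'; rfl
  exact key _ (by omega) _ (by omega)

/-- The Yoneda product `x * y = x ∘ y` (first `y`, then `x`) on `⨁ n, Ext^n(X, X)`; Mathlib's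
`Ext.comp` takes its arguments in the opposite order. -/
noncomputable instance extGMul (X : C) : GradedMonoid.GMul (fun n : ℕ => Ext X X n) where
  mul {i j} x y := y.comp x (add_comm j i)

noncomputable instance extGOne (X : C) : GradedMonoid.GOne (fun n : ℕ => Ext X X n) where
  one := Ext.mk₀ (𝟙 X)

noncomputable instance extGMonoid (X : C) : GradedMonoid.GMonoid (fun n : ℕ => Ext X X n) where
  one_mul a := gradedMonoid_mk_comp_id a.2 _
  mul_one a := gradedMonoid_mk_id_comp a.2 _
  mul_assoc a b c := gradedMonoid_mk_assoc a.2 b.2 c.2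

noncomputable instance extGRing (X : C) : DirectSum.GRing (fun n : ℕ => Ext X X n) where
  mul_zero _ := Ext.zero_comp _ _ _ _ _
  zero_mul _ := Ext.comp_zero _ _ _ _ _
  mul_add _ _ _ := Ext.add_comp _ _ _ _
  add_mul _ _ _ := Ext.comp_add _ _ _ _
  __ := extGMonoid X
  natCast n := n • Ext.mk₀ (𝟙 X)
  natCast_zero := zero_smul _ _
  natCast_succ n := (add_smul n 1 _).trans (congrArg _ (one_smul ℕ _))
  intCast n := n • Ext.mk₀ (𝟙 X)
  intCast_ofNat _ := natCast_zsmul _ _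
  intCast_negSucc_ofNat _ := negSucc_zsmul _ _

/-- The action `x • y = x ∘ y` of `Ext^*(X, X)` on `Ext^*(M, X)`. -/
noncomputable instance extGmodule (M X : C) :
    DirectSum.Gmodule (fun n : ℕ => Ext X X n) (fun n : ℕ => Ext M X n) where
  smul {i j} x y := y.comp x (add_comm j i)
  one_smul a := gradedMonoid_mk_comp_id a.2 _
  mul_smul a b c := gradedMonoid_mk_assoc a.2 b.2 c.2
  smul_zero _ := Ext.zero_comp _ _ _ _ _
  zero_smul _ := Ext.comp_zero _ _ _ _ _
  smul_add _ _ _ := Ext.add_comp _ _ _ _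
  add_smul _ _ _ := Ext.comp_add _ _ _ _

noncomputable instance (X : C) : Ring (ExtAlg X) :=
  inferInstanceAs (Ring (⨁ n : ℕ, Ext X X n))

noncomputable instance (M X : C) : AddCommGroup (ExtMod M X) :=
  inferInstanceAs (AddCommGroup (⨁ n : ℕ, Ext M X n))

noncomputable instance (M X : C) : Module (ExtAlg X) (ExtMod M X) :=
  inferInstanceAs (Module (⨁ n : ℕ, Ext X X n) (⨁ n : ℕ, Ext M X n))

variable (k : Type*) [Field k] [Linear k C]

theorem gradedMonoid_mk_comp_smul_id {k : Type*} [Field k] [Linear k C] {X Y : C} {i c : ℕ}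
    (r : k) (a : Ext X Y i) (h : i + 0 = c) :
    (GradedMonoid.mk c (a.comp (r • Ext.mk₀ (𝟙 Y)) h) : GradedMonoid (fun n => Ext X Y n)) =
      GradedMonoid.mk i (r • a) := by
  subst h; simp

theorem gradedMonoid_mk_smul_id_comp {k : Type*} [Field k] [Linear k C] {X Y : C} {i c : ℕ}
    (r : k) (a : Ext X Y i) (h : 0 + i = c) :
    (GradedMonoid.mk c ((r • Ext.mk₀ (𝟙 X)).comp a h) : GradedMonoid (fun n => Ext X Y n)) =
      GradedMonoid.mk i (r • a) := by
  have : c = i := by omega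
  subst this; simp

noncomputable instance extGAlgebra (X : C) : DirectSum.GAlgebra k (fun n : ℕ => Ext X X n) where
  toFun := AddMonoidHom.mk' (fun r : k => r • Ext.mk₀ (𝟙 X)) (fun r s => add_smul r s _)
  map_one := one_smul _ _
  map_mul r s := by
    refine Sigma.ext (zero_add 0).symm (heq_of_eq ?_)
    change (r * s) • Ext.mk₀ (𝟙 X) =
      (s • Ext.mk₀ (𝟙 X)).comp (r • Ext.mk₀ (𝟙 X)) (add_comm 0 0)
    rw [Ext.smul_comp, Ext.comp_smul, Ext.comp_mk₀_id, smul_smul, mul_comm]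
  commutes r x :=
    (gradedMonoid_mk_comp_smul_id r x.2 (add_comm x.1 0)).trans
      (gradedMonoid_mk_smul_id_comp r x.2 (add_comm 0 x.1)).symm
  smul_def r x := (gradedMonoid_mk_comp_smul_id r x.2 (add_comm x.1 0)).symm

noncomputable instance (X : C) : Algebra k (ExtAlg X) :=
  inferInstanceAs (Algebra k (⨁ n : ℕ, Ext X X n))

noncomputable instance (M X : C) : Module k (ExtMod M X) :=
  inferInstanceAs (Module k (⨁ n : ℕ, Ext M X n))

/-- The inclusion `Ext^n(M, X) → Ext^*(M, X)`. -/
noncomputable def ExtMod.of (M X : C) (n : ℕ) : Ext M X n →+ ExtMod M X :=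
  DirectSum.of (fun n : ℕ => Ext M X n) n

/-- The inclusion `Ext^n(X, X) → Ext^*(X, X)`. -/
noncomputable def ExtAlg.of (X : C) (n : ℕ) : Ext X X n →+ ExtAlg X :=
  DirectSum.of (fun n : ℕ => Ext X X n) n

theorem ExtMod.of_smul_of {M X : C} {i j : ℕ} (x : Ext X X i) (y : Ext M X j) :
    ExtAlg.of X i x • ExtMod.of M X j y = ExtMod.of M X (i + j) (y.comp x (add_comm j i)) :=
  DirectSum.Gmodule.of_smul_of (fun n : ℕ => Ext X X n) (fun n : ℕ => Ext M X n) x y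

theorem ExtAlg.of_mul_of {X : C} {i j : ℕ} (x : Ext X X i) (y : Ext X X j) :
    ExtAlg.of X i x * ExtAlg.of X j y = ExtAlg.of X (i + j) (y.comp x (add_comm j i)) :=
  DirectSum.of_mul_of (A := fun n : ℕ => Ext X X n) x y

theorem ExtMod.induction {M X : C} {p : ExtMod M X → Prop} (x : ExtMod M X) (h0 : p 0)
    (hof : ∀ n y, p (ExtMod.of M X n y)) (hadd : ∀ y z, p y → p z → p (y + z)) : p x :=
  DirectSum.induction_on x h0 hof hadd

theorem ExtAlg.induction {X : C} {p : ExtAlg X → Prop} (x : ExtAlg X) (h0 : p 0)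
    (hof : ∀ n y, p (ExtAlg.of X n y)) (hadd : ∀ y z, p y → p z → p (y + z)) : p x :=
  DirectSum.induction_on x h0 hof hadd

/-- The grading of `Ext^*(X, X)` by cohomological degree. -/
noncomputable def extAlgGrading (X : C) : ℕ → Submodule k (ExtAlg X) :=
  homogeneous k (fun n : ℕ => Ext X X n) id

/-- The grading of `Ext^*(M, X)` by cohomological degree (nothing in negative degrees). -/
noncomputable def extModGrading (M X : C) : ℤ → Submodule k (ExtMod M X) :=
  homogeneous k (fun n : ℕ => Ext M X n) (fun i : ℕ => (i : ℤ))

theorem ExtAlg.of_mem (X : C) (n : ℕ) (x : Ext X X n) :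
    ExtAlg.of X n x ∈ extAlgGrading k X n :=
  of_mem_homogeneous k (fun n : ℕ => Ext X X n) id n x

theorem ExtMod.of_mem (M X : C) (n : ℕ) (x : Ext M X n) :
    ExtMod.of M X n x ∈ extModGrading k M X n :=
  of_mem_homogeneous k (fun n : ℕ => Ext M X n) (fun i : ℕ => (i : ℤ)) n x

variable {k}

theorem ExtAlg.exists_of {X : C} {n : ℕ} {x : ExtAlg X} (hx : x ∈ extAlgGrading k X n) :
    ∃ y, ExtAlg.of X n y = x :=
  ⟨_, eq_of_of_mem_homogeneous (e := id) Function.injective_id hx⟩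

theorem ExtMod.exists_of {M X : C} {n : ℕ} {x : ExtMod M X}
    (hx : x ∈ extModGrading k M X n) : ∃ y, ExtMod.of M X n y = x :=
  ⟨_, eq_of_of_mem_homogeneous (e := fun i : ℕ => (i : ℤ)) Nat.cast_injective hx⟩

theorem ExtMod.eq_zero_of_neg {M X : C} {n : ℤ} (hn : n < 0) {x : ExtMod M X}
    (hx : x ∈ extModGrading k M X n) : x = 0 :=
  DFinsupp.ext fun i => hx i (by
    intro h
    have h' : (i : ℤ) = n := h
    omega)

variable (k)

noncomputable instance (X : C) : GradedAlgebra (extAlgGrading k X) where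
  toGradedMonoid :=
    { one_mem := ExtAlg.of_mem k X 0 (Ext.mk₀ (𝟙 X))
      mul_mem := by
        intro i j x y hx hy
        obtain ⟨x, rfl⟩ := ExtAlg.exists_of hx
        obtain ⟨y, rfl⟩ := ExtAlg.exists_of hy
        rw [ExtAlg.of_mul_of]
        exact ExtAlg.of_mem k X _ _ }
  toDecomposition :=
    (homogeneous_isInternal k (fun n : ℕ => Ext X X n) id).chooseDecomposition

theorem extModGrading_isInternal (M X : C) : DirectSum.IsInternal (extModGrading k M X) :=
  homogeneous_isInternal k (fun n : ℕ => Ext M X n) (fun i : ℕ => (i : ℤ))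

theorem extModGrading_smul_mem (M X : C) (i : ℕ) (j : ℤ) (a : ExtAlg X) (m : ExtMod M X)
    (ha : a ∈ extAlgGrading k X i) (hm : m ∈ extModGrading k M X j) :
    a • m ∈ extModGrading k M X (i + j) := by
  rcases lt_or_ge j 0 with hj | hj
  · rw [ExtMod.eq_zero_of_neg hj hm, smul_zero]; exact Submodule.zero_mem _
  · lift j to ℕ using hj
    obtain ⟨x, rfl⟩ := ExtAlg.exists_of ha
    obtain ⟨y, rfl⟩ := ExtMod.exists_of hm
    rw [ExtMod.of_smul_of]
    exact_mod_cast ExtMod.of_mem k M X (i + j) _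

theorem ExtAlg.smul_of (X : C) (n : ℕ) (r : k) (x : Ext X X n) :
    r • ExtAlg.of X n x = ExtAlg.of X n (r • x) :=
  ((DirectSum.lof k ℕ (fun n : ℕ => Ext _ X n) n).map_smul r x).symm

theorem ExtMod.smul_of (M X : C) (n : ℕ) (r : k) (x : Ext M X n) :
    r • ExtMod.of M X n x = ExtMod.of M X n (r • x) :=
  ((DirectSum.lof k ℕ (fun n : ℕ => Ext _ X n) n).map_smul r x).symm

instance (M X : C) : IsScalarTower k (ExtAlg X) (ExtMod M X) where
  smul_assoc r a m := by
    induction a using ExtAlg.induction with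
    | h0 => rw [smul_zero, zero_smul, smul_zero]
    | hadd y z hy hz => rw [smul_add, add_smul, hy, hz, add_smul, smul_add]
    | hof i x =>
      induction m using ExtMod.induction with
      | h0 => rw [smul_zero, smul_zero, smul_zero]
      | hadd y z hy hz => rw [smul_add, hy, hz, smul_add, smul_add]
      | hof j y =>
        rw [ExtAlg.smul_of, ExtMod.of_smul_of, ExtMod.of_smul_of, ExtMod.smul_of,
          Ext.comp_smul]

/-- Precomposition with `f : M ⟶ N`, as a map `Ext^*(N, X) → Ext^*(M, X)`. -/
noncomputable def ExtMod.mapAdd {M N : C} (f : M ⟶ N) (X : C) : ExtMod N X →+ ExtMod M X :=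
  DirectSum.map (fun n : ℕ => AddMonoidHom.mk' (fun y : Ext N X n => (Ext.mk₀ f).comp y (zero_add n))
    (fun y z => Ext.comp_add _ y z _))

theorem ExtMod.mapAdd_of {M N : C} (f : M ⟶ N) (X : C) (n : ℕ) (y : Ext N X n) :
    ExtMod.mapAdd f X (ExtMod.of N X n y) =
      ExtMod.of M X n ((Ext.mk₀ f).comp y (zero_add n)) :=
  DirectSum.map_of _ _ _

/-- Precomposition with `f : M ⟶ N`, as an `Ext^*(X, X)`-linear map. -/
noncomputable def ExtMod.map {M N : C} (f : M ⟶ N) (X : C) :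
    ExtMod N X →ₗ[ExtAlg X] ExtMod M X where
  toFun := ExtMod.mapAdd f X
  map_add' := map_add _
  map_smul' a m := by
    induction a using ExtAlg.induction with
    | h0 => simp only [zero_smul, map_zero]
    | hadd y z hy hz => simp only [add_smul, map_add, hy, hz]
    | hof i x =>
      induction m using ExtMod.induction with
      | h0 => simp only [smul_zero, map_zero]
      | hadd y z hy hz => simp only [smul_add, map_add, hy, hz]
      | hof j y =>
        simp only [RingHom.id_apply, ExtMod.of_smul_of, ExtMod.mapAdd_of]
        rw [Ext.comp_assoc _ _ _ (zero_add j) (add_comm j i) (by omega)]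

theorem ExtMod.map_of {M N : C} (f : M ⟶ N) (X : C) (n : ℕ) (y : Ext N X n) :
    ExtMod.map f X (ExtMod.of N X n y) =
      ExtMod.of M X n ((Ext.mk₀ f).comp y (zero_add n)) :=
  ExtMod.mapAdd_of f X n y

theorem ExtMod.map_mem {M N : C} (f : M ⟶ N) (X : C) (n : ℤ) (x : ExtMod N X)
    (hx : x ∈ extModGrading k N X n) : ExtMod.map f X x ∈ extModGrading k M X n := by
  rcases lt_or_ge n 0 with hn | hn
  · rw [ExtMod.eq_zero_of_neg hn hx, map_zero]; exact Submodule.zero_mem _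
  · lift n to ℕ using hn
    obtain ⟨y, rfl⟩ := ExtMod.exists_of hx
    rw [ExtMod.map_of]
    exact ExtMod.of_mem k M X n _

theorem ExtMod.map_id (M X : C) (x : ExtMod M X) : ExtMod.map (𝟙 M) X x = x := by
  induction x using ExtMod.induction with
  | h0 => rw [map_zero]
  | hadd y z hy hz => rw [map_add, hy, hz]
  | hof n y => rw [ExtMod.map_of, Ext.mk₀_id_comp]

theorem ExtMod.map_comp {M N L : C} (f : M ⟶ N) (g : N ⟶ L) (X : C) (x : ExtMod L X) :
    ExtMod.map (f ≫ g) X x = ExtMod.map f X (ExtMod.map g X x) := by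
  induction x using ExtMod.induction with
  | h0 => simp only [map_zero]
  | hadd y z hy hz => rw [map_add, hy, hz, map_add, map_add]
  | hof n y => rw [ExtMod.map_of, ExtMod.map_of, ExtMod.map_of, Ext.mk₀_comp_mk₀_assoc]

end Yoneda

/-! ## Graded modules over a positively graded algebra -/

section Graded

variable {k : Type v} [Field k] {A : Type u} [Ring A] [Algebra k A]

/-- A `ℤ`-graded left module `M = ⨁ n, M_n` over `A = ⨁ i, A_i`, with `A_i M_j ⊆ M_{i+j}`. The
`k`-structure is the one induced from `A`, because of `isScalarTower`. -/
structure GrMod (𝒜 : ℕ → Submodule k A) where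
  carrier : Type u
  [addCommGroup : AddCommGroup carrier]
  [moduleBase : Module k carrier]
  [module : Module A carrier]
  [isScalarTower : IsScalarTower k A carrier]
  deg : ℤ → Submodule k carrier
  isInternal : DirectSum.IsInternal deg
  smul_mem : ∀ (i : ℕ) (j : ℤ) (a : A) (m : carrier),
    a ∈ 𝒜 i → m ∈ deg j → a • m ∈ deg (i + j)

namespace GrMod

variable {𝒜 : ℕ → Submodule k A}

instance : CoeSort (GrMod 𝒜) (Type u) := ⟨GrMod.carrier⟩

attribute [instance] GrMod.addCommGroup GrMod.moduleBase GrMod.module GrMod.isScalarTower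

/-- The underlying ungraded `A`-module. -/
abbrev toModuleCat (M : GrMod 𝒜) : ModuleCat.{u} A := ModuleCat.of A M

/-- Homomorphisms of graded modules: `A`-linear maps that preserve degrees. -/
@[ext]
structure Hom (M N : GrMod 𝒜) where
  toLinearMap : M →ₗ[A] N
  map_mem : ∀ (n : ℤ) (m : M), m ∈ M.deg n → toLinearMap m ∈ N.deg n

instance : Category (GrMod 𝒜) where
  Hom := Hom
  id M := ⟨LinearMap.id, fun _ _ h => h⟩
  comp f g := ⟨g.toLinearMap.comp f.toLinearMap, fun n m h => g.map_mem n _ (f.map_mem n m h)⟩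

/-- The linear map underlying a morphism of graded modules. -/
def lin {M N : GrMod 𝒜} (f : M ⟶ N) : M →ₗ[A] N := Hom.toLinearMap f

theorem hom_ext {M N : GrMod 𝒜} {f g : M ⟶ N} (h : lin f = lin g) : f = g := Hom.ext h

/-- Every graded piece is finite-dimensional. -/
def LocallyFinite (M : GrMod 𝒜) : Prop := ∀ n : ℤ, FiniteDimensional k (M.deg n)

/-- `M` is generated in degree `s`: `M = A · M_s`. -/
def GeneratedIn (M : GrMod 𝒜) (s : ℤ) : Prop :=
  Submodule.span A (M.deg s : Set M) = ⊤

/-- A linear projective resolution `⋯ ⟶ P^1 ⟶ P^0 ⟶ M ⟶ 0` of `M` in the category of graded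
modules: an exact sequence in which `P^n` is projective and generated in degree `n`. -/
structure LinearResolution (M : GrMod 𝒜) where
  P : ℕ → GrMod 𝒜
  d : ∀ n : ℕ, P (n + 1) ⟶ P n
  ε : P 0 ⟶ M
  projective : ∀ n : ℕ, Module.Projective A (P n)
  generatedIn : ∀ n : ℕ, (P n).GeneratedIn n
  surjective : Function.Surjective (lin ε)
  exact_zero : Function.Exact (lin (d 0)) (lin ε)
  exact_succ : ∀ n : ℕ, Function.Exact (lin (d (n + 1))) (lin (d n))

/-- Koszul modules: locally finite graded modules that are generated in degree `0` and have a
linear projective resolution. -/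
def IsKoszul : ObjectProperty (GrMod 𝒜) := fun M =>
  M.LocallyFinite ∧ M.GeneratedIn 0 ∧ Nonempty (LinearResolution M)

end GrMod

variable (𝒜 : ℕ → Submodule k A)

/-- The category of Koszul `A`-modules, with the degree-preserving homomorphisms. -/
abbrev KoszulMod := (GrMod.IsKoszul (𝒜 := 𝒜)).FullSubcategory

variable [GradedAlgebra 𝒜]

/-- `A_0 = A / J`, `J = ⨁_{i ≥ 1} A_i`, as a graded `A`-module concentrated in degree `0`:
`A` acts through the projection `A → A_0`. -/
noncomputable def degZero : GrMod 𝒜 :=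
  letI : Module A (𝒜 0) := Module.compHom (𝒜 0) (GradedRing.projZeroRingHom' 𝒜)
  haveI : IsScalarTower k A (𝒜 0) := ⟨fun r a x => by
    change GradedRing.projZeroRingHom' 𝒜 (r • a) * x = r • (GradedRing.projZeroRingHom' 𝒜 a * x)
    rw [← smul_mul_assoc]
    congr 1
    refine Subtype.ext ?_
    simp [DirectSum.decompose_smul, DirectSum.smul_apply]⟩
  { carrier := 𝒜 0
    deg := fun n => if n = 0 then ⊤ else ⊥
    isInternal := by
      have key : ∀ x : ⨁ n : ℤ, ((if n = 0 then ⊤ else ⊥ : Submodule k (𝒜 0)) : Submodule k (𝒜 0)),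
          DirectSum.coeAddMonoidHom _ x = (x 0).1 := by
        intro x
        induction x using DirectSum.induction_on with
        | zero => rw [map_zero]; rfl
        | of n y =>
          rw [DirectSum.coeAddMonoidHom_of]
          by_cases h : n = 0
          · subst h; rw [DirectSum.of_eq_same]
          · have hy := y.2
            simp only [if_neg h, Submodule.mem_bot] at hy
            rw [DirectSum.of_eq_of_ne _ _ _ (Ne.symm h), hy]; rfl
        | add x y hx hy => rw [map_add, DirectSum.add_apply, hx, hy]; rfl
      refine ⟨(injective_iff_map_eq_zero _).2 fun x hx => ?_, fun x =>
        ⟨DirectSum.of (fun n : ℤ => ((if n = 0 then ⊤ else ⊥ : Submodule k (𝒜 0)) :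
          Submodule k (𝒜 0))) 0 ⟨x, by simp⟩, DirectSum.coeAddMonoidHom_of _ _ _⟩⟩
      refine DFinsupp.ext fun n => Subtype.ext ?_
      by_cases h : n = 0
      · subst h; rw [← key, hx]; rfl
      · have hy := (x n).2
        simp only [if_neg h, Submodule.mem_bot] at hy
        exact hy
    smul_mem := by
      intro i j a m ha hm
      by_cases hj : j = 0
      · by_cases hi : i = 0
        · subst hi hj; simp
        · have h0 : GradedRing.projZeroRingHom' 𝒜 a = 0 := by
            refine Subtype.ext ?_
            simpa using DirectSum.decompose_of_mem_ne 𝒜 ha hi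
          have h1 : a • m = 0 := by
            change GradedRing.projZeroRingHom' 𝒜 a * m = 0
            rw [h0, zero_mul]
          rw [h1]; exact Submodule.zero_mem _
      · rw [if_neg hj, Submodule.mem_bot] at hm
        rw [hm, smul_zero]; exact Submodule.zero_mem _ }

/-- `A` is a Koszul algebra if `A_0` is a Koszul `A`-module. -/
def IsKoszulAlgebra : Prop := (degZero 𝒜).IsKoszul

/-- `Γ = Ext_A^*(A_0, A_0)`. -/
abbrev Gam : Type u := ExtAlg (degZero 𝒜).toModuleCat

/-- The grading of `Γ = Ext_A^*(A_0, A_0)` by cohomological degree. -/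
noncomputable abbrev gamGrading : ℕ → Submodule k (Gam 𝒜) := extAlgGrading k (degZero 𝒜).toModuleCat

/-- `E(M) = Ext_A^*(M, A_0)` as a graded `Γ`-module. -/
noncomputable def extObj (M : GrMod 𝒜) : GrMod (gamGrading 𝒜) where
  carrier := ExtMod M.toModuleCat (degZero 𝒜).toModuleCat
  deg := extModGrading k M.toModuleCat (degZero 𝒜).toModuleCat
  isInternal := extModGrading_isInternal k M.toModuleCat (degZero 𝒜).toModuleCat
  smul_mem := extModGrading_smul_mem k M.toModuleCat (degZero 𝒜).toModuleCat

/-- `E(f) : E(N) ⟶ E(M)` for `f : M ⟶ N`. -/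
noncomputable def extMap {M N : GrMod 𝒜} (f : M ⟶ N) : extObj 𝒜 N ⟶ extObj 𝒜 M :=
  GrMod.Hom.mk (M := extObj 𝒜 N) (N := extObj 𝒜 M)
    (ExtMod.map (ModuleCat.ofHom (GrMod.lin f)) (degZero 𝒜).toModuleCat)
    (ExtMod.map_mem k (ModuleCat.ofHom (GrMod.lin f)) (degZero 𝒜).toModuleCat)

theorem extMap_id (M : GrMod 𝒜) : extMap 𝒜 (𝟙 M) = 𝟙 (extObj 𝒜 M) :=
  GrMod.Hom.ext (LinearMap.ext (ExtMod.map_id M.toModuleCat (degZero 𝒜).toModuleCat))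

theorem extMap_comp {M N L : GrMod 𝒜} (f : M ⟶ N) (g : N ⟶ L) :
    extMap 𝒜 (f ≫ g) = extMap 𝒜 g ≫ extMap 𝒜 f :=
  GrMod.Hom.ext (LinearMap.ext (ExtMod.map_comp (ModuleCat.ofHom (GrMod.lin f))
    (ModuleCat.ofHom (GrMod.lin g)) (degZero 𝒜).toModuleCat))

/-- `E = Ext_A^*(-, A_0)`, a contravariant functor from graded `A`-modules to graded
`Γ`-modules. -/
noncomputable def extFunctor : (GrMod 𝒜)ᵒᵖ ⥤ GrMod (gamGrading 𝒜) where
  obj M := extObj 𝒜 M.unop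
  map f := extMap 𝒜 f.unop
  map_id M := extMap_id 𝒜 M.unop
  map_comp f g := extMap_comp 𝒜 g.unop f.unop

/-- The restriction of `E` to Koszul modules, for an `E` that preserves Koszul modules. -/
noncomputable def koszulFunctor
    (hE : ∀ M : GrMod 𝒜, GrMod.IsKoszul M → GrMod.IsKoszul (extObj 𝒜 M)) :
    (KoszulMod 𝒜)ᵒᵖ ⥤ KoszulMod (gamGrading 𝒜) :=
  ObjectProperty.lift _ ((GrMod.IsKoszul (𝒜 := 𝒜)).ι.op ⋙ extFunctor 𝒜)
    (fun M => hE M.unop.obj M.unop.property)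

end Graded

/-- Every short exact sequence `0 → P → Q → N → 0` of left `R`-modules with `P` and `Q` projective
splits. -/
def LeftSplitting (R : Type u) [Ring R] : Prop :=
  ∀ (P Q N : Type u) [AddCommGroup P] [AddCommGroup Q] [AddCommGroup N]
    [Module R P] [Module R Q] [Module R N] (f : P →ₗ[R] Q) (g : Q →ₗ[R] N),
    Function.Injective f → Function.Exact f g → Function.Surjective g →
    Module.Projective R P → Module.Projective R Q →
    ∃ s : N →ₗ[R] Q, g.comp s = LinearMap.id

/-- The splitting condition (S), for left and for right `R`-modules. -/
def SplittingCondition (R : Type u) [Ring R] : Prop :=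
  LeftSplitting R ∧ LeftSplitting Rᵐᵒᵖ

end GenKoszul

open GenKoszul

namespace GenKoszul

/-! Write `J M` for the part of positive degree of a graded module `M`, so that `tail M` is `J M`
with degrees lowered by one and `Head M` is `M / J M`. Koszulness is treated coinductively
(`IsKoszul.coinduction`): only one step of a resolution, the passage from a module to the shifted
kernel (syzygy) of a cover, is ever looked at.

The syzygy of a Koszul module starts in positive degree, so the cover is an isomorphism in degree 0
and `M_0` is projective over `A_0`. This is where (S) enters: an injection `K → L` of Koszul modules
splits in degree 0, hence lifts to a split injection of covers. Consequently cokernels of such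
injections are Koszul (`IsKoszul.cokernel`), and `Ext^n(L, A_0) → Ext^n(K, A_0)` is onto
(`IsKoszul.ext_surjective`). Applied to the syzygy of `M` inside `tail P`, for a cover `P → M`, the
first fact shows that `tail M` is Koszul and the second that the restriction `E(M) → E(J M)` is
zero.

The long exact sequence of `0 → J M → M → M / J M → 0` therefore breaks up into `0 → E(tail M) → E(M
/ J M) → E(M) → 0`, whose first map raises degrees by one (`IsKoszul.ext_ses`). As `M / J M` is a
summand of a power of `A_0`, the middle term is a projective `Γ`-module generated in degree 0. So
`E(tail M)` is the shifted syzygy of `E(M)`, and coinduction proves that `E(M)` is Koszul.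

The hypotheses pass to `Γ`: `Γ_0` is opposite to `A_0`, condition (S) is two-sided, and `Γ_0 ≅ E(A)`
is Koszul because `A` is (`IsGenKoszul.gam`). Hence `E` can be applied twice. In degree 0, `M_0` is
a finitely generated projective `A_0`-module, so evaluation identifies it with `Hom_Γ(E(M), Γ_0)`.
In degree `n + 1`, the connecting map of the sequence above identifies `Ext_Γ^n(E(tail M), Γ_0)`
with `Ext_Γ^{n+1}(E(M), Γ_0)`, so recursion on `n` gives `θ : M ≅ E(E(M))`, natural in `M`. The case
`M = A` gives the algebra isomorphism, over which every `θ` is linear. Naturality of `θ` for `A` and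
for `Γ` makes `E` fully faithful, and `θ` for `Γ`, carried along `A ≅ Ext_Γ^*(Γ_0, Γ_0)`, makes it
essentially surjective. -/

theorem isInternal_of_projections {k V : Type*} [Field k] [AddCommGroup V] [Module k V]
    (deg : ℤ → Submodule k V) (π : ℤ → V →ₗ[k] V)
    (hself : ∀ n m, m ∈ deg n → π n m = m)
    (hne : ∀ n j m, m ∈ deg n → j ≠ n → π j m = 0)
    (hsum : ∀ m, m ∈ ⨆ n, deg n) : DirectSum.IsInternal deg := by
  rw [DirectSum.isInternal_submodule_iff_iSupIndep_and_iSup_eq_top]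
  refine ⟨iSupIndep_def.2 fun n => Submodule.disjoint_def.2 fun x hx hx' => ?_,
    eq_top_iff.2 fun m _ => hsum m⟩
  have h : (⨆ j, ⨆ (_ : j ≠ n), deg j) ≤ LinearMap.ker (π n) :=
    iSup_le fun j => iSup_le fun hj m hm => hne j n m hm (Ne.symm hj)
  rw [← hself n x hx]
  exact h hx'

/-! ### Homogeneous components, shifts, homogeneous submodules and syzygies. -/

namespace GrMod

variable {k : Type v} [Field k] {A : Type u} [Ring A] [Algebra k A] {𝒜 : ℕ → Submodule k A}

/-- The projection of a graded module onto its component of degree `n`. -/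
noncomputable def pr (M : GrMod 𝒜) (n : ℤ) : M →ₗ[k] M :=
  letI := M.isInternal.chooseDecomposition
  (M.deg n).subtype ∘ₗ DirectSum.component k ℤ (fun n => M.deg n) n ∘ₗ
    (DirectSum.decomposeLinearEquiv M.deg).toLinearMap

theorem pr_mem (M : GrMod 𝒜) (n : ℤ) (m : M) : M.pr n m ∈ M.deg n := by
  simp [pr]

theorem pr_of_mem {M : GrMod 𝒜} {n : ℤ} {m : M} (hm : m ∈ M.deg n) : M.pr n m = m := by
  let := M.isInternal.chooseDecomposition
  exact DirectSum.decompose_of_mem_same M.deg hm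

theorem pr_of_mem_ne {M : GrMod 𝒜} {n j : ℤ} {m : M} (hm : m ∈ M.deg n) (h : j ≠ n) :
    M.pr j m = 0 := by
  let := M.isInternal.chooseDecomposition
  exact DirectSum.decompose_of_mem_ne M.deg hm h.symm

theorem exists_eq_sum_pr (M : GrMod 𝒜) (m : M) : ∃ s : Finset ℤ, m = ∑ n ∈ s, M.pr n m := by
  classical
  let := M.isInternal.chooseDecomposition
  exact ⟨_, (DirectSum.sum_support_decompose M.deg m).symm⟩

theorem induction_deg {M : GrMod 𝒜} {p : M → Prop} (m : M) (h0 : p 0)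
    (hdeg : ∀ n x, x ∈ M.deg n → p x) (hadd : ∀ x y, p x → p y → p (x + y)) : p m := by
  obtain ⟨s, hs⟩ := M.exists_eq_sum_pr m
  rw [hs]
  exact Finset.sum_induction _ p hadd h0 fun n _ => hdeg n _ (M.pr_mem n m)

theorem ext_pr {M : GrMod 𝒜} {x y : M} (h : ∀ n, M.pr n x = M.pr n y) : x = y := by
  rw [← sub_eq_zero]
  obtain ⟨s, hs⟩ := M.exists_eq_sum_pr (x - y)
  rw [hs]
  exact Finset.sum_eq_zero fun n _ => by rw [map_sub, h, sub_self]

theorem mem_deg_iff {M : GrMod 𝒜} {n : ℤ} {m : M} : m ∈ M.deg n ↔ M.pr n m = m :=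
  ⟨pr_of_mem, fun h => h ▸ M.pr_mem n m⟩

theorem eq_zero_of_mem_deg {M : GrMod 𝒜} {n j : ℤ} (h : n ≠ j) {m : M} (hn : m ∈ M.deg n)
    (hj : m ∈ M.deg j) : m = 0 := by
  rw [← pr_of_mem hn, pr_of_mem_ne hj h]

theorem lin_pr {M N : GrMod 𝒜} (f : M →ₗ[A] N) (d : ℤ)
    (hf : ∀ n m, m ∈ M.deg n → f m ∈ N.deg (n + d)) (n : ℤ) (m : M) :
    N.pr (n + d) (f m) = f (M.pr n m) := by
  induction m using induction_deg with
  | h0 => simp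
  | hadd x y hx hy => simp only [map_add, hx, hy]
  | hdeg j x hx =>
    by_cases h : n = j
    · subst h; rw [pr_of_mem hx, pr_of_mem (hf _ _ hx)]
    · rw [pr_of_mem_ne hx h, map_zero, pr_of_mem_ne (hf _ _ hx) (by omega)]

theorem pr_lin {M N : GrMod 𝒜} (f : M ⟶ N) (n : ℤ) (m : M) :
    N.pr n (lin f m) = lin f (M.pr n m) := by
  simpa using lin_pr (lin f) 0 (fun n m h => by rw [add_zero]; exact Hom.map_mem f n m h) n m

theorem lin_mem {M N : GrMod 𝒜} (f : M ⟶ N) {n : ℤ} {m : M} (h : m ∈ M.deg n) :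
    lin f m ∈ N.deg n := Hom.map_mem f n m h

@[simp] theorem lin_id (M : GrMod 𝒜) (m : M) : lin (𝟙 M) m = m := rfl
@[simp] theorem lin_comp {M N L : GrMod 𝒜} (f : M ⟶ N) (g : N ⟶ L) (m : M) :
    lin (f ≫ g) m = lin g (lin f m) := rfl

/-- Build a morphism of graded modules. -/
def mkHom {M N : GrMod 𝒜} (f : M →ₗ[A] N) (h : ∀ n m, m ∈ M.deg n → f m ∈ N.deg n) : M ⟶ N :=
  Hom.mk f h

theorem hom_ext_apply {M N : GrMod 𝒜} {f g : M ⟶ N} (h : ∀ m, lin f m = lin g m) : f = g :=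
  hom_ext (LinearMap.ext h)

theorem lin_algebraMap (M : GrMod 𝒜) (r : k) (m : M) : algebraMap k A r • m = r • m :=
  algebraMap_smul A r m

theorem lin_smul_base {M N : GrMod 𝒜} (f : M →ₗ[A] N) (r : k) (m : M) : f (r • m) = r • f m := by
  rw [← lin_algebraMap, map_smul, lin_algebraMap]

/-- An isomorphism of graded modules from a degree-preserving linear bijection. -/
noncomputable def isoOfBijective {M N : GrMod 𝒜} (f : M ⟶ N) (hf : Function.Bijective (lin f)) :
    M ≅ N where
  hom := f
  inv := mkHom (LinearEquiv.ofBijective (lin f) hf).symm.toLinearMap (by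
    intro n m hm
    obtain ⟨x, rfl⟩ := hf.2 m
    change (LinearEquiv.ofBijective (lin f) hf).symm (lin f x) ∈ _
    have : (LinearEquiv.ofBijective (lin f) hf).symm (lin f x) = x :=
      (LinearEquiv.ofBijective (lin f) hf).symm_apply_apply x
    rw [this, mem_deg_iff]
    exact hf.1 (by rw [← pr_lin, pr_of_mem hm]))
  hom_inv_id := hom_ext_apply fun m => (LinearEquiv.ofBijective (lin f) hf).symm_apply_apply m
  inv_hom_id := hom_ext_apply fun m => (LinearEquiv.ofBijective (lin f) hf).apply_symm_apply m

theorem iso_bijective {M N : GrMod 𝒜} (e : M ≅ N) : Function.Bijective (lin e.hom) := by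
  refine Function.bijective_iff_has_inverse.2 ⟨lin e.inv, fun x => ?_, fun x => ?_⟩
  · rw [← lin_comp, e.hom_inv_id, lin_id]
  · rw [← lin_comp, e.inv_hom_id, lin_id]

/-! ### Constructions of graded modules -/

/-- The graded module with the same underlying module and `(M.shift d)_n = M_{n + d}`. -/
def shift (M : GrMod 𝒜) (d : ℤ) : GrMod 𝒜 where
  carrier := M
  deg n := M.deg (n + d)
  isInternal := isInternal_of_projections _ (fun n => M.pr (n + d)) (fun _ _ h => pr_of_mem h)
    (fun _ _ _ h hj => pr_of_mem_ne h (by omega)) (fun m => by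
      obtain ⟨s, hs⟩ := M.exists_eq_sum_pr m
      rw [hs]
      refine Submodule.sum_mem _ fun n _ => Submodule.mem_iSup_of_mem (n - d) ?_
      rw [sub_add_cancel]
      exact M.pr_mem n m)
  smul_mem i j a m ha hm := by
    rw [add_assoc]
    exact M.smul_mem i (j + d) a m ha hm

/-- A homogeneous submodule as a graded module. -/
def ofSub (M : GrMod 𝒜) (N : Submodule A M) (hN : ∀ n, ∀ m ∈ N, M.pr n m ∈ N) : GrMod 𝒜 where
  carrier := N
  deg n := (M.deg n).comap (N.subtype.restrictScalars k)
  isInternal := isInternal_of_projections _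
    (fun n => (M.pr n).restrict (p := N.restrictScalars k) (q := N.restrictScalars k) (hN n))
    (fun _ _ h => Subtype.ext (pr_of_mem h)) (fun _ _ _ h hj => Subtype.ext (pr_of_mem_ne h hj))
    (fun m => by
      obtain ⟨s, hs⟩ := M.exists_eq_sum_pr m.1
      have : m = ∑ n ∈ s, (⟨M.pr n m.1, hN n _ m.2⟩ : N) := by
        refine Subtype.ext ?_
        rw [AddSubmonoidClass.coe_finsetSum]; exact hs
      rw [this]
      exact Submodule.sum_mem _ fun n _ => Submodule.mem_iSup_of_mem n (M.pr_mem n m.1))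
  smul_mem i j a m ha hm := M.smul_mem i j a m.1 ha hm

/-- The inclusion of a homogeneous submodule. -/
def ofSubι (M : GrMod 𝒜) (N : Submodule A M) (hN : ∀ n, ∀ m ∈ N, M.pr n m ∈ N) :
    M.ofSub N hN ⟶ M :=
  mkHom (M := M.ofSub N hN) N.subtype fun _ _ h => h

/-- Finite powers of a graded module. -/
def pow (M : GrMod 𝒜) (r : ℕ) : GrMod 𝒜 where
  carrier := Fin r → M
  deg n := Submodule.pi Set.univ fun _ => M.deg n
  isInternal := isInternal_of_projections _
    (fun n => LinearMap.pi fun i => M.pr n ∘ₗ LinearMap.proj i)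
    (fun _ _ h => funext fun i => pr_of_mem (h i trivial))
    (fun _ _ _ h hj => funext fun i => pr_of_mem_ne (h i trivial) hj)
    (fun m => by
      rw [← Finset.univ_sum_single m]
      refine Submodule.sum_mem _ fun i _ => ?_
      obtain ⟨s, hs⟩ := M.exists_eq_sum_pr (m i)
      rw [hs, ← LinearMap.coe_single k, map_sum]
      refine Submodule.sum_mem _ fun n _ => Submodule.mem_iSup_of_mem n fun j _ => ?_
      by_cases h : j = i
      · subst h; simpa using M.pr_mem n (m j)
      · simp [h])
  smul_mem i j a m ha hm l _ := M.smul_mem i j a (m l) ha (hm l trivial)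

theorem kernel_pr {P N : GrMod 𝒜} (f : P ⟶ N) (n : ℤ) (m : P) (hm : m ∈ LinearMap.ker (lin f)) :
    P.pr n m ∈ LinearMap.ker (lin f) := by
  rw [LinearMap.mem_ker] at hm ⊢
  rw [← pr_lin, hm, map_zero]

/-- The kernel of a graded map, shifted so that its elements of degree one get degree zero. -/
def syz {P N : GrMod 𝒜} (f : P ⟶ N) : GrMod 𝒜 :=
  (P.ofSub (LinearMap.ker (lin f)) (kernel_pr f)).shift 1

/-- The inclusion of the kernel; it raises degrees by one. -/
def syzι {P N : GrMod 𝒜} (f : P ⟶ N) : syz f →ₗ[A] P := (LinearMap.ker (lin f)).subtype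

theorem syzι_injective {P N : GrMod 𝒜} (f : P ⟶ N) : Function.Injective (syzι f) :=
  Subtype.val_injective

theorem mem_syz_deg {P N : GrMod 𝒜} (f : P ⟶ N) {n : ℤ} {x : syz f} :
    x ∈ (syz f).deg n ↔ syzι f x ∈ P.deg (n + 1) := Iff.rfl

theorem lin_syzι {P N : GrMod 𝒜} (f : P ⟶ N) (x : syz f) : lin f (syzι f x) = 0 := x.2

theorem exact_syzι {P N : GrMod 𝒜} (f : P ⟶ N) : Function.Exact (syzι f) (lin f) := fun x =>
  ⟨fun h => ⟨⟨x, h⟩, rfl⟩, by rintro ⟨y, rfl⟩; exact y.2⟩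

/-- Lift a degree-one map along the inclusion of the kernel. -/
def syzLift {P N K : GrMod 𝒜} (f : P ⟶ N) (g : K →ₗ[A] P)
    (hg : ∀ n m, m ∈ K.deg n → g m ∈ P.deg (n + 1)) (h : ∀ m, lin f (g m) = 0) : K ⟶ syz f :=
  mkHom (N := syz f) (g.codRestrict (LinearMap.ker (lin f)) h) fun n m hm => hg n m hm

/-- The map induced on kernels. -/
def syzMap {P N P' N' : GrMod 𝒜} (f : P ⟶ N) (f' : P' ⟶ N') (α : P ⟶ P')
    (h : ∀ x, lin f x = 0 → lin f' (lin α x) = 0) : syz f ⟶ syz f' :=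
  syzLift f' (lin α ∘ₗ syzι f) (fun _ _ hm => lin_mem α hm) fun m => h _ m.2

@[simp] theorem syzι_syzMap {P N P' N' : GrMod 𝒜} (f : P ⟶ N) (f' : P' ⟶ N') (α : P ⟶ P')
    (h : ∀ x, lin f x = 0 → lin f' (lin α x) = 0) (m : syz f) :
    syzι f' (lin (syzMap f f' α h) m) = lin α (syzι f m) := rfl

end GrMod
end GenKoszul

/-! ### Generation in one degree, finiteness, and the component of degree zero. -/

namespace GenKoszul
namespace GrMod

variable {k : Type v} [Field k] {A : Type u} [Ring A] [Algebra k A] {𝒜 : ℕ → Submodule k A}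

theorem GeneratedIn.of_surjective {M N : GrMod 𝒜} {s : ℤ} (hM : M.GeneratedIn s) (f : M ⟶ N)
    (hf : Function.Surjective (lin f)) : N.GeneratedIn s := by
  unfold GeneratedIn at hM ⊢
  rw [eq_top_iff, ← LinearMap.range_eq_top.2 hf, ← Submodule.map_top, ← hM, Submodule.map_span]
  refine Submodule.span_mono ?_
  rintro _ ⟨x, hx, rfl⟩
  exact lin_mem f hx

theorem GeneratedIn.shift {M : GrMod 𝒜} {s d t : ℤ} (hM : M.GeneratedIn s) (h : t + d = s) :
    (M.shift d).GeneratedIn t := by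
  subst h; exact hM

theorem LocallyFinite.of_surjective {M N : GrMod 𝒜} (hM : M.LocallyFinite) (f : M ⟶ N)
    (hf : Function.Surjective (lin f)) : N.LocallyFinite := fun n => by
  have := hM n
  refine Module.Finite.of_surjective (M := M.deg n)
    (((lin f).restrictScalars k).restrict (p := M.deg n) (q := N.deg n)
      fun m hm => lin_mem f hm) fun y => ?_
  obtain ⟨x, hx⟩ := hf y.1
  refine ⟨⟨M.pr n x, M.pr_mem n x⟩, Subtype.ext ?_⟩
  change lin f (M.pr n x) = y.1
  rw [← pr_lin, hx, pr_of_mem y.2]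

theorem LocallyFinite.of_injective {M N : GrMod 𝒜} (hN : N.LocallyFinite) (f : M →ₗ[A] N) (d : ℤ)
    (hd : ∀ n m, m ∈ M.deg n → f m ∈ N.deg (n + d))
    (hf : Function.Injective f) : M.LocallyFinite := fun n => by
  have := hN (n + d)
  refine Module.Finite.of_injective (N := N.deg (n + d))
    ((f.restrictScalars k).restrict (p := M.deg n) (q := N.deg (n + d)) fun m hm => hd n m hm)
    fun x y h => Subtype.ext (hf (congrArg Subtype.val h))

variable [GradedAlgebra 𝒜]

theorem pr_smul {M : GrMod 𝒜} {i : ℕ} {a : A} (ha : a ∈ 𝒜 i) (n : ℤ) (m : M) :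
    M.pr n (a • m) = a • M.pr (n - i) m := by
  induction m using induction_deg with
  | h0 => simp
  | hadd x y hx hy => simp only [smul_add, map_add, hx, hy]
  | hdeg j x hx =>
    by_cases h : n = i + j
    · subst h; rw [pr_of_mem (M.smul_mem _ _ _ _ ha hx), add_sub_cancel_left, pr_of_mem hx]
    · rw [pr_of_mem_ne (M.smul_mem _ _ _ _ ha hx) h, pr_of_mem_ne hx (by omega), smul_zero]

theorem pr_smul_of_mem {M : GrMod 𝒜} {s : ℤ} {m : M} (hm : m ∈ M.deg s) (a : A) (n : ℕ) :
    M.pr (n + s) (a • m) = (decompose 𝒜 a n : A) • m := by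
  induction a using DirectSum.Decomposition.inductionOn 𝒜 with
  | zero => simp
  | add x y hx hy => simp only [add_smul, map_add, hx, hy, decompose_add, DirectSum.add_apply,
      Submodule.coe_add]
  | homogeneous x =>
    rename_i i
    rw [pr_smul x.2]
    by_cases h : i = n
    · subst h
      rw [add_sub_cancel_left, pr_of_mem hm, DirectSum.decompose_of_mem_same 𝒜 x.2]
    · rw [DirectSum.decompose_of_mem_ne 𝒜 x.2 h, pr_of_mem_ne hm (by omega), zero_smul, smul_zero]

theorem pr_smul_of_mem_of_lt {M : GrMod 𝒜} {s : ℤ} {m : M} (hm : m ∈ M.deg s) (a : A) {n : ℤ}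
    (hn : n < s) : M.pr n (a • m) = 0 := by
  induction a using DirectSum.Decomposition.inductionOn 𝒜 with
  | zero => simp
  | add x y hx hy => simp only [add_smul, map_add, hx, hy, add_zero]
  | homogeneous x => rw [pr_smul x.2, pr_of_mem_ne hm (by omega), smul_zero]

/-- The components of negative degree vanish. -/
def Nonneg (M : GrMod 𝒜) : Prop := ∀ n < 0, ∀ m ∈ M.deg n, m = 0

theorem GeneratedIn.eq_zero {M : GrMod 𝒜} {s : ℤ} (hM : M.GeneratedIn s) {n : ℤ} (hn : n < s)
    {m : M} (hm : m ∈ M.deg n) : m = 0 := by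
  have h : m ∈ Submodule.span A (M.deg s : Set M) := hM ▸ trivial
  obtain ⟨r, f, g, rfl⟩ := Submodule.mem_span_set'.1 h
  rw [← pr_of_mem hm, map_sum]
  exact Finset.sum_eq_zero fun i _ => pr_smul_of_mem_of_lt (g i).2 _ hn

theorem GeneratedIn.nonneg {M : GrMod 𝒜} (hM : M.GeneratedIn 0) : M.Nonneg :=
  fun _ hn _ hm => hM.eq_zero hn hm

theorem GeneratedIn.hom_ext {M N : GrMod 𝒜} {s : ℤ} (hM : M.GeneratedIn s) {f g : M →ₗ[A] N}
    (h : ∀ m ∈ M.deg s, f m = g m) : f = g :=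
  LinearMap.ext_on hM h

/-- In a sum of terms `a • m` with `m` of degree 0, the component of degree `n` only sees the degree
`n` part of each `a`; hence `M_n = A_n M_0`. -/
theorem GeneratedIn.deg_le {M : GrMod 𝒜} (hM : M.GeneratedIn 0) (n : ℕ) :
    M.deg n ≤ Submodule.map₂ (Algebra.lsmul k k (M : Type u) : A →ₐ[k] Module.End k M).toLinearMap
      (𝒜 n) (M.deg 0) := by
  intro m hm
  have h : m ∈ Submodule.span A (M.deg 0 : Set M) := hM ▸ trivial
  obtain ⟨r, f, g, rfl⟩ := Submodule.mem_span_set'.1 h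
  rw [← pr_of_mem hm, map_sum]
  refine Submodule.sum_mem _ fun i _ => ?_
  have := pr_smul_of_mem (g i).2 (f i) n
  rw [add_zero] at this
  rw [this]
  exact Submodule.apply_mem_map₂ (Algebra.lsmul k k (M : Type u)).toLinearMap
    (decompose 𝒜 (f i) n).2 (g i).2

theorem GeneratedIn.locallyFinite {M : GrMod 𝒜} (hM : M.GeneratedIn 0)
    (hA : ∀ i, FiniteDimensional k (𝒜 i)) (h0 : FiniteDimensional k (M.deg 0)) :
    M.LocallyFinite := fun n => by
  rcases lt_or_ge n 0 with hn | hn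
  · have : M.deg n = ⊥ := (Submodule.eq_bot_iff _).2 fun m hm => hM.eq_zero hn hm
    rw [this]; infer_instance
  · lift n to ℕ using hn
    have h := (Module.Finite.iff_fg.1 (hA n)).map₂
      (Algebra.lsmul k k (M : Type u) : A →ₐ[k] Module.End k M).toLinearMap
      (Module.Finite.iff_fg.1 h0)
    have := Module.Finite.iff_fg.2 h
    exact Submodule.finiteDimensional_of_le (hM.deg_le n)

theorem pr_zero_smul {M : GrMod 𝒜} (hM : M.Nonneg) (a : A) (m : M) :
    M.pr 0 (a • m) = (decompose 𝒜 a 0 : A) • M.pr 0 m := by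
  induction m using induction_deg with
  | h0 => simp
  | hadd x y hx hy => simp only [smul_add, map_add, hx, hy]
  | hdeg j x hx =>
    rcases lt_trichotomy j 0 with h | rfl | h
    · rw [hM j h x hx]; simp
    · rw [pr_of_mem hx]; simpa using pr_smul_of_mem hx a 0
    · rw [pr_of_mem_ne hx h.ne, smul_zero, pr_smul_of_mem_of_lt hx a h]

instance (M : GrMod 𝒜) : Module (𝒜 0) (M.deg 0) where
  smul a m := ⟨a.1 • m.1, by simpa using M.smul_mem 0 0 _ _ a.2 m.2⟩
  one_smul m := Subtype.ext (one_smul A m.1)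
  mul_smul a b m := Subtype.ext (mul_smul a.1 b.1 m.1)
  smul_zero a := Subtype.ext (smul_zero a.1)
  zero_smul m := Subtype.ext (zero_smul A m.1)
  smul_add a m n := Subtype.ext (smul_add a.1 m.1 n.1)
  add_smul a b m := Subtype.ext (add_smul a.1 b.1 m.1)

@[simp] theorem coe_smul_deg (M : GrMod 𝒜) (a : 𝒜 0) (m : M.deg 0) :
    ((a • m : M.deg 0) : M) = (a : A) • (m : M) := rfl

/-- The `A_0`-linear map between the components of degree zero. -/
def degMap {M N : GrMod 𝒜} (f : M ⟶ N) : M.deg 0 →ₗ[𝒜 0] N.deg 0 where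
  toFun m := ⟨lin f m.1, lin_mem f m.2⟩
  map_add' x y := Subtype.ext (map_add (lin f) x.1 y.1)
  map_smul' a x := Subtype.ext (map_smul (lin f) a.1 x.1)

@[simp] theorem coe_degMap {M N : GrMod 𝒜} (f : M ⟶ N) (m : M.deg 0) :
    (degMap f m : N) = lin f m := rfl

/-- Projectivity is that of the ungraded module, so no graded splitting is at hand. Reducing the
coefficients of an ungraded section modulo positive degree still gives an `A_0`-linear section on
`P_0`, because in a nonnegatively graded module the degree 0 part of `a • q` is `a_0 • q_0`. -/
theorem projective_deg_zero {P : GrMod 𝒜} (hP : P.Nonneg) [hp : Module.Projective A P] :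
    Module.Projective (𝒜 0) (P.deg 0) := by
  obtain ⟨s, hs⟩ := hp.out
  let σ : P.deg 0 →ₗ[𝒜 0] (P →₀ 𝒜 0) :=
    { toFun := fun p => (s p.1).mapRange (GradedRing.projZeroRingHom' 𝒜) (map_zero _)
      map_add' := fun x y => by
        ext q; simp
      map_smul' := fun a x => by
        ext q
        have h : GradedRing.projZeroRingHom' 𝒜 a.1 = a :=
          Subtype.ext (DirectSum.decompose_of_mem_same 𝒜 a.2)
        simp only [coe_smul_deg, map_smul, Finsupp.mapRange_apply, Finsupp.smul_apply, smul_eq_mul,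
          map_mul, h, RingHom.id_apply] }
  refine Module.Projective.of_split σ
    (Finsupp.linearCombination (𝒜 0) fun q : P => (⟨P.pr 0 q, P.pr_mem 0 q⟩ : P.deg 0)) ?_
  ext p
  simp only [LinearMap.comp_apply, LinearMap.id_apply]
  have h1 := congrArg (P.pr 0) (hs p.1)
  rw [pr_of_mem p.2, Finsupp.linearCombination_apply, Finsupp.sum, map_sum] at h1
  refine Eq.trans ?_ h1
  rw [Finsupp.linearCombination_apply]
  have h2 : (σ p).sum (fun i a => a • (⟨P.pr 0 i, P.pr_mem 0 i⟩ : P.deg 0)) =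
      ∑ q ∈ (s p.1).support, σ p q • (⟨P.pr 0 q, P.pr_mem 0 q⟩ : P.deg 0) :=
    Finsupp.sum_of_support_subset _
      (Finsupp.support_mapRange (hf := map_zero (GradedRing.projZeroRingHom' 𝒜))) _ fun q _ => Subtype.ext (zero_smul A (P.pr 0 q))
  rw [h2, AddSubmonoidClass.coe_finsetSum]
  refine Finset.sum_congr rfl fun q _ => ?_
  rw [id, pr_zero_smul hP]
  rfl

/-- The degree-preserving part of a linear map. -/
theorem exists_homPart {M N : GrMod 𝒜} (h : M →ₗ[A] N) :
    ∃ f : M ⟶ N, ∀ n, ∀ m ∈ M.deg n, lin f m = N.pr n (h m) := by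
  let _ := M.isInternal.chooseDecomposition
  let L : M →ₗ[k] N := DirectSum.toModule k ℤ N
      (fun n => N.pr n ∘ₗ h.restrictScalars k ∘ₗ (M.deg n).subtype) ∘ₗ
      (DirectSum.decomposeLinearEquiv M.deg).toLinearMap
  have hL : ∀ n, ∀ m ∈ M.deg n, L m = N.pr n (h m) := fun n m hm => by
    simp only [L, LinearMap.comp_apply, LinearEquiv.coe_coe, DirectSum.decomposeLinearEquiv_apply,
      DirectSum.decompose_of_mem M.deg hm]
    exact DirectSum.toModule_lof (M := fun n => M.deg n) k n (⟨m, hm⟩ : M.deg n)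
  refine ⟨mkHom { L with map_smul' := fun a m => ?_ } ?_, hL⟩
  · change L (a • m) = a • L m
    induction a using DirectSum.Decomposition.inductionOn 𝒜 with
    | zero => simp
    | add x y hx hy => rw [add_smul, map_add, hx, hy, add_smul]
    | homogeneous a =>
      rename_i i
      induction m using induction_deg with
      | h0 => simp
      | hadd x y hx hy => rw [smul_add, map_add, hx, hy, map_add, smul_add]
      | hdeg j x hx =>
        rw [hL _ _ (M.smul_mem _ _ _ _ a.2 hx), hL _ _ hx, map_smul, pr_smul a.2,
          add_sub_cancel_left]
  · intro n m hm
    change L m ∈ _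
    rw [hL n m hm]; exact N.pr_mem n _

/-- An `A_0`-linear map defined on the component of degree zero of a projective module extends to
a graded map. -/
theorem exists_extend {P N : GrMod 𝒜} (hP : P.Nonneg) [hp : Module.Projective A P]
    (r : P.deg 0 →ₗ[𝒜 0] N.deg 0) :
    ∃ ρ : P ⟶ N, ∀ p : P.deg 0, lin ρ p = r p := by
  obtain ⟨s, hs⟩ := hp.out
  -- An ungraded `A`-linear map built from the section `s`; its degree-preserving part is the
  -- required extension, since taking components of degree 0 undoes the higher terms.
  let ρ : P →ₗ[A] N :=
    (Finsupp.linearCombination A fun q : P => (r ⟨P.pr 0 q, P.pr_mem 0 q⟩ : N)) ∘ₗ s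
  obtain ⟨f, hf⟩ := exists_homPart ρ
  refine ⟨f, fun p => ?_⟩
  rw [hf 0 p p.2]
  have h1 := congrArg (P.pr 0) (hs p.1)
  rw [pr_of_mem p.2, Finsupp.linearCombination_apply, Finsupp.sum, map_sum] at h1
  have h2 : p = ∑ q ∈ (s p.1).support, (decompose 𝒜 (s p.1 q) 0) • (⟨P.pr 0 q, P.pr_mem 0 q⟩ : P.deg 0) := by
    refine Subtype.ext ?_
    rw [AddSubmonoidClass.coe_finsetSum]
    refine h1.symm.trans ?_
    refine Finset.sum_congr rfl fun q _ => ?_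
    rw [id, pr_zero_smul hP]; rfl
  conv_rhs => rw [h2]
  rw [map_sum, AddSubmonoidClass.coe_finsetSum]
  simp only [ρ, LinearMap.comp_apply, Finsupp.linearCombination_apply, Finsupp.sum, map_sum]
  refine Finset.sum_congr rfl fun q _ => ?_
  have := pr_smul_of_mem (r ⟨P.pr 0 q, P.pr_mem 0 q⟩).2 (s p.1 q) 0
  simpa only [Nat.cast_zero, zero_add, coe_smul_deg, map_smul] using this

/-! ### The part of positive degree -/

/-- The submodule of elements of positive degree. -/
def tailSub (M : GrMod 𝒜) : Submodule A M where
  carrier := {m | ∀ n ≤ 0, M.pr n m = 0}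
  add_mem' hx hy n hn := by rw [map_add, hx n hn, hy n hn, add_zero]
  zero_mem' n _ := map_zero _
  smul_mem' a m hm n hn := by
    induction a using DirectSum.Decomposition.inductionOn 𝒜 with
    | zero => simp
    | add x y hx hy => rw [add_smul, map_add, hx, hy, add_zero]
    | homogeneous a => rw [pr_smul a.2, hm _ (by omega), smul_zero]

theorem pr_mem_tailSub (M : GrMod 𝒜) (n : ℤ) (m : M) (hm : m ∈ M.tailSub) :
    M.pr n m ∈ M.tailSub := fun j hj => by
  by_cases h : j = n
  · subst h; rw [hm j hj, map_zero]
  · exact pr_of_mem_ne (M.pr_mem n m) h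

/-- The part of positive degree, shifted so that the elements of degree one get degree zero. -/
def tail (M : GrMod 𝒜) : GrMod 𝒜 := (M.ofSub M.tailSub M.pr_mem_tailSub).shift 1

/-- The inclusion of the part of positive degree; it raises degrees by one. -/
def tailι (M : GrMod 𝒜) : tail M →ₗ[A] M := M.tailSub.subtype

theorem tailι_injective (M : GrMod 𝒜) : Function.Injective M.tailι := Subtype.val_injective

theorem mem_tail_deg {M : GrMod 𝒜} {n : ℤ} {x : tail M} :
    x ∈ (tail M).deg n ↔ tailι M x ∈ M.deg (n + 1) := Iff.rfl

theorem tailι_mem (M : GrMod 𝒜) (x : tail M) : tailι M x ∈ M.tailSub := x.2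

theorem mem_tailSub_of_mem_deg {M : GrMod 𝒜} {n : ℤ} (hn : 0 < n) {m : M} (hm : m ∈ M.deg n) :
    m ∈ M.tailSub := fun j hj => pr_of_mem_ne hm (by omega)

theorem mem_tailSub_iff {M : GrMod 𝒜} (hM : M.Nonneg) {m : M} :
    m ∈ M.tailSub ↔ M.pr 0 m = 0 := by
  refine ⟨fun h => h 0 le_rfl, fun h n hn => ?_⟩
  rcases hn.lt_or_eq with hn | rfl
  · exact hM n hn _ (M.pr_mem n m)
  · exact h

theorem sub_pr_zero_mem_tailSub {M : GrMod 𝒜} (hM : M.Nonneg) (m : M) :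
    m - M.pr 0 m ∈ M.tailSub := by
  rw [mem_tailSub_iff hM, map_sub, pr_of_mem (M.pr_mem 0 m), sub_self]

/-- Lift a degree-one map with values in the elements of positive degree. -/
def tailLift {K : GrMod 𝒜} (M : GrMod 𝒜) (g : K →ₗ[A] M)
    (hg : ∀ n m, m ∈ K.deg n → g m ∈ M.deg (n + 1)) (h : ∀ m, g m ∈ M.tailSub) : K ⟶ tail M :=
  mkHom (N := tail M) (g.codRestrict M.tailSub h) fun n m hm => hg n m hm

theorem lin_mem_tailSub {M N : GrMod 𝒜} (f : M ⟶ N) {m : M} (hm : m ∈ M.tailSub) :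
    lin f m ∈ N.tailSub := fun n hn => by rw [pr_lin, hm n hn, map_zero]

/-- The map induced on the parts of positive degree. -/
def tailMap {M N : GrMod 𝒜} (f : M ⟶ N) : tail M ⟶ tail N :=
  tailLift N (lin f ∘ₗ tailι M) (fun _ _ h => lin_mem f h) fun m => lin_mem_tailSub f m.2

@[simp] theorem tailι_tailMap {M N : GrMod 𝒜} (f : M ⟶ N) (x : tail M) :
    tailι N (lin (tailMap f) x) = lin f (tailι M x) := rfl

end GrMod
end GenKoszul

/-! ### Linear resolutions, minimal covers, and the splitting condition. -/

namespace GenKoszul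
namespace GrMod

variable {k : Type v} [Field k] {A : Type u} [Ring A] [Algebra k A] {𝒜 : ℕ → Submodule k A}

/-- A graded projective cover of a module by a projective module generated in degree zero. -/
structure IsCover {P N : GrMod 𝒜} (π : P ⟶ N) : Prop where
  projective : Module.Projective A P
  generatedIn : P.GeneratedIn 0
  surjective : Function.Surjective (lin π)

/-- The resolution obtained from a linear resolution by cutting off its first term. -/
def LinearResolution.truncate {M : GrMod 𝒜} (R : LinearResolution M) :
    LinearResolution (syz (P := R.P 0) (mkHom (M := R.P 0) (lin R.ε) R.ε.map_mem)) where
  P n := (R.P (n + 1)).shift 1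
  d n := mkHom (M := (R.P (n + 1 + 1)).shift 1) (N := (R.P (n + 1)).shift 1) (lin (M := R.P (n + 1 + 1)) (N := R.P (n + 1)) (R.d (n + 1)))
    fun m x hx => lin_mem (R.d (n + 1)) hx
  ε := syzLift (K := (R.P 1).shift 1) _ (lin (M := R.P 1) (N := R.P 0) (R.d 0)) (fun n m hm => lin_mem (R.d 0) hm)
    fun m => (R.exact_zero _).2 ⟨m, rfl⟩
  projective n := R.projective (n + 1)
  generatedIn n := (R.generatedIn (n + 1)).shift (by push_cast; ring)
  surjective y := by
    obtain ⟨x, hx⟩ := (R.exact_zero _).1 (lin_syzι _ y)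
    exact ⟨x, syzι_injective _ hx⟩
  exact_zero y := by
    refine (Iff.trans ?_ (R.exact_succ 0 y))
    exact ⟨fun h => congrArg (syzι _) h, fun h => syzι_injective _ (h.trans (map_zero _).symm)⟩
  exact_succ n := R.exact_succ (n + 1)

theorem IsKoszul.of_iso {M N : GrMod 𝒜} (hM : IsKoszul M) (e : M ≅ N) : IsKoszul N := by
  obtain ⟨hf, hg, ⟨R⟩⟩ := hM
  have he := iso_bijective e
  exact ⟨hf.of_surjective e.hom he.2, hg.of_surjective e.hom he.2, ⟨
    { P := R.P
      d := R.d
      ε := R.ε ≫ e.hom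
      projective := R.projective
      generatedIn := R.generatedIn
      surjective := he.2.comp R.surjective
      exact_zero := fun y => by
        rw [← R.exact_zero y]
        exact ⟨fun h => he.1 (h.trans (map_zero _).symm), fun h => by
          rw [lin_comp, h, map_zero]⟩
      exact_succ := R.exact_succ }⟩⟩

/-- The modules obtained by iterating a choice of covers. -/
noncomputable def iterSyz (R : GrMod 𝒜 → Prop)
    (h : ∀ N, R N → ∃ (P : GrMod 𝒜) (π : P ⟶ N), IsCover π ∧ R (syz π))
    (N : GrMod 𝒜) (hN : R N) : ℕ → {N : GrMod 𝒜 // R N}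
  | 0 => ⟨N, hN⟩
  | n + 1 => ⟨syz (h _ (iterSyz R h N hN n).2).choose_spec.choose,
      (h _ (iterSyz R h N hN n).2).choose_spec.choose_spec.2⟩

/-- Coinduction: a class of locally finite modules generated in degree zero whose members have
covers with shifted kernels in the class consists of Koszul modules. -/
theorem IsKoszul.coinduction (R : GrMod 𝒜 → Prop)
    (hR : ∀ N, R N → N.LocallyFinite ∧ N.GeneratedIn 0)
    (h : ∀ N, R N → ∃ (P : GrMod 𝒜) (π : P ⟶ N), IsCover π ∧ R (syz π))
    {N : GrMod 𝒜} (hN : R N) : IsKoszul N := by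
  refine ⟨(hR N hN).1, (hR N hN).2, ⟨?_⟩⟩
  let X := iterSyz R h N hN
  let P : ℕ → GrMod 𝒜 := fun n => (h _ (X n).2).choose
  let π : ∀ n, P n ⟶ (X n).1 := fun n => (h _ (X n).2).choose_spec.choose
  have hπ : ∀ n, IsCover (π n) := fun n => (h _ (X n).2).choose_spec.choose_spec.1
  have hX : ∀ n, (X (n + 1)).1 = syz (π n) := fun n => rfl
  let ι : ∀ n, (X (n + 1)).1 →ₗ[A] P n := fun n => syzι (π n)
  have hι : ∀ n m x, x ∈ (X (n + 1)).1.deg m → ι n x ∈ (P n).deg (m + 1) := fun n m x hx => hx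
  exact
    -- Each kernel was shifted by one, so the cover of the `n`-th kernel is generated in degree 0
    -- after `n` shifts; undoing them puts its generators in degree `n`.
    { P := fun n => (P n).shift (-n)
      d := fun n => mkHom (M := (P (n + 1)).shift (-(n + 1 : ℕ))) (N := (P n).shift (-n))
        (ι n ∘ₗ lin (M := P (n + 1)) (π (n + 1))) fun m x hx => by
          have := hι n _ _ (lin_mem (π (n + 1)) hx)
          change ι n (lin (π (n + 1)) x) ∈ (P n).deg (m + -n)
          convert this using 2
          push_cast; ring
      ε := mkHom (M := (P 0).shift (-(0 : ℕ))) (lin (M := P 0) (N := N) (π 0)) fun m x hx => by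
        have := lin_mem (M := P 0) (N := N) (π 0) (n := m + -(0 : ℕ)) hx
        exact (show m + -((0 : ℕ) : ℤ) = m by simp) ▸ this
      projective := fun n => (hπ n).projective
      generatedIn := fun n => (hπ n).generatedIn.shift (by ring)
      surjective := (hπ 0).surjective
      exact_zero := fun y => by
        refine ⟨fun hy => ?_, ?_⟩
        · obtain ⟨z, hz⟩ := (exact_syzι (π 0) y).1 hy
          obtain ⟨x, hx⟩ := (hπ 1).surjective z
          exact ⟨x, (congrArg (ι 0) hx).trans hz⟩
        · rintro ⟨x, rfl⟩
          exact lin_syzι (π 0) _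
      exact_succ := fun n y => by
        have key : ∀ y, ι n (lin (π (n + 1)) y) = 0 ↔ lin (π (n + 1)) y = 0 := fun y =>
          ⟨fun h => syzι_injective (π n) (h.trans (map_zero _).symm), fun h => by rw [h, map_zero]⟩
        refine (key y).trans ⟨fun hy => ?_, ?_⟩
        · obtain ⟨z, hz⟩ := (exact_syzι (π (n + 1)) y).1 hy
          obtain ⟨x, hx⟩ := (hπ (n + 2)).surjective z
          exact ⟨x, (congrArg (ι (n + 1)) hx).trans hz⟩
        · rintro ⟨x, rfl⟩
          exact lin_syzι (π (n + 1)) _ }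

/-- The map induced on finite powers. -/
def powMap {M N : GrMod 𝒜} (f : M ⟶ N) (r : ℕ) : M.pow r ⟶ N.pow r :=
  mkHom (M := M.pow r) (N := N.pow r) ((lin f).compLeft (Fin r)) fun _ _ h i _ =>
    lin_mem f (h i trivial)

/-- The projections of a finite power. -/
def powProj (M : GrMod 𝒜) {r : ℕ} (i : Fin r) : M.pow r ⟶ M :=
  mkHom (M := M.pow r) (LinearMap.proj i) fun _ _ h => h i trivial

@[simp] theorem lin_powProj (M : GrMod 𝒜) {r : ℕ} (i : Fin r) (x : M.pow r) :
    lin (powProj M i) x = x i := rfl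

theorem GeneratedIn.pow {M : GrMod 𝒜} {s : ℤ} (hM : M.GeneratedIn s) (r : ℕ) :
    (M.pow r).GeneratedIn s := by
  refine eq_top_iff.2 fun (x : Fin r → M) _ => ?_
  rw [← Finset.univ_sum_single x]
  refine Submodule.sum_mem _ fun i _ => ?_
  have h : x i ∈ Submodule.span A (M.deg s : Set M) := hM ▸ trivial
  have h2 : LinearMap.single A (fun _ : Fin r => (M : Type u)) i (x i) ∈
      (Submodule.span A (M.deg s : Set M)).map (LinearMap.single A (fun _ : Fin r => (M : Type u)) i) :=
    ⟨_, h, rfl⟩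
  rw [Submodule.map_span] at h2
  refine Submodule.span_mono ?_ h2
  rintro _ ⟨y, hy, rfl⟩ j -
  by_cases h : j = i
  · subst h; simpa using hy
  · simp [h]

theorem LocallyFinite.pow {M : GrMod 𝒜} (hM : M.LocallyFinite) (r : ℕ) :
    (M.pow r).LocallyFinite := fun n => by
  have := hM n
  refine Module.Finite.of_injective (N := Fin r → M.deg n)
    (LinearMap.pi fun i => ((lin (powProj M i)).restrictScalars k).restrict
      (p := (M.pow r).deg n) (q := M.deg n) fun m hm => lin_mem (powProj M i) hm)
    fun x y h => Subtype.ext (funext fun i => congrArg Subtype.val (congrFun h i))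

instance (M : GrMod 𝒜) (r : ℕ) [Module.Projective A M] : Module.Projective A (M.pow r) :=
  Module.Projective.of_equiv
    (DFinsupp.linearEquivFunOnFintype (R := A) (M := fun _ : Fin r => (M : Type u)))

theorem exact_powMap {M N L : GrMod 𝒜} {f : M ⟶ N} {g : N ⟶ L}
    (h : Function.Exact (lin f) (lin g)) (r : ℕ) :
    Function.Exact (lin (powMap f r)) (lin (powMap g r)) := fun y => by
  refine ⟨fun hy => ?_, ?_⟩
  · have : ∀ i, ∃ x, lin f x = y i := fun i => (h _).1 (congrFun hy i)
    choose x hx using this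
    exact ⟨x, funext hx⟩
  · rintro ⟨x, rfl⟩
    exact funext fun i => (h _).2 ⟨x i, rfl⟩

theorem surjective_powMap {M N : GrMod 𝒜} {f : M ⟶ N}
    (h : Function.Surjective (lin f)) (r : ℕ) : Function.Surjective (lin (powMap f r)) :=
  fun y => by
    choose x hx using fun i => h (y i)
    exact ⟨x, funext hx⟩

/-- Finite powers of Koszul modules are Koszul. -/
theorem IsKoszul.pow {M : GrMod 𝒜} (hM : IsKoszul M) (r : ℕ) : IsKoszul (M.pow r) := by
  obtain ⟨hf, hg, ⟨R⟩⟩ := hM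
  exact ⟨hf.pow r, hg.pow r, ⟨
    { P := fun n => (R.P n).pow r
      d := fun n => powMap (R.d n) r
      ε := powMap R.ε r
      projective := fun n => by
        have := R.projective n
        infer_instance
      generatedIn := fun n => (R.generatedIn n).pow r
      surjective := surjective_powMap R.surjective r
      exact_zero := exact_powMap R.exact_zero r
      exact_succ := fun n => exact_powMap (R.exact_succ n) r }⟩⟩

variable [GradedAlgebra 𝒜]

theorem IsKoszul.locallyFinite {M : GrMod 𝒜} (hM : IsKoszul M) : M.LocallyFinite := hM.1
theorem IsKoszul.generatedIn {M : GrMod 𝒜} (hM : IsKoszul M) : M.GeneratedIn 0 := hM.2.1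
theorem IsKoszul.nonneg {M : GrMod 𝒜} (hM : IsKoszul M) : M.Nonneg := hM.generatedIn.nonneg

/-- A map that is injective in degree zero. -/
def Minimal {P N : GrMod 𝒜} (π : P ⟶ N) : Prop := ∀ x ∈ P.deg 0, lin π x = 0 → x = 0

/-- Because of the shift, an element of degree 0 in the kernel has degree -1 in `syz π`, where a
module generated in degree 0 vanishes. -/
theorem GeneratedIn.minimal {P N : GrMod 𝒜} {π : P ⟶ N} (hπ : (syz π).GeneratedIn 0) :
    Minimal π := fun x hx h => by
  have := hπ.nonneg (-1) (by norm_num) ⟨x, h⟩ ((mem_syz_deg π).2 (by rw [neg_add_cancel]; exact hx))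
  exact congrArg Subtype.val this

theorem degMap_bijective {P N : GrMod 𝒜} {π : P ⟶ N} (hc : IsCover π)
    (hπ : Minimal π) : Function.Bijective (degMap π) := by
  refine ⟨(injective_iff_map_eq_zero _).2 fun x hx =>
    Subtype.ext (hπ _ x.2 (congrArg Subtype.val hx)), fun y => ?_⟩
  obtain ⟨x, hx⟩ := hc.surjective y
  refine ⟨⟨P.pr 0 x, P.pr_mem 0 x⟩, Subtype.ext ?_⟩
  rw [coe_degMap, ← pr_lin, hx, pr_of_mem y.2]

/-- The cover of a Koszul module; the shifted kernel is again Koszul. -/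
theorem IsKoszul.exists_cover (hA : ∀ i, FiniteDimensional k (𝒜 i)) {M : GrMod 𝒜}
    (hM : IsKoszul M) : ∃ (P : GrMod 𝒜) (π : P ⟶ M), IsCover π ∧ P.LocallyFinite ∧
      IsKoszul (syz π) := by
  obtain ⟨hf, hg, ⟨R⟩⟩ := hM
  let π : R.P 0 ⟶ M := R.ε
  have hc : IsCover π := ⟨R.projective 0, by simpa using R.generatedIn 0, R.surjective⟩
  have hR' : LinearResolution (syz π) := R.truncate
  have hs : (syz π).GeneratedIn 0 := by
    have := hR'.generatedIn 0
    exact (this.of_surjective hR'.ε hR'.surjective)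
  -- Minimality embeds `P_0` in the finite-dimensional `M_0`, and `P_n = A_n P_0`.
  have hP : (R.P 0).LocallyFinite := by
    refine hc.generatedIn.locallyFinite hA ?_
    have := hf 0
    refine Module.Finite.of_injective (N := M.deg 0)
      (((lin π).restrictScalars k).restrict (p := (R.P 0).deg 0) (q := M.deg 0)
        fun m hm => lin_mem π hm) ?_
    exact fun x y h => (degMap_bijective hc hs.minimal).1 (Subtype.ext (congrArg Subtype.val h))
  exact ⟨R.P 0, π, hc, hP, hP.of_injective (syzι π) 1 (fun n m hm => hm) (syzι_injective π), hs,
    ⟨hR'⟩⟩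

/-- A minimal cover is an isomorphism in degree 0, and the degree 0 part of the cover is projective
over `A_0`. This is what makes (S) applicable. -/
theorem IsKoszul.projective_deg_zero (hA : ∀ i, FiniteDimensional k (𝒜 i)) {M : GrMod 𝒜}
    (hM : IsKoszul M) : Module.Projective (𝒜 0) (M.deg 0) := by
  obtain ⟨P, π, hc, -, hs⟩ := hM.exists_cover hA
  have := hc.projective
  have := GrMod.projective_deg_zero hc.generatedIn.nonneg
  exact Module.Projective.of_equiv (LinearEquiv.ofBijective _ (degMap_bijective hc hs.generatedIn.minimal))

/-- Maps that agree with prescribed `A_0`-linear maps in degree zero lift to covers. -/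
theorem exists_lift {P N P' N' : GrMod 𝒜} {π : P ⟶ N} {π' : P' ⟶ N'} (hc : IsCover π)
    (hc' : IsCover π') (hs' : Minimal π') (r : N.deg 0 →ₗ[𝒜 0] N'.deg 0) :
    ∃ α : P ⟶ P', ∀ p ∈ P.deg 0, ∀ y : N.deg 0, lin π p = y → lin π' (lin α p) = r y := by
  have := hc.projective
  let e := LinearEquiv.ofBijective _ (degMap_bijective hc' hs')
  -- In degree 0 the minimal cover `π'` can be inverted, so `r` becomes a map `P_0 → P'_0`, which
  -- extends to `P`.
  obtain ⟨α, hα⟩ := exists_extend (N := P') hc.generatedIn.nonneg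
    (e.symm.toLinearMap ∘ₗ r ∘ₗ degMap π)
  refine ⟨α, fun p hp y hy => ?_⟩
  have h1 := hα ⟨p, hp⟩
  change lin α p = _ at h1
  rw [h1]
  have h2 : degMap π ⟨p, hp⟩ = y := Subtype.ext hy
  simp only [LinearMap.comp_apply, h2]
  exact congrArg Subtype.val (e.apply_symm_apply (r y))

/-- Lift a graded map to covers. -/
theorem exists_lift_hom {P N P' N' : GrMod 𝒜} {π : P ⟶ N} {π' : P' ⟶ N'} (hc : IsCover π)
    (hc' : IsCover π') (hs' : Minimal π') (f : N ⟶ N') :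
    ∃ α : P ⟶ P', ∀ p, lin π' (lin α p) = lin f (lin π p) := by
  obtain ⟨α, hα⟩ := exists_lift hc hc' hs' (degMap f)
  refine ⟨α, fun p => ?_⟩
  have : lin π' ∘ₗ lin α = lin f ∘ₗ lin π := hc.generatedIn.hom_ext fun p hp =>
    hα p hp ⟨lin π p, lin_mem π hp⟩ rfl
  exact LinearMap.congr_fun this p

/-- A graded endomorphism, or composition, is determined by what it does after covering. -/
theorem hom_ext_of_cover {Q P N : GrMod 𝒜} {π : P ⟶ N} (hQ : Q.GeneratedIn 0)
    (hs : Minimal π) {α β : Q ⟶ P}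
    (h : ∀ q ∈ Q.deg 0, lin π (lin α q) = lin π (lin β q)) (q : Q) : lin α q = lin β q := by
  have : lin α = lin β := hQ.hom_ext fun q hq => by
    rw [← sub_eq_zero]
    refine hs _ (Submodule.sub_mem _ (lin_mem α hq) (lin_mem β hq)) ?_
    rw [map_sub, h q hq, sub_self]
  exact LinearMap.congr_fun this q

/-- Condition (S): injective graded maps between Koszul modules split in degree zero. -/
theorem IsKoszul.exists_retraction (hA : ∀ i, FiniteDimensional k (𝒜 i))
    (hS : LeftSplitting (𝒜 0)) {K L : GrMod 𝒜} (hK : IsKoszul K) (hL : IsKoszul L) (j : K ⟶ L)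
    (hj : Function.Injective (lin j)) :
    ∃ r : L.deg 0 →ₗ[𝒜 0] K.deg 0, ∀ x, r (degMap j x) = x := by
  have hj0 : Function.Injective (degMap j) := fun x y h =>
    Subtype.ext (hj (congrArg Subtype.val h))
  obtain ⟨s, hs⟩ := hS (K.deg 0) (L.deg 0) (L.deg 0 ⧸ LinearMap.range (degMap j)) (degMap j)
    (Submodule.mkQ _) hj0 (LinearMap.exact_map_mkQ_range _) (Submodule.mkQ_surjective _)
    (hK.projective_deg_zero hA) (hL.projective_deg_zero hA)
  -- The section `s` of the quotient gives the complementary projection `y ↦ y - s [y]` onto the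
  -- image of `j`; the retraction is this projection followed by the inverse of `j` on its image.
  have h : ∀ y : L.deg 0, ∃ x, degMap j x = y - s (Submodule.mkQ _ y) := fun y => by
    have : y - s (Submodule.mkQ _ y) ∈ LinearMap.range (degMap j) := by
      rw [← Submodule.Quotient.mk_eq_zero]
      change Submodule.mkQ _ (y - _) = 0
      rw [map_sub, sub_eq_zero]
      exact (LinearMap.congr_fun hs _).symm
    exact this
  choose r hr using h
  refine ⟨{ toFun := r, map_add' := fun x y => hj0 ?_, map_smul' := fun a x => hj0 ?_ },
    fun x => hj0 ?_⟩
  · rw [map_add, hr, hr, hr, map_add, map_add]; abel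
  · rw [map_smul, hr, hr, map_smul, map_smul, smul_sub]; rfl
  · change degMap j (r _) = _
    rw [hr, show Submodule.mkQ _ (degMap j x) = 0 from
      (Submodule.Quotient.mk_eq_zero _).2 (LinearMap.mem_range_self _ x), map_zero, sub_zero]

/-- An injective graded map between Koszul modules lifts to a split injection of covers, with an
injective map on the shifted kernels. -/
theorem IsKoszul.exists_split_lift (hA : ∀ i, FiniteDimensional k (𝒜 i))
    (hS : LeftSplitting (𝒜 0)) {K L : GrMod 𝒜} (hK : IsKoszul K) (hL : IsKoszul L) (j : K ⟶ L)
    (hj : Function.Injective (lin j)) :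
    ∃ (P Q : GrMod 𝒜) (π : P ⟶ K) (π' : Q ⟶ L) (α : P ⟶ Q) (ρ : Q ⟶ P),
      IsCover π ∧ IsCover π' ∧ IsKoszul (syz π) ∧ IsKoszul (syz π') ∧
      (∀ p, lin π' (lin α p) = lin j (lin π p)) ∧ (∀ p, lin ρ (lin α p) = p) := by
  obtain ⟨P, π, hc, -, hs⟩ := hK.exists_cover hA
  obtain ⟨Q, π', hc', -, hs'⟩ := hL.exists_cover hA
  obtain ⟨r, hr⟩ := hK.exists_retraction hA hS hL j hj
  obtain ⟨α, hα⟩ := exists_lift_hom hc hc' hs'.generatedIn.minimal j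
  obtain ⟨ρ, hρ⟩ := exists_lift hc' hc hs.generatedIn.minimal r
  refine ⟨P, Q, π, π', α, ρ, hc, hc', hs, hs', hα, fun p => ?_⟩
  -- The retraction `r` lives in degree 0 only, so `ρ` need not cover a graded map `L ⟶ K`. The
  -- identity `ρ ∘ α = id` can nevertheless be tested in degree 0, where `P` is generated and `π` is
  -- injective.
  refine hom_ext_of_cover (α := α ≫ ρ) (β := 𝟙 P) hc.generatedIn hs.generatedIn.minimal (fun q hq => ?_) p
  have := hρ _ (lin_mem α hq) (degMap j ⟨lin π q, lin_mem π hq⟩) (hα q)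
  rw [hr] at this
  exact this

/-- Minimal covers are unique, hence so are their kernels. -/
theorem exists_syz_iso {P P' N : GrMod 𝒜} {π : P ⟶ N} {π' : P' ⟶ N} (hc : IsCover π)
    (hc' : IsCover π') (hs : Minimal π) (hs' : Minimal π') : Nonempty (syz π ≅ syz π') := by
  obtain ⟨α, hα⟩ := exists_lift_hom hc hc' hs' (𝟙 N)
  obtain ⟨β, hβ⟩ := exists_lift_hom hc' hc hs (𝟙 N)
  have hαβ : ∀ p, lin β (lin α p) = p :=
    hom_ext_of_cover (α := α ≫ β) (β := 𝟙 P) hc.generatedIn hs fun q _ => by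
      rw [lin_comp, hβ, hα]; rfl
  have hβα : ∀ p, lin α (lin β p) = p :=
    hom_ext_of_cover (α := β ≫ α) (β := 𝟙 P') hc'.generatedIn hs' fun q _ => by
      rw [lin_comp, hα, hβ]; rfl
  refine ⟨isoOfBijective (syzMap π π' α fun x hx => by rw [hα, hx, map_zero]) ⟨fun x y h => ?_, fun y => ?_⟩⟩
  · have := congrArg (fun z => lin β (syzι π' z)) h
    simp only [syzι_syzMap, hαβ] at this
    exact syzι_injective π this
  · refine ⟨⟨lin β (syzι π' y), ?_⟩, syzι_injective π' ?_⟩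
    · rw [LinearMap.mem_ker, hβ, lin_syzι, map_zero]
    · exact hβα _

/-- The definition provides one linear resolution; uniqueness of minimal covers lets any prescribed
minimal cover take the place of its first term. -/
theorem IsKoszul.syz_of_cover (hA : ∀ i, FiniteDimensional k (𝒜 i)) {P M : GrMod 𝒜}
    (hM : IsKoszul M) {π : P ⟶ M} (hc : IsCover π) (hs : Minimal π) : IsKoszul (syz π) := by
  obtain ⟨P', π', hc', -, hs'⟩ := hM.exists_cover hA
  obtain ⟨e⟩ := exists_syz_iso hc' hc hs'.generatedIn.minimal hs
  exact hs'.of_iso e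

end GrMod
end GenKoszul

namespace GenKoszul
namespace GrMod

variable {k : Type v} [Field k] {A : Type u} [Ring A] [Algebra k A] {𝒜 : ℕ → Submodule k A}
variable [GradedAlgebra 𝒜]

/-! ### Closure properties of Koszul modules -/

/-- The cokernel of an injective graded map between Koszul modules is Koszul. -/
theorem IsKoszul.cokernel (hA : ∀ i, FiniteDimensional k (𝒜 i))
    (hS : LeftSplitting (𝒜 0)) {K L N : GrMod 𝒜} (hK : IsKoszul K) (hL : IsKoszul L) (j : K ⟶ L)
    (q : L ⟶ N) (hj : Function.Injective (lin j)) (hjq : Function.Exact (lin j) (lin q))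
    (hq : Function.Surjective (lin q)) : IsKoszul N := by
  -- The coinductive class is that of all such cokernels: the syzygy of a cokernel will be the
  -- cokernel of the map of syzygies.
  refine IsKoszul.coinduction (fun N => ∃ (K L : GrMod 𝒜) (j : K ⟶ L) (q : L ⟶ N),
    IsKoszul K ∧ IsKoszul L ∧ Function.Injective (lin j) ∧ Function.Exact (lin j) (lin q) ∧
      Function.Surjective (lin q)) ?_ ?_ ⟨K, L, j, q, hK, hL, hj, hjq, hq⟩
  · rintro N ⟨K, L, j, q, hK, hL, hj, hjq, hq⟩
    exact ⟨hL.locallyFinite.of_surjective q hq, hL.generatedIn.of_surjective q hq⟩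
  · rintro N ⟨K, L, j, q, hK, hL, hj, hjq, hq⟩
    obtain ⟨P, Q, π, π', α, ρ, hc, hc', hs, hs', hα, hρ⟩ := hK.exists_split_lift hA hS hL j hj
    -- `Q` is the direct sum of `α P` and `T`, with projection `p` onto `T`. Since `q ∘ π'` kills `α
    -- P`, the complement `T` already covers `N`, and the snake lemma gives `0 → syz π → syz π' →
    -- syz (i ≫ π' ≫ q) → 0`.
    let T : GrMod 𝒜 := Q.ofSub (LinearMap.ker (lin ρ)) (kernel_pr ρ)
    let i : T ⟶ Q := Q.ofSubι _ (kernel_pr ρ)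
    have hi : Function.Injective (lin i) := Subtype.val_injective
    have hρi : ∀ x, lin ρ (lin i x) = 0 := fun x => x.2
    let p : Q ⟶ T := mkHom (N := T)
      ((LinearMap.id - lin (ρ ≫ α)).codRestrict (LinearMap.ker (lin ρ)) fun x => by
        change lin ρ (x - lin α (lin ρ x)) = 0
        rw [map_sub, hρ, sub_self]) fun n m hm =>
          Submodule.sub_mem (Q.deg n) hm (lin_mem α (lin_mem ρ hm))
    have hip : ∀ x, lin i (lin p x) = x - lin α (lin ρ x) := fun x => rfl
    have hpi : ∀ x, lin p (lin i x) = x := fun x => hi (by rw [hip, hρi, map_zero, sub_zero])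
    have hqj : ∀ x, lin q (lin j x) = 0 := fun x => (hjq _).2 ⟨x, rfl⟩
    have hqp : ∀ x, lin q (lin π' (lin i (lin p x))) = lin q (lin π' x) := fun x => by
      rw [hip, map_sub, map_sub, hα, hqj, sub_zero]
    have := hc'.projective
    refine ⟨T, i ≫ π' ≫ q, ⟨Module.Projective.of_split (lin i) (lin p) (LinearMap.ext hpi),
      hc'.generatedIn.of_surjective p fun y => ⟨_, hpi y⟩, fun y => ?_⟩,
      syz π, syz π', syzMap π π' α fun x hx => by rw [hα, hx, map_zero],
      syzMap π' (i ≫ π' ≫ q) p fun x hx => by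
        change lin q (lin π' (lin i (lin p x))) = 0
        rw [hqp, hx, map_zero], hs, hs', fun x y h => ?_, fun y => ⟨fun hy => ?_, ?_⟩, fun y => ?_⟩
    · obtain ⟨x, rfl⟩ := hq y
      obtain ⟨z, rfl⟩ := hc'.surjective x
      exact ⟨lin p z, hqp z⟩
    · have := congrArg (fun z => lin ρ (syzι π' z)) h
      simp only [syzι_syzMap, hρ] at this
      exact syzι_injective π this
    · have h1 : lin p (syzι π' y) = 0 := congrArg (syzι (i ≫ π' ≫ q)) hy
      have h2 : syzι π' y = lin α (lin ρ (syzι π' y)) := by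
        rw [← sub_eq_zero, ← hip, h1, map_zero]
      refine ⟨⟨lin ρ (syzι π' y), hj ?_⟩, syzι_injective π' h2.symm⟩
      rw [← hα, ← h2, lin_syzι, map_zero]
    · rintro ⟨x, rfl⟩
      refine syzι_injective _ (hi ?_)
      rw [syzι_syzMap, hip, syzι_syzMap, hρ, sub_self, map_zero, map_zero]
    -- An element `t` of the kernel of `T ⟶ N` maps under `π'` into the image of `K`; subtracting a
    -- suitable `α z`, which `p` kills, moves it into the kernel of `π'`.
    · obtain ⟨x, hx⟩ := (hjq _).1 (lin_syzι (i ≫ π' ≫ q) y)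
      obtain ⟨z, rfl⟩ := hc.surjective x
      let t := syzι (i ≫ π' ≫ q) y
      refine ⟨⟨lin i t - lin α z, ?_⟩, syzι_injective _ (hi ?_)⟩
      · rw [LinearMap.mem_ker, map_sub, hα, sub_eq_zero]
        exact hx.symm
      · change lin i (lin p (lin i t - lin α z)) = lin i t
        rw [hip, map_sub, hρi, hρ, zero_sub, map_neg]; abel

/-- Graded direct summands of Koszul modules are Koszul. -/
theorem IsKoszul.retract (hA : ∀ i, FiniteDimensional k (𝒜 i)) {L N : GrMod 𝒜}
    (hL : IsKoszul L) (i : N ⟶ L) (r : L ⟶ N) (hir : i ≫ r = 𝟙 N) : IsKoszul N := by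
  refine IsKoszul.coinduction (fun N => ∃ (L : GrMod 𝒜) (i : N ⟶ L) (r : L ⟶ N),
    IsKoszul L ∧ ∀ x, lin r (lin i x) = x) ?_ ?_
    ⟨L, i, r, hL, fun x => LinearMap.congr_fun (congrArg lin hir) x⟩
  · rintro N ⟨L, i, r, hL, hir⟩
    have hr : Function.Surjective (lin r) := fun x => ⟨_, hir x⟩
    exact ⟨hL.locallyFinite.of_surjective r hr, hL.generatedIn.of_surjective r hr⟩
  · rintro N ⟨L, i, r, hL, hir⟩
    obtain ⟨P, π, hc, -, hs⟩ := hL.exists_cover hA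
    -- The idempotent `r ≫ i` of `L` lifts to the cover. By minimality the lift `e` is idempotent
    -- too; its image covers `N`, and the syzygy of `N` is a retract of that of `L`.
    obtain ⟨e, he⟩ := exists_lift_hom hc hc hs.generatedIn.minimal (r ≫ i)
    have hee : ∀ x, lin e (lin e x) = lin e x :=
      hom_ext_of_cover (α := e ≫ e) (β := e) hc.generatedIn hs.generatedIn.minimal fun x _ => by
        rw [lin_comp, he, he, lin_comp, lin_comp, hir]
    let T : GrMod 𝒜 := P.ofSub (LinearMap.range (lin e)) (by
      rintro n _ ⟨x, rfl⟩
      exact ⟨P.pr n x, (pr_lin e n x).symm⟩)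
    let ι : T ⟶ P := P.ofSubι _ _
    have hι : Function.Injective (lin ι) := Subtype.val_injective
    let p : P ⟶ T := mkHom (N := T) (lin e).rangeRestrict fun n m hm => lin_mem e hm
    have hιp : ∀ x, lin ι (lin p x) = lin e x := fun x => rfl
    have hpι : ∀ x, lin p (lin ι x) = x := fun x => hι (by
      obtain ⟨_, ⟨y, rfl⟩⟩ := x
      exact hee y)
    have := hc.projective
    have hi : Function.Injective (lin i) := Function.LeftInverse.injective hir
    have key : ∀ x, lin π (lin ι x) = lin i (lin r (lin π (lin ι x))) := fun x => by
      rw [← lin_comp r i, ← he, ← hιp, hpι]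
    refine ⟨T, ι ≫ π ≫ r, ⟨Module.Projective.of_split (lin ι) (lin p) (LinearMap.ext hpι),
      hc.generatedIn.of_surjective p fun y => ⟨_, hpι y⟩, fun y => ?_⟩,
      syz π, syzMap (ι ≫ π ≫ r) π ι fun x hx => ?_,
      syzMap π (ι ≫ π ≫ r) p fun x hx => ?_, hs, fun x => syzι_injective _ ?_⟩
    · obtain ⟨x, hx⟩ := hc.surjective (lin i y)
      refine ⟨lin p x, ?_⟩
      rw [lin_comp, lin_comp, hιp, he, hx, lin_comp, hir, hir]
    · have hx' : lin r (lin π (lin ι x)) = 0 := hx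
      rw [key, hx', map_zero]
    · rw [lin_comp, lin_comp, hιp, he, hx, map_zero, map_zero]
    · rw [syzι_syzMap, syzι_syzMap, hpι]

/-- Locally finite projective modules generated in degree zero are Koszul. -/
theorem IsKoszul.of_projective {P : GrMod 𝒜} (hf : P.LocallyFinite) (hg : P.GeneratedIn 0)
    (hp : Module.Projective A P) : IsKoszul P := by
  refine IsKoszul.coinduction
    (fun P : GrMod 𝒜 => P.LocallyFinite ∧ P.GeneratedIn 0 ∧ Module.Projective A P)
    (fun P h => ⟨h.1, h.2.1⟩) (fun P h => ⟨P, 𝟙 P, ⟨h.2.2, h.2.1, fun x => ⟨x, rfl⟩⟩, ?_⟩)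
    ⟨hf, hg, hp⟩
  have : Subsingleton (syz (𝟙 P)) :=
    ⟨fun x y => syzι_injective _ ((lin_syzι (𝟙 P) x).trans (lin_syzι (𝟙 P) y).symm)⟩
  refine ⟨fun n => inferInstance, ?_, inferInstance⟩
  exact Subsingleton.elim _ _

/-! ### The regular module and the module concentrated in degree zero -/

variable (𝒜)

/-- The regular graded module. -/
noncomputable def reg : GrMod 𝒜 where
  carrier := A
  deg n := match n with
    | Int.ofNat n => 𝒜 n
    | Int.negSucc _ => ⊥
  isInternal := by
    refine isInternal_of_projections _ (fun n => match n with
      | Int.ofNat n => GradedAlgebra.proj 𝒜 n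
      | Int.negSucc _ => 0) ?_ ?_ ?_
    · rintro (n | n) m hm
      · exact DirectSum.decompose_of_mem_same 𝒜 hm
      · exact ((Submodule.mem_bot k).1 hm).symm
    · rintro (n | n) (j | j) m hm h
      · exact DirectSum.decompose_of_mem_ne 𝒜 hm fun h' => h (by rw [h'])
      · rfl
      · rw [(Submodule.mem_bot k).1 hm, map_zero]
      · rfl
    · intro m
      induction m using DirectSum.Decomposition.inductionOn 𝒜 with
      | zero => exact Submodule.zero_mem _
      | add x y hx hy => exact Submodule.add_mem _ hx hy
      | homogeneous x =>
        rename_i i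
        exact Submodule.mem_iSup_of_mem (Int.ofNat i) x.2
  smul_mem := by
    rintro i (j | j) a m ha hm
    · exact SetLike.mul_mem_graded ha hm
    · rw [(Submodule.mem_bot k).1 hm, smul_zero]
      exact Submodule.zero_mem _

variable {𝒜}

variable (𝒜) in
/-- The elements of the algebra as elements of the regular module. -/
def regMk (a : A) : reg 𝒜 := a

theorem regMk_surjective (x : reg 𝒜) : ∃ a, regMk 𝒜 a = x := ⟨x, rfl⟩

theorem smul_regMk (a b : A) : a • regMk 𝒜 b = regMk 𝒜 (a * b) := rfl

theorem regMk_eq_smul_one (a : A) : regMk 𝒜 a = a • regMk 𝒜 1 := by rw [smul_regMk, mul_one]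

theorem mem_reg_deg {n : ℕ} {a : A} : regMk 𝒜 a ∈ (reg 𝒜).deg n ↔ a ∈ 𝒜 n := Iff.rfl

theorem one_mem_reg : regMk 𝒜 1 ∈ (reg 𝒜).deg 0 :=
  mem_reg_deg (n := 0).2 SetLike.GradedOne.one_mem

theorem reg_generatedIn : (reg 𝒜).GeneratedIn 0 := by
  refine eq_top_iff.2 fun x _ => ?_
  obtain ⟨a, rfl⟩ := regMk_surjective x
  rw [regMk_eq_smul_one]
  exact Submodule.smul_mem _ a (Submodule.subset_span one_mem_reg)

instance : Module.Projective A (reg 𝒜) := inferInstanceAs (Module.Projective A A)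

theorem reg_locallyFinite (hA : ∀ i, FiniteDimensional k (𝒜 i)) : (reg 𝒜).LocallyFinite :=
  reg_generatedIn.locallyFinite hA (hA 0)

theorem reg_isKoszul (hA : ∀ i, FiniteDimensional k (𝒜 i)) : IsKoszul (reg 𝒜) :=
  IsKoszul.of_projective (reg_locallyFinite hA) reg_generatedIn inferInstance

theorem reg_pr (n : ℕ) (a : A) : (reg 𝒜).pr n (regMk 𝒜 a) = regMk 𝒜 (decompose 𝒜 a n : A) := by
  have := pr_smul_of_mem (M := reg 𝒜) one_mem_reg a n
  rwa [add_zero, ← regMk_eq_smul_one, ← regMk_eq_smul_one] at this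

variable (𝒜) in
/-- The linear map `a ↦ a • m` from the regular module. -/
noncomputable def regLin {V : Type*} [AddCommGroup V] [Module A V] (m : V) : reg 𝒜 →ₗ[A] V where
  toFun a := (show A from a) • m
  map_add' a b := add_smul (show A from a) (show A from b) m
  map_smul' a b := mul_smul a (show A from b) m

@[simp] theorem regLin_regMk {V : Type*} [AddCommGroup V] [Module A V] (m : V) (a : A) :
    regLin 𝒜 m (regMk 𝒜 a) = a • m := rfl

theorem regLin_one {V : Type*} [AddCommGroup V] [Module A V] (f : reg 𝒜 →ₗ[A] V) :
    regLin 𝒜 (f (regMk 𝒜 1)) = f := by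
  refine LinearMap.ext fun x => ?_
  obtain ⟨a, rfl⟩ := regMk_surjective x
  rw [regLin_regMk, ← map_smul, ← regMk_eq_smul_one]

/-- The map `a ↦ a • m` from the regular module, as a graded map. -/
noncomputable def regHom (M : GrMod 𝒜) (m : M) (hm : m ∈ M.deg 0) : reg 𝒜 ⟶ M :=
  mkHom (M := reg 𝒜) (regLin 𝒜 m) (by
    rintro (n | n) a ha
    · have := M.smul_mem n 0 a m ha hm
      rwa [add_zero] at this
    · have h : a = 0 := (Submodule.mem_bot k).1 ha
      rw [h, map_zero]
      exact Submodule.zero_mem _)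

@[simp] theorem lin_regHom (M : GrMod 𝒜) (m : M) (hm : m ∈ M.deg 0) :
    lin (regHom M m hm) = regLin 𝒜 m := rfl

variable (𝒜) in
/-- The elements of `A_0` as elements of the module `A_0` concentrated in degree zero. -/
def degZeroMk (a : 𝒜 0) : degZero 𝒜 := a

theorem degZeroMk_surjective (x : degZero 𝒜) : ∃ a, degZeroMk 𝒜 a = x := ⟨x, rfl⟩

theorem degZeroMk_injective : Function.Injective (degZeroMk 𝒜) := fun _ _ h => h

theorem smul_degZeroMk (a : A) (b : 𝒜 0) :
    a • degZeroMk 𝒜 b = degZeroMk 𝒜 (GradedRing.projZeroRingHom' 𝒜 a * b) := rfl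

theorem degZeroMk_add (a b : 𝒜 0) : degZeroMk 𝒜 (a + b) = degZeroMk 𝒜 a + degZeroMk 𝒜 b := rfl

theorem mem_degZero_deg (x : degZero 𝒜) : x ∈ (degZero 𝒜).deg 0 := by
  change x ∈ (if (0 : ℤ) = 0 then ⊤ else ⊥ : Submodule k (𝒜 0))
  rw [if_pos rfl]; trivial

variable (𝒜) in
/-- The projection of the regular module onto `A_0`. -/
noncomputable def regProj : reg 𝒜 ⟶ degZero 𝒜 := regHom (degZero 𝒜) (degZeroMk 𝒜 1) (mem_degZero_deg _)

theorem lin_regProj (a : A) :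
    lin (regProj 𝒜) (regMk 𝒜 a) = degZeroMk 𝒜 (GradedRing.projZeroRingHom' 𝒜 a) := by
  rw [regProj, lin_regHom, regLin_regMk, smul_degZeroMk, mul_one]

theorem projZero_coe (a : 𝒜 0) : GradedRing.projZeroRingHom' 𝒜 (a : A) = a :=
  Subtype.ext (DirectSum.decompose_of_mem_same 𝒜 a.2)

theorem regProj_isCover : IsCover (regProj 𝒜) where
  projective := inferInstance
  generatedIn := reg_generatedIn
  surjective x := by
    obtain ⟨a, rfl⟩ := degZeroMk_surjective x
    exact ⟨regMk 𝒜 a, (lin_regProj _).trans (by rw [projZero_coe])⟩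

theorem lin_regProj_eq_zero_iff (x : reg 𝒜) : lin (regProj 𝒜) x = 0 ↔ (reg 𝒜).pr 0 x = 0 := by
  obtain ⟨a, rfl⟩ := regMk_surjective x
  rw [lin_regProj]
  refine Iff.trans ?_ (Iff.of_eq (congrArg (· = 0) (reg_pr 0 a).symm))
  exact ⟨fun h => congrArg Subtype.val h, fun h => Subtype.ext h⟩

theorem regProj_minimal : Minimal (regProj 𝒜) := fun x hx h => by
  rw [← pr_of_mem hx]; exact (lin_regProj_eq_zero_iff x).1 h

/-- The part of positive degree of `A` is the kernel of the minimal cover `A ⟶ A_0`, and `A_0` is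
Koszul. -/
theorem tail_reg_isKoszul (hA : ∀ i, FiniteDimensional k (𝒜 i)) (hK : IsKoszulAlgebra 𝒜) :
    IsKoszul (tail (reg 𝒜)) := by
  have h := IsKoszul.syz_of_cover hA hK regProj_isCover regProj_minimal
  refine h.of_iso (isoOfBijective (tailLift (reg 𝒜) (syzι (regProj 𝒜)) (fun _ _ h => h)
    fun x => (mem_tailSub_iff reg_generatedIn.nonneg).2
      ((lin_regProj_eq_zero_iff _).1 (lin_syzι _ x))) ⟨fun x y h => ?_, fun y => ?_⟩)
  · exact syzι_injective _ (congrArg (tailι _) h)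
  · exact ⟨⟨tailι _ y, (lin_regProj_eq_zero_iff _).2
      ((mem_tailSub_iff reg_generatedIn.nonneg).1 (tailι_mem _ y))⟩, rfl⟩

theorem tail_pow_isKoszul {M : GrMod 𝒜} (hM : IsKoszul (tail M)) (hn : M.Nonneg) (r : ℕ) :
    IsKoszul (tail (M.pow r)) := by
  have hn' : (M.pow r).Nonneg := fun n hn' m hm => funext fun i => hn n hn' _ (hm i trivial)
  have hmem : ∀ x : M.pow r, x ∈ (M.pow r).tailSub ↔ ∀ i, x i ∈ M.tailSub := fun x => by
    rw [mem_tailSub_iff hn']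
    refine ⟨fun h i => ?_, fun h => funext fun i => ?_⟩
    · rw [mem_tailSub_iff hn, ← lin_powProj M i x, pr_lin, h, map_zero]
    · have := (mem_tailSub_iff hn).1 (h i)
      rwa [← lin_powProj M i x, pr_lin] at this
  refine (hM.pow r).of_iso (isoOfBijective (M := (tail M).pow r) (tailLift (M.pow r)
    (K := (tail M).pow r) ((tailι M).compLeft (Fin r)) (fun n m hm i _ => hm i trivial)
    fun x => (hmem _).2 fun i => (x i).2) ⟨fun x y h => ?_, fun y => ?_⟩)
  · exact funext fun i => tailι_injective M (congrFun (congrArg (tailι _) h) i)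
  · exact ⟨fun i => ⟨y.1 i, (hmem y.1).1 y.2 i⟩, rfl⟩

theorem finite_deg_zero {M : GrMod 𝒜} (hf : FiniteDimensional k (M.deg 0)) :
    Module.Finite (𝒜 0) (M.deg 0) := by
  have : IsScalarTower k (𝒜 0) (M.deg 0) := ⟨fun r a x => Subtype.ext (smul_assoc r a.1 x.1)⟩
  exact Module.Finite.of_restrictScalars_finite k (𝒜 0) (M.deg 0)

/-- A dual basis of the finitely generated projective `A_0`-module `P_0` extends to graded maps
presenting `P` as a retract of some `A^n`. Since `tail` is functorial, `tail P` is a retract of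
`tail (A^n)`. -/
theorem tail_isKoszul_of_projective (hA : ∀ i, FiniteDimensional k (𝒜 i))
    (hK : IsKoszulAlgebra 𝒜) {P : GrMod 𝒜} (hf : P.LocallyFinite) (hg : P.GeneratedIn 0)
    (hp : Module.Projective A P) : IsKoszul (tail P) := by
  have := finite_deg_zero (hf 0)
  have := projective_deg_zero hg.nonneg
  obtain ⟨n, f, g, -, -, hfg⟩ := Module.Finite.exists_comp_eq_id_of_projective (𝒜 0) (P.deg 0)
  obtain ⟨i, hi⟩ := exists_extend (N := (reg 𝒜).pow n) hg.nonneg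
    { toFun := fun x => ⟨fun i => (g x i : A), fun i _ => (g x i).2⟩
      map_add' := fun x y => Subtype.ext (funext fun i => by simp; rfl)
      map_smul' := fun a x => Subtype.ext (funext fun i => by simp; rfl) }
  obtain ⟨r, hr⟩ := exists_extend (P := (reg 𝒜).pow n) (N := P) (reg_generatedIn.pow n).nonneg
    { toFun := fun x => f fun i => ⟨x.1 i, x.2 i trivial⟩
      map_add' := fun x y => by rw [← map_add]; rfl
      map_smul' := fun a x => by rw [RingHom.id_apply, ← map_smul]; rfl }
  -- `P` is generated in degree 0, where `i` and `r` are the dual basis maps `g` and `f`.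
  have hir : i ≫ r = 𝟙 P := by
    refine hom_ext (hg.hom_ext fun m hm => ?_)
    have h1 := hi ⟨m, hm⟩
    have h2 := hr ⟨_, lin_mem i hm⟩
    change lin r (lin i m) = m
    refine h2.trans ?_
    refine Eq.trans ?_ (congrArg Subtype.val (LinearMap.congr_fun hfg ⟨m, hm⟩))
    rw [LinearMap.comp_apply]
    refine congrArg (fun z => ((f z : P.deg 0) : P)) (funext fun l => Subtype.ext ?_)
    exact congrFun h1 l
  refine IsKoszul.retract hA (tail_pow_isKoszul (tail_reg_isKoszul hA hK) reg_generatedIn.nonneg n)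
    (tailMap i) (tailMap r) (hom_ext_apply fun x => tailι_injective _ ?_)
  exact LinearMap.congr_fun (congrArg lin hir) _

theorem syz_le_tailSub {P M : GrMod 𝒜} {π : P ⟶ M} (hP : P.Nonneg) (hs : Minimal π) (x : syz π) :
    syzι π x ∈ P.tailSub := by
  rw [mem_tailSub_iff hP]
  refine hs _ (P.pr_mem 0 _) ?_
  rw [← pr_lin, lin_syzι, map_zero]

/-- The inclusion of the kernel of a minimal cover in the part of positive degree. -/
def syzToTail {P M : GrMod 𝒜} (π : P ⟶ M) (hP : P.Nonneg) (hs : Minimal π) : syz π ⟶ tail P :=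
  tailLift P (syzι π) (fun _ _ h => h) (syz_le_tailSub hP hs)

theorem syzToTail_injective {P M : GrMod 𝒜} (π : P ⟶ M) (hP : P.Nonneg) (hs : Minimal π) :
    Function.Injective (lin (syzToTail π hP hs)) := fun _ _ h =>
  syzι_injective π (congrArg (tailι P) h)

theorem exact_syzToTail {P M : GrMod 𝒜} (π : P ⟶ M) (hP : P.Nonneg) (hs : Minimal π) :
    Function.Exact (lin (syzToTail π hP hs)) (lin (tailMap π)) := fun y =>
  ⟨fun h => ⟨⟨tailι P y, congrArg (tailι M) h⟩, rfl⟩, by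
    rintro ⟨x, rfl⟩
    exact tailι_injective M (lin_syzι π x)⟩

theorem surjective_tailMap {P M : GrMod 𝒜} {π : P ⟶ M} (hP : P.Nonneg)
    (hπ : Function.Surjective (lin π)) : Function.Surjective (lin (tailMap π)) := fun y => by
  obtain ⟨x, hx⟩ := hπ (tailι M y)
  refine ⟨⟨_, sub_pr_zero_mem_tailSub hP x⟩, tailι_injective M ?_⟩
  change lin π (x - P.pr 0 x) = tailι M y
  rw [map_sub, ← pr_lin, hx, tailι_mem M y 0 le_rfl, sub_zero]

/-- For a minimal cover `P → M` the syzygy lies in `J P`, so `0 → syz π → tail P → tail M → 0`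
presents `tail M` as a cokernel of Koszul modules. -/
theorem IsKoszul.isKoszul_tail (hA : ∀ i, FiniteDimensional k (𝒜 i)) (hS : LeftSplitting (𝒜 0))
    (hK : IsKoszulAlgebra 𝒜) {M : GrMod 𝒜} (hM : IsKoszul M) : IsKoszul (tail M) := by
  obtain ⟨P, π, hc, hf, hs⟩ := hM.exists_cover hA
  have hP := hc.generatedIn.nonneg
  have hm := hs.generatedIn.minimal
  exact IsKoszul.cokernel hA hS hs (tail_isKoszul_of_projective hA hK hf hc.generatedIn hc.projective)
    (syzToTail π hP hm) (tailMap π) (syzToTail_injective π hP hm) (exact_syzToTail π hP hm)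
    (surjective_tailMap hP hc.surjective)

/-- Extend an `A_0`-linear map on the component of degree zero by zero. -/
theorem exists_toDegZero {M : GrMod 𝒜} (hM : M.Nonneg) (f : M.deg 0 →ₗ[𝒜 0] 𝒜 0) :
    ∃ F : M →ₗ[A] degZero 𝒜, ∀ m, F m = degZeroMk 𝒜 (f ⟨M.pr 0 m, M.pr_mem 0 m⟩) := by
  refine ⟨{ toFun := fun m => degZeroMk 𝒜 (f ⟨M.pr 0 m, M.pr_mem 0 m⟩)
            map_add' := fun x y => ?_, map_smul' := fun a x => ?_ }, fun m => rfl⟩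
  · rw [← degZeroMk_add, ← map_add]
    congr 2
    exact Subtype.ext (map_add _ _ _)
  · rw [RingHom.id_apply, smul_degZeroMk, ← smul_eq_mul, ← map_smul]
    congr 2
    exact Subtype.ext (pr_zero_smul hM a x)

theorem smul_degZero_of_mem {i : ℕ} (hi : i ≠ 0) {a : A} (ha : a ∈ 𝒜 i) (x : degZero 𝒜) :
    a • x = 0 := by
  have := (degZero 𝒜).smul_mem i 0 a x ha (mem_degZero_deg x)
  exact eq_zero_of_mem_deg (by omega) this (mem_degZero_deg _)

/-- For `n > 0`, `M_n = A_n M_0` and `A_n` annihilates the target `A_0`. The map `f` need not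
preserve degrees. -/
theorem GeneratedIn.map_eq_zero {M : GrMod 𝒜} (hM : M.GeneratedIn 0) (f : M →ₗ[A] degZero 𝒜)
    {m : M} (hm : m ∈ M.tailSub) : f m = 0 := by
  have key : ∀ n : ℤ, 0 < n → ∀ m ∈ M.deg n, f m = 0 := fun n hn m hm => by
    lift n to ℕ using hn.le
    have h : Submodule.map₂ (Algebra.lsmul k k (M : Type u) : A →ₐ[k] Module.End k M).toLinearMap
        (𝒜 n) (M.deg 0) ≤ LinearMap.ker (f.restrictScalars k) :=
      Submodule.map₂_le.2 fun a ha x _ => (map_smul f a x).trans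
        (smul_degZero_of_mem (by omega) ha _)
    exact h (hM.deg_le n hm)
  obtain ⟨s, hs⟩ := M.exists_eq_sum_pr m
  rw [hs, map_sum]
  refine Finset.sum_eq_zero fun n _ => ?_
  rcases le_or_gt n 0 with h | h
  · rw [hm n h, map_zero]
  · exact key n h _ (M.pr_mem n m)

/-- A dual basis of the component of degree zero of a Koszul module. -/
theorem IsKoszul.exists_dualBasis (hA : ∀ i, FiniteDimensional k (𝒜 i)) {M : GrMod 𝒜}
    (hM : IsKoszul M) : ∃ (n : ℕ) (m : Fin n → M) (f : Fin n → (M →ₗ[A] degZero 𝒜))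
      (_ : ∀ i, m i ∈ M.deg 0), ∀ x ∈ M.deg 0, ∀ a : Fin n → 𝒜 0, (∀ i, f i x = degZeroMk 𝒜 (a i)) →
        x = ∑ i, (a i : A) • m i := by
  have := finite_deg_zero (hM.locallyFinite 0)
  have := hM.projective_deg_zero hA
  obtain ⟨n, f, g, -, -, hfg⟩ := Module.Finite.exists_comp_eq_id_of_projective (𝒜 0) (M.deg 0)
  choose F hF using fun i => exists_toDegZero hM.nonneg (LinearMap.proj i ∘ₗ g)
  refine ⟨n, fun i => f (Pi.single i 1), F, fun i => (f (Pi.single i 1)).2, fun x hx a ha => ?_⟩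
  have h1 : g ⟨x, hx⟩ = a := funext fun i => degZeroMk_injective (by
    rw [← ha i, hF]
    simp only [LinearMap.comp_apply, LinearMap.proj_apply, pr_of_mem hx])
  have h2 := congrArg Subtype.val (LinearMap.congr_fun hfg ⟨x, hx⟩)
  rw [LinearMap.comp_apply, h1, LinearMap.id_apply] at h2
  refine h2.symm.trans ?_
  have h3 : a = ∑ i, a i • (Pi.single i 1 : Fin n → 𝒜 0) := by
    ext i
    simp [Finset.sum_apply, Pi.single_apply]
  conv_lhs => rw [h3]
  rw [map_sum, AddSubmonoidClass.coe_finsetSum]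
  exact Finset.sum_congr rfl fun i _ => by rw [map_smul]; rfl

end GrMod
end GenKoszul

namespace GenKoszul
open Abelian

/-! ### `Ext` and short exact sequences of modules -/

section Modules

variable {R : Type u} [Ring R]

/-- Precomposition with a linear map. -/
noncomputable def pre {X Y : Type u} [AddCommGroup X] [Module R X] [AddCommGroup Y] [Module R Y]
    (f : X →ₗ[R] Y) {Z : ModuleCat.{u} R} {n : ℕ} (y : Ext (ModuleCat.of R Y) Z n) :
    Ext (ModuleCat.of R X) Z n :=
  (Ext.mk₀ (ModuleCat.ofHom f)).comp y (zero_add n)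

section pre

variable {X Y V : Type u} [AddCommGroup X] [Module R X] [AddCommGroup Y] [Module R Y]
  [AddCommGroup V] [Module R V] {Z : ModuleCat.{u} R} {n : ℕ}

@[simp] theorem pre_zero (f : X →ₗ[R] Y) : pre f (0 : Ext (ModuleCat.of R Y) Z n) = 0 :=
  Ext.comp_zero _ _ _ _ _

theorem pre_id (y : Ext (ModuleCat.of R Y) Z n) : pre LinearMap.id y = y := Ext.mk₀_id_comp y

theorem pre_pre (f : X →ₗ[R] Y) (g : Y →ₗ[R] V) (y : Ext (ModuleCat.of R V) Z n) :
    pre f (pre g y) = pre (g ∘ₗ f) y := by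
  rw [pre, pre, pre, Ext.mk₀_comp_mk₀_assoc]; rfl

theorem pre_mk₀ (f : X →ₗ[R] Y) (g : ModuleCat.of R Y ⟶ Z) :
    pre f (Ext.mk₀ g) = Ext.mk₀ (ModuleCat.ofHom f ≫ g) := Ext.mk₀_comp_mk₀ _ _

end pre

/-- Short exact sequences of modules. -/
structure SES {X Y V : Type u} [AddCommGroup X] [Module R X] [AddCommGroup Y] [Module R Y]
    [AddCommGroup V] [Module R V] (f : X →ₗ[R] Y) (g : Y →ₗ[R] V) : Prop where
  injective : Function.Injective f
  exact : Function.Exact f g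
  surjective : Function.Surjective g

namespace SES

variable {X Y V : Type u} [AddCommGroup X] [Module R X] [AddCommGroup Y] [Module R Y]
  [AddCommGroup V] [Module R V] {f : X →ₗ[R] Y} {g : Y →ₗ[R] V} (S : SES f g)
include S

/-- The associated short complex. -/
abbrev complex : ShortComplex (ModuleCat.{u} R) :=
  ModuleCat.shortComplexOfCompEqZero f g S.exact.linearMap_comp_eq_zero

theorem shortExact : S.complex.ShortExact :=
  ModuleCat.shortComplex_shortExact S.complex S.exact S.injective S.surjective

/-- The extension class. -/
noncomputable def cls : Ext (ModuleCat.of R V) (ModuleCat.of R X) 1 := S.shortExact.extClass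

/-- For a morphism of short exact sequences, the pullback of one class along `c` is the pushout of
the other along `a`. The naturality of all later connecting maps, and so of `θ`, comes from here. -/
theorem cls_naturality {X' Y' V' : Type u} [AddCommGroup X'] [Module R X'] [AddCommGroup Y']
    [Module R Y'] [AddCommGroup V'] [Module R V'] {f' : X' →ₗ[R] Y'} {g' : Y' →ₗ[R] V'}
    (S' : SES f' g') (a : X →ₗ[R] X') (b : Y →ₗ[R] Y') (c : V →ₗ[R] V')
    (h₁ : ∀ x, b (f x) = f' (a x)) (h₂ : ∀ y, c (g y) = g' (b y)) {Z : ModuleCat.{u} R} {n m : ℕ}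
    (y : Ext (ModuleCat.of R X') Z n) (h : 1 + n = m) :
    pre c (S'.cls.comp y h) = S.cls.comp (pre a y) h := by
  have := ShortComplex.ShortExact.extClass_naturality S.shortExact S'.shortExact
    { τ₁ := ModuleCat.ofHom a, τ₂ := ModuleCat.ofHom b, τ₃ := ModuleCat.ofHom c
      comm₁₂ := by ext x; exact (h₁ x).symm
      comm₂₃ := by ext x; exact (h₂ x).symm }
  rw [pre, pre, ← Ext.comp_assoc _ _ _ (zero_add 1) h (by omega)]
  refine (congrArg (fun z => Ext.comp z y h) this.symm).trans ?_
  exact Ext.comp_assoc _ _ _ (add_zero 1) (zero_add n) (by omega)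

variable {Z : ModuleCat.{u} R}

theorem pre_cls_comp {n m : ℕ} (y : Ext (ModuleCat.of R X) Z n) (h : 1 + n = m) :
    pre g (S.cls.comp y h) = 0 := S.shortExact.comp_extClass_assoc y h

theorem cls_comp_pre {n m : ℕ} (y : Ext (ModuleCat.of R Y) Z n) (h : 1 + n = m) :
    S.cls.comp (pre f y) h = 0 := S.shortExact.extClass_comp_assoc y

theorem exists_pre_of_cls {n m : ℕ} (y : Ext (ModuleCat.of R X) Z n) (h : 1 + n = m)
    (hy : S.cls.comp y h = 0) : ∃ x : Ext (ModuleCat.of R Y) Z n, pre f x = y :=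
  Ext.contravariant_sequence_exact₁ S.shortExact _ y h hy

theorem exists_pre_of_pre {n : ℕ} (y : Ext (ModuleCat.of R Y) Z n) (hy : pre f y = 0) :
    ∃ x : Ext (ModuleCat.of R V) Z n, pre g x = y :=
  Ext.contravariant_sequence_exact₂ S.shortExact _ y hy

theorem exists_cls_of_pre {n m : ℕ} (y : Ext (ModuleCat.of R V) Z m) (hy : pre g y = 0)
    (h : 1 + n = m) : ∃ x : Ext (ModuleCat.of R X) Z n, S.cls.comp x h = y :=
  Ext.contravariant_sequence_exact₃ S.shortExact _ y hy h

theorem pre_injective_zero {y : Ext (ModuleCat.of R V) Z 0} (hy : pre g y = 0) : y = 0 := by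
  have : Epi (ModuleCat.ofHom g) := (ModuleCat.epi_iff_surjective _).2 S.surjective
  obtain ⟨y, rfl⟩ := (Ext.mk₀_bijective _ _).2 y
  rw [pre_mk₀, Ext.mk₀_eq_zero_iff] at hy
  rw [Ext.mk₀_eq_zero_iff, ← cancel_epi (ModuleCat.ofHom g), hy, Limits.comp_zero]

end SES

theorem ext_eq_zero_of_projective {P : Type u} [AddCommGroup P] [Module R P]
    [Module.Projective R P] {Z : ModuleCat.{u} R} {n : ℕ} (y : Ext (ModuleCat.of R P) Z n)
    (hn : n ≠ 0) : y = 0 := by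
  obtain ⟨n, rfl⟩ := Nat.exists_eq_succ_of_ne_zero hn
  have : Projective (ModuleCat.of R P) := (IsProjective.iff_projective P).1 inferInstance
  exact Ext.eq_zero_of_projective y

end Modules

/-! ### `Ext` of Koszul modules with values in `A_0`. -/

namespace GrMod

variable {k : Type v} [Field k] {A : Type u} [Ring A] [Algebra k A] {𝒜 : ℕ → Submodule k A}

theorem syz_ses {P M : GrMod 𝒜} {π : P ⟶ M} (h : Function.Surjective (lin π)) :
    SES (syzι π) (lin π) := ⟨syzι_injective π, exact_syzι π, h⟩

variable [GradedAlgebra 𝒜]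

/-- An injective graded map between Koszul modules induces surjections on `Ext^n(-, A_0)`. -/
theorem IsKoszul.ext_surjective (hA : ∀ i, FiniteDimensional k (𝒜 i)) (hS : LeftSplitting (𝒜 0))
    (n : ℕ) : ∀ {K L : GrMod 𝒜}, IsKoszul K → IsKoszul L → ∀ (j : K ⟶ L),
      Function.Injective (lin j) → ∀ y : Ext K.toModuleCat (degZero 𝒜).toModuleCat n,
      ∃ x : Ext L.toModuleCat (degZero 𝒜).toModuleCat n, pre (lin j) x = y := by
  induction n with
  | zero =>
    intro K L hK hL j hj y
    obtain ⟨r, hr⟩ := hK.exists_retraction hA hS hL j hj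
    obtain ⟨f, rfl⟩ := (Ext.mk₀_bijective _ _).2 y
    let f₀ : K.deg 0 →ₗ[𝒜 0] 𝒜 0 :=
      { toFun := fun x => f.hom x.1
        map_add' := fun x y => map_add f.hom x.1 y.1
        map_smul' := fun a x => by
          refine (map_smul f.hom a.1 x.1).trans ?_
          refine (smul_degZeroMk _ _).trans ?_
          rw [projZero_coe]; rfl }
    obtain ⟨F, hF⟩ := exists_toDegZero hL.nonneg (f₀ ∘ₗ r)
    -- A map into `A_0` from a module generated in degree 0 is determined by its values there, so
    -- composing with the retraction `r` and extending by zero solves the problem for `n = 0`.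
    refine ⟨Ext.mk₀ (ModuleCat.ofHom F), ?_⟩
    rw [pre_mk₀]
    congr 1
    refine ModuleCat.hom_ext (hK.generatedIn.hom_ext (N := degZero 𝒜) fun x hx => ?_)
    change F (lin j x) = f.hom x
    have h1 : (⟨L.pr 0 (lin j x), L.pr_mem 0 _⟩ : L.deg 0) = degMap j ⟨x, hx⟩ :=
      Subtype.ext (pr_of_mem (lin_mem j hx))
    rw [hF, h1, LinearMap.comp_apply, hr]
    rfl
  | succ n ih =>
    intro K L hK hL j hj y
    obtain ⟨P, Q, π, π', α, ρ, hc, hc', hs, hs', hα, hρ⟩ := hK.exists_split_lift hA hS hL j hj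
    have hp := hc.projective
    -- Dimension shift: `P` is projective, so every class in `Ext^{n+1}(K, A_0)` comes from
    -- `Ext^n(syz π, A_0)`. The induced map `β` of syzygies is injective because `α` is split, so
    -- the induction hypothesis applies to it.
    obtain ⟨x, rfl⟩ := (syz_ses hc.surjective).exists_cls_of_pre y
      (ext_eq_zero_of_projective _ (by omega)) (add_comm 1 n)
    let β : syz π ⟶ syz π' := syzMap π π' α fun x hx => by rw [hα, hx, map_zero]
    obtain ⟨x', rfl⟩ := ih hs hs' β (fun x y h => by
      have := congrArg (fun z => lin ρ (syzι π' z)) h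
      simp only [β, syzι_syzMap, hρ] at this
      exact syzι_injective π this) x
    exact ⟨(syz_ses hc'.surjective).cls.comp x' (add_comm 1 n),
      (syz_ses hc.surjective).cls_naturality (syz_ses hc'.surjective) (lin β) (lin α) (lin j)
        (fun x => rfl) (fun x => (hα x).symm) x' _⟩

/-- Restricting to the part of positive degree kills `Ext^n(M, A_0)`. -/
theorem IsKoszul.pre_tailι (hA : ∀ i, FiniteDimensional k (𝒜 i)) (hS : LeftSplitting (𝒜 0))
    (hK : IsKoszulAlgebra 𝒜) {M : GrMod 𝒜} (hM : IsKoszul M) {n : ℕ}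
    (y : Ext M.toModuleCat (degZero 𝒜).toModuleCat n) : pre (tailι M) y = 0 := by
  rcases n with _ | n
  · obtain ⟨f, rfl⟩ := (Ext.mk₀_bijective _ _).2 y
    rw [pre_mk₀, Ext.mk₀_eq_zero_iff]
    refine ModuleCat.hom_ext (LinearMap.ext fun x => ?_)
    exact hM.generatedIn.map_eq_zero f.hom x.2
  · obtain ⟨P, π, hc, hf, hs⟩ := hM.exists_cover hA
    have hp := hc.projective
    have hP := hc.generatedIn.nonneg
    have hm := hs.generatedIn.minimal
    obtain ⟨x, rfl⟩ := (syz_ses hc.surjective).exists_cls_of_pre y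
      (ext_eq_zero_of_projective _ (by omega)) (add_comm 1 n)
    -- Pulling the sequence `syz π → P → M` back along `J M → M` gives `syz π → tail P → tail M`. By
    -- `IsKoszul.ext_surjective` the class `x` extends to `tail P`, and classes that extend to the
    -- middle term are killed by the connecting map.
    have S : SES (lin (syzToTail π hP hm)) (lin (tailMap π)) :=
      ⟨syzToTail_injective π hP hm, exact_syzToTail π hP hm, surjective_tailMap hP hc.surjective⟩
    obtain ⟨x', rfl⟩ := IsKoszul.ext_surjective hA hS n hs
      (tail_isKoszul_of_projective hA hK hf hc.generatedIn hc.projective) (syzToTail π hP hm)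
      (syzToTail_injective π hP hm) x
    rw [S.cls_naturality (syz_ses hc.surjective) LinearMap.id (tailι P) (tailι M) (fun x => rfl)
      (fun x => rfl), pre_id, S.cls_comp_pre]

/-- The quotient of a graded module by its part of positive degree. -/
abbrev Head (M : GrMod 𝒜) : Type u := M ⧸ M.tailSub

theorem head_ses (M : GrMod 𝒜) : SES (tailι M) M.tailSub.mkQ :=
  ⟨tailι_injective M, LinearMap.exact_subtype_mkQ _, Submodule.mkQ_surjective _⟩

/-- A dual basis of the head of a Koszul module. -/
theorem IsKoszul.exists_dualBasis_head (hA : ∀ i, FiniteDimensional k (𝒜 i)) {M : GrMod 𝒜}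
    (hM : IsKoszul M) : ∃ (n : ℕ) (f : Fin n → (Head M →ₗ[A] degZero 𝒜))
      (g : Fin n → (degZero 𝒜 →ₗ[A] Head M)), ∑ i, g i ∘ₗ f i = LinearMap.id := by
  obtain ⟨n, m, f, hm, hf⟩ := hM.exists_dualBasis hA
  have hg : ∀ i, ∃ g : degZero 𝒜 →ₗ[A] Head M,
      ∀ a : 𝒜 0, g (degZeroMk 𝒜 a) = M.tailSub.mkQ ((a : A) • m i) := fun i =>
    ⟨{  toFun := fun a => M.tailSub.mkQ (((show 𝒜 0 from a) : A) • m i)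
        map_add' := fun x y => by
          rw [← map_add, ← add_smul]; rfl
        map_smul' := fun b x => by
          obtain ⟨a, rfl⟩ := degZeroMk_surjective x
          rw [smul_degZeroMk, RingHom.id_apply, ← map_smul]
          change M.tailSub.mkQ (((GradedRing.projZeroRingHom' 𝒜 b * a : 𝒜 0) : A) • m i) =
            M.tailSub.mkQ (b • (a : A) • m i)
          rw [← sub_eq_zero, ← map_sub]
          refine (Submodule.Quotient.mk_eq_zero _).2 ((mem_tailSub_iff hM.nonneg).2 ?_)
          rw [map_sub, sub_eq_zero, pr_zero_smul hM.nonneg, pr_zero_smul hM.nonneg, pr_zero_smul hM.nonneg,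
            pr_of_mem (hm i), DirectSum.decompose_of_mem_same 𝒜 (Subtype.prop _),
            DirectSum.decompose_of_mem_same 𝒜 a.2, smul_smul]
          rfl }, fun a => rfl⟩
  choose g hg using hg
  refine ⟨n, fun i => M.tailSub.liftQ (f i) fun x hx => hM.generatedIn.map_eq_zero (f i) hx, g, ?_⟩
  refine LinearMap.ext fun x => ?_
  obtain ⟨x, rfl⟩ := M.tailSub.mkQ_surjective x
  have hx : M.tailSub.mkQ x = M.tailSub.mkQ (M.pr 0 x) := by
    rw [← sub_eq_zero, ← map_sub]
    exact (Submodule.Quotient.mk_eq_zero _).2 (sub_pr_zero_mem_tailSub hM.nonneg x)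
  choose a ha using fun i => degZeroMk_surjective (f i (M.pr 0 x))
  have h := congrArg M.tailSub.mkQ (hf _ (M.pr_mem 0 x) a fun i => (ha i).symm)
  rw [map_sum] at h
  rw [hx, LinearMap.sum_apply, LinearMap.id_apply]
  refine Eq.trans (Finset.sum_congr rfl fun i _ => ?_) h.symm
  rw [LinearMap.comp_apply, ← hg, ha]
  rfl

end GrMod
end GenKoszul

/-! ### `E(M / J M)` as a projective cover of `E(M)`. -/

namespace GenKoszul
open Abelian

section Yoneda

variable {C : Type u} [Category.{v} C] [Abelian C] [HasExt.{w} C]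

theorem ExtMod.of_injective (M X : C) (n : ℕ) : Function.Injective (ExtMod.of M X n) :=
  DirectSum.of_injective n

theorem ExtAlg.of_injective (X : C) (n : ℕ) : Function.Injective (ExtAlg.of X n) :=
  DirectSum.of_injective n

theorem ExtMod.of_congr {M X : C} {i j : ℕ} (h : i = j) {l d : ℕ} {Y : C} (x : Ext M Y d)
    (y : Ext Y X l) (h₁ : d + l = i) (h₂ : d + l = j) :
    ExtMod.of M X i (x.comp y h₁) = ExtMod.of M X j (x.comp y h₂) := by subst h; rfl

/-- The identification of `Ext^*(X, X)` as a module with the algebra. -/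
noncomputable def ExtMod.toAlgAdd (X : C) : ExtMod X X ≃+ ExtAlg X := AddEquiv.refl (⨁ n : ℕ, Ext X X n)

theorem ExtMod.toAlgAdd_of (X : C) (n : ℕ) (y : Ext X X n) :
    ExtMod.toAlgAdd X (ExtMod.of X X n y) = ExtAlg.of X n y := rfl

/-- The module `Ext^*(X, X)` is the regular module. -/
noncomputable def ExtMod.toAlg (X : C) : ExtMod X X ≃ₗ[ExtAlg X] ExtAlg X where
  __ := ExtMod.toAlgAdd X
  map_smul' a m := by
    change ExtMod.toAlgAdd X (a • m) = a * ExtMod.toAlgAdd X m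
    induction a using ExtAlg.induction with
    | h0 => rw [zero_smul, zero_mul, map_zero]
    | hadd y z hy hz => rw [add_smul, add_mul, map_add, hy, hz]
    | hof i x =>
      induction m using ExtMod.induction with
      | h0 => rw [smul_zero, map_zero, mul_zero]
      | hadd y z hy hz => rw [smul_add, map_add, map_add, mul_add, hy, hz]
      | hof j y =>
        rw [ExtMod.of_smul_of, ExtMod.toAlgAdd_of, ExtMod.toAlgAdd_of, ExtAlg.of_mul_of]

@[simp] theorem ExtMod.toAlg_of (X : C) (n : ℕ) (y : Ext X X n) :
    ExtMod.toAlg X (ExtMod.of X X n y) = ExtAlg.of X n y := rfl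

/-- Precomposition with an extension class, as an additive map on `Ext^*(-, X)`. -/
noncomputable def ExtMod.precompAdd {M N : C} {d : ℕ} (α : Ext M N d) (X : C) :
    ExtMod N X →+ ExtMod M X :=
  DirectSum.toAddMonoid fun n =>
    (ExtMod.of M X (d + n)).comp (AddMonoidHom.mk' (fun y : Ext N X n => α.comp y rfl)
      fun y z => Ext.comp_add _ y z _)

theorem ExtMod.precompAdd_of {M N : C} {d : ℕ} (α : Ext M N d) (X : C) (n : ℕ) (y : Ext N X n) :
    ExtMod.precompAdd α X (ExtMod.of N X n y) = ExtMod.of M X (d + n) (α.comp y rfl) :=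
  DirectSum.toAddMonoid_of _ _ _

/-- Precomposition with an extension class, as a linear map on `Ext^*(-, X)`. -/
noncomputable def ExtMod.precomp {M N : C} {d : ℕ} (α : Ext M N d) (X : C) :
    ExtMod N X →ₗ[ExtAlg X] ExtMod M X where
  toFun := ExtMod.precompAdd α X
  map_add' := map_add _
  map_smul' a m := by
    rw [RingHom.id_apply]
    induction a using ExtAlg.induction with
    | h0 => rw [zero_smul, map_zero, zero_smul]
    | hadd y z hy hz => rw [add_smul, map_add, add_smul, hy, hz]
    | hof i x =>
      induction m using ExtMod.induction with
      | h0 => rw [smul_zero, map_zero, smul_zero]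
      | hadd y z hy hz => rw [smul_add, map_add, map_add, smul_add, hy, hz]
      | hof j y =>
        rw [ExtMod.of_smul_of, ExtMod.precompAdd_of, ExtMod.precompAdd_of, ExtMod.of_smul_of,
          Ext.comp_assoc α y x rfl (add_comm j i) (by omega : d + j + i = i + (d + j))]
        exact ExtMod.of_congr (by omega) _ _ _ _

theorem ExtMod.precomp_of {M N : C} {d : ℕ} (α : Ext M N d) (X : C) (n : ℕ) (y : Ext N X n) :
    ExtMod.precomp α X (ExtMod.of N X n y) = ExtMod.of M X (d + n) (α.comp y rfl) :=
  ExtMod.precompAdd_of α X n y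

/-- Homogeneous elements of `Ext^*(M, X)`. -/
theorem ExtMod.eq_zero_or_exists_of {k : Type*} [Field k] [Linear k C] {M X : C} {n : ℤ}
    {x : ExtMod M X} (hx : x ∈ extModGrading k M X n) :
    x = 0 ∨ ∃ (j : ℕ) (y : Ext M X j), n = j ∧ x = ExtMod.of M X j y := by
  rcases lt_or_ge n 0 with hn | hn
  · exact Or.inl (ExtMod.eq_zero_of_neg hn hx)
  · lift n to ℕ using hn
    obtain ⟨y, rfl⟩ := ExtMod.exists_of hx
    exact Or.inr ⟨n, y, rfl, rfl⟩

/-- An object which is a retract of a finite sum of copies of `X` has a projective `Ext^*(-, X)`. -/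
theorem ExtMod.eq_sum_of_dualBasis {M X : C} {r : ℕ} (f : Fin r → (M ⟶ X)) (g : Fin r → (X ⟶ M))
    (h : ∑ i, f i ≫ g i = 𝟙 M) (e : ExtMod M X) :
    e = ∑ i, ExtMod.toAlg X (ExtMod.map (g i) X e) • ExtMod.of M X 0 (Ext.mk₀ (f i)) := by
  induction e using ExtMod.induction with
  | h0 => simp
  | hadd y z hy hz =>
    simp only [map_add, add_smul, Finset.sum_add_distrib]
    rw [← hy, ← hz]
  | hof n y =>
    have : ∀ i, ExtMod.toAlg X (ExtMod.map (g i) X (ExtMod.of M X n y)) •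
        ExtMod.of M X 0 (Ext.mk₀ (f i)) =
        ExtMod.of M X n ((Ext.mk₀ (f i ≫ g i)).comp y (zero_add n)) := fun i => by
      rw [ExtMod.map_of, ExtMod.toAlg_of, ExtMod.of_smul_of, Ext.mk₀_comp_mk₀_assoc]
      exact ExtMod.of_congr (add_zero n) _ _ _ _
    simp only [this]
    rw [← map_sum, ← Ext.sum_comp, ← Ext.mk₀_sum, h, Ext.mk₀_id_comp]

/-- The maps `f i`, as classes of degree 0, and precomposition with the `g i` form a dual basis of
`Ext^*(M, X)` over `Ext^*(X, X)`. -/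
theorem ExtMod.projective_of_dualBasis {M X : C} {r : ℕ} (f : Fin r → (M ⟶ X))
    (g : Fin r → (X ⟶ M)) (h : ∑ i, f i ≫ g i = 𝟙 M) :
    Module.Projective (ExtAlg X) (ExtMod M X) := by
  refine Module.Projective.of_split (M := Fin r →₀ ExtAlg X)
    (∑ i, Finsupp.lsingle i ∘ₗ (ExtMod.toAlg X).toLinearMap ∘ₗ ExtMod.map (g i) X)
    (Finsupp.linearCombination (ExtAlg X) fun i => ExtMod.of M X 0 (Ext.mk₀ (f i)))
    (LinearMap.ext fun e => ?_)
  conv_rhs => rw [LinearMap.id_apply, ExtMod.eq_sum_of_dualBasis f g h e]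
  simp [map_sum, Finsupp.linearCombination_single]

end Yoneda

namespace GrMod

section general

variable {k : Type v} [Field k] {A : Type u} [Ring A] [Algebra k A] {𝒜 : ℕ → Submodule k A}

theorem injective_of_homogeneous {M N : GrMod 𝒜} (f : M →ₗ[A] N) (d : ℤ)
    (hf : ∀ n m, m ∈ M.deg n → f m ∈ N.deg (n + d))
    (h : ∀ n, ∀ m ∈ M.deg n, f m = 0 → m = 0) : Function.Injective f := by
  refine (injective_iff_map_eq_zero f).2 fun m hm => ext_pr fun n => ?_
  rw [map_zero]
  refine h n _ (M.pr_mem n m) ?_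
  rw [← lin_pr f d hf, hm, map_zero]

theorem exact_of_homogeneous {M N L : GrMod 𝒜} (f : M →ₗ[A] N) (g : N →ₗ[A] L) (d : ℤ)
    (hg : ∀ n m, m ∈ N.deg n → g m ∈ L.deg (n + d))
    (hfg : ∀ n, ∀ m ∈ M.deg n, g (f m) = 0)
    (h : ∀ n, ∀ m ∈ N.deg n, g m = 0 → ∃ x, f x = m) : Function.Exact f g := fun y => by
  refine ⟨fun hy => ?_, ?_⟩
  · obtain ⟨s, hs⟩ := N.exists_eq_sum_pr y
    have : ∀ n, ∃ x, f x = N.pr n y := fun n => h n _ (N.pr_mem n y) (by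
      rw [← lin_pr g d hg, hy, map_zero])
    choose x hx using this
    exact ⟨∑ n ∈ s, x n, by
      rw [map_sum]
      exact (Finset.sum_congr rfl fun n _ => hx n).trans hs.symm⟩
  · rintro ⟨x, rfl⟩
    induction x using induction_deg with
    | h0 => simp
    | hadd x y hx hy => rw [map_add, map_add, hx, hy, add_zero]
    | hdeg n x hx => exact hfg n x hx

theorem surjective_of_homogeneous {M N : GrMod 𝒜} (f : M →ₗ[A] N)
    (h : ∀ n, ∀ m ∈ N.deg n, ∃ x, f x = m) : Function.Surjective f := fun y => by
  induction y using induction_deg with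
  | h0 => exact ⟨0, map_zero f⟩
  | hadd x y hx hy =>
    obtain ⟨x, rfl⟩ := hx
    obtain ⟨y, rfl⟩ := hy
    exact ⟨x + y, map_add f x y⟩
  | hdeg n x hx => exact h n x hx

end general

variable {k : Type v} [Field k] {A : Type u} [Ring A] [Algebra k A] (𝒜 : ℕ → Submodule k A)
variable [GradedAlgebra 𝒜]

/-- `Ext_A^*(X, A_0)` for an ungraded module `X`. -/
noncomputable def extGr (X : ModuleCat.{u} A) : GrMod (gamGrading 𝒜) where
  carrier := ExtMod X (degZero 𝒜).toModuleCat
  deg := extModGrading k X (degZero 𝒜).toModuleCat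
  isInternal := extModGrading_isInternal k X (degZero 𝒜).toModuleCat
  smul_mem := extModGrading_smul_mem k X (degZero 𝒜).toModuleCat

variable {𝒜}

variable (𝒜) in
/-- The inclusion of `Ext^n(X, A_0)`. -/
noncomputable def grOf (X : ModuleCat.{u} A) (n : ℕ) :
    Ext X (degZero 𝒜).toModuleCat n →+ extGr 𝒜 X := ExtMod.of X _ n

variable (𝒜) in
/-- The inclusion of `Ext^n(M, A_0)`. -/
noncomputable def objOf (M : GrMod 𝒜) (n : ℕ) :
    Ext M.toModuleCat (degZero 𝒜).toModuleCat n →+ extObj 𝒜 M := ExtMod.of M.toModuleCat _ n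

theorem grOf_congr {X Y : ModuleCat.{u} A} {i j l d : ℕ} (h : i = j) (x : Ext X Y d)
    (y : Ext Y (degZero 𝒜).toModuleCat l) (h₁ : d + l = i) (h₂ : d + l = j) :
    grOf 𝒜 X i (x.comp y h₁) = grOf 𝒜 X j (x.comp y h₂) := by subst h; rfl

theorem grOf_injective {X : ModuleCat.{u} A} {n : ℕ} : Function.Injective (grOf 𝒜 X n) :=
  ExtMod.of_injective _ _ _

theorem objOf_injective {M : GrMod 𝒜} {n : ℕ} : Function.Injective (objOf 𝒜 M n) :=
  ExtMod.of_injective _ _ _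

theorem extGr_cases {X : ModuleCat.{u} A} {n : ℤ} {x : extGr 𝒜 X} (hx : x ∈ (extGr 𝒜 X).deg n) :
    x = 0 ∨ ∃ (j : ℕ) (y : Ext X (degZero 𝒜).toModuleCat j), n = j ∧ x = grOf 𝒜 X j y :=
  ExtMod.eq_zero_or_exists_of hx

theorem extObj_cases {M : GrMod 𝒜} {n : ℤ} {x : extObj 𝒜 M} (hx : x ∈ (extObj 𝒜 M).deg n) :
    x = 0 ∨ ∃ (j : ℕ) (y : Ext M.toModuleCat (degZero 𝒜).toModuleCat j),
      n = j ∧ x = objOf 𝒜 M j y :=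
  ExtMod.eq_zero_or_exists_of hx

theorem grOf_mem {X : ModuleCat.{u} A} {j : ℕ} (y : Ext X (degZero 𝒜).toModuleCat j) :
    grOf 𝒜 X j y ∈ (extGr 𝒜 X).deg j := ExtMod.of_mem k _ _ j y

theorem objOf_mem {M : GrMod 𝒜} {j : ℕ} (y : Ext M.toModuleCat (degZero 𝒜).toModuleCat j) :
    objOf 𝒜 M j y ∈ (extObj 𝒜 M).deg j := ExtMod.of_mem k _ _ j y

theorem objOf_induction {M : GrMod 𝒜} {p : extObj 𝒜 M → Prop} (x : extObj 𝒜 M) (h0 : p 0)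
    (hof : ∀ n y, p (objOf 𝒜 M n y)) (hadd : ∀ y z, p y → p z → p (y + z)) : p x :=
  ExtMod.induction x h0 hof hadd

theorem of_smul_objOf {M : GrMod 𝒜} {i j : ℕ}
    (x : Ext (degZero 𝒜).toModuleCat (degZero 𝒜).toModuleCat i)
    (y : Ext M.toModuleCat (degZero 𝒜).toModuleCat j) :
    (ExtAlg.of _ i x : Gam 𝒜) • objOf 𝒜 M j y = objOf 𝒜 M (i + j) (y.comp x (add_comm j i)) :=
  ExtMod.of_smul_of x y

theorem extMap_objOf {M N : GrMod 𝒜} (f : M ⟶ N) {n : ℕ}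
    (y : Ext N.toModuleCat (degZero 𝒜).toModuleCat n) :
    lin (extMap 𝒜 f) (objOf 𝒜 N n y) = objOf 𝒜 M n (pre (lin f) y) := ExtMod.map_of _ _ _ _

variable (𝒜) in
/-- The map `Ext^*(M / M_{≥ 1}, A_0) → Ext^*(M, A_0)`. -/
noncomputable def extHead (M : GrMod 𝒜) : extGr 𝒜 (ModuleCat.of A (Head M)) ⟶ extObj 𝒜 M :=
  mkHom (M := extGr 𝒜 (ModuleCat.of A (Head M))) (N := extObj 𝒜 M)
    (ExtMod.map (ModuleCat.ofHom M.tailSub.mkQ) (degZero 𝒜).toModuleCat)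
    (ExtMod.map_mem k (ModuleCat.ofHom M.tailSub.mkQ) (degZero 𝒜).toModuleCat)

theorem extHead_of (M : GrMod 𝒜) {n : ℕ} (y) : lin (extHead 𝒜 M) (grOf 𝒜 _ n y) =
    objOf 𝒜 M n (pre M.tailSub.mkQ y) := ExtMod.map_of _ _ _ _

variable (𝒜) in
/-- The connecting map `Ext^n(M_{≥ 1}, A_0) → Ext^{n+1}(M / M_{≥ 1}, A_0)`. -/
noncomputable def extConn (M : GrMod 𝒜) :
    extObj 𝒜 (tail M) →ₗ[Gam 𝒜] extGr 𝒜 (ModuleCat.of A (Head M)) :=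
  ExtMod.precomp (head_ses M).cls (degZero 𝒜).toModuleCat

theorem extConn_of (M : GrMod 𝒜) {n : ℕ} (y) : extConn 𝒜 M (objOf 𝒜 _ n y) =
    grOf 𝒜 _ (1 + n) ((head_ses M).cls.comp y rfl) := ExtMod.precomp_of _ _ _ _

theorem extConn_mem (M : GrMod 𝒜) (n : ℤ) (x : extObj 𝒜 (tail M))
    (hx : x ∈ (extObj 𝒜 (tail M)).deg n) :
    extConn 𝒜 M x ∈ (extGr 𝒜 (ModuleCat.of A (Head M))).deg (n + 1) := by
  obtain rfl | ⟨j, y, rfl, rfl⟩ := extObj_cases hx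
  · rw [map_zero]; exact Submodule.zero_mem _
  · rw [extConn_of]
    have := grOf_mem (𝒜 := 𝒜) ((head_ses M).cls.comp y rfl)
    push_cast at this
    rwa [add_comm] at this

/-- All three claims are the long exact `Ext` sequence of `0 → J M → M → M / J M → 0`, in which the
restriction `E(M) → E(J M)` vanishes by `IsKoszul.pre_tailι`. They are checked on homogeneous
elements, that is, on single classes. -/
theorem IsKoszul.ext_ses (hA : ∀ i, FiniteDimensional k (𝒜 i)) (hS : LeftSplitting (𝒜 0))
    (hK : IsKoszulAlgebra 𝒜) {M : GrMod 𝒜} (hM : IsKoszul M) :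
    SES (extConn 𝒜 M) (lin (extHead 𝒜 M)) where
  injective := by
    refine injective_of_homogeneous _ 1 (extConn_mem M) fun n x hx h => ?_
    obtain rfl | ⟨j, y, rfl, rfl⟩ := extObj_cases hx
    · rfl
    · rw [extConn_of, ← map_zero (grOf 𝒜 _ (1 + j))] at h
      obtain ⟨z, rfl⟩ := (head_ses M).exists_pre_of_cls y rfl (grOf_injective h)
      rw [hM.pre_tailι hA hS hK, map_zero]
  exact := by
    refine exact_of_homogeneous _ _ 0 (fun n m hm => by rw [add_zero]; exact lin_mem (extHead 𝒜 M) hm)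
      (fun n x hx => ?_) (fun n x hx h => ?_)
    · obtain rfl | ⟨j, y, rfl, rfl⟩ := extObj_cases hx
      · rw [map_zero, map_zero]
      · rw [extConn_of, extHead_of, (head_ses M).pre_cls_comp, map_zero]
    · obtain rfl | ⟨j, y, rfl, rfl⟩ := extGr_cases hx
      · exact ⟨0, map_zero _⟩
      · rw [extHead_of, ← map_zero (objOf 𝒜 _ j)] at h
        have h' := objOf_injective h
        -- The connecting map raises degree by one, so nothing hits degree 0; there `Hom(M / J M,
        -- A_0) → Hom(M, A_0)` is injective.
        rcases j with _ | j
        · exact ⟨0, by rw [(head_ses M).pre_injective_zero h', map_zero, map_zero]⟩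
        · obtain ⟨z, rfl⟩ := (head_ses M).exists_cls_of_pre y h' (add_comm 1 j)
          exact ⟨objOf 𝒜 _ j z, (extConn_of M z).trans (grOf_congr (add_comm 1 j) _ _ _ _)⟩
  surjective := by
    refine surjective_of_homogeneous _ fun n x hx => ?_
    obtain rfl | ⟨j, y, rfl, rfl⟩ := extObj_cases hx
    · exact ⟨0, map_zero _⟩
    · obtain ⟨z, rfl⟩ := (head_ses M).exists_pre_of_pre y (hM.pre_tailι hA hS hK y)
      exact ⟨grOf 𝒜 _ j z, extHead_of M z⟩

/-- `M / J M` is a direct summand of a finite power of `A_0`, hence `E(M / J M)` is one of a finite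
power of `Γ`. -/
theorem IsKoszul.extHead_projective (hA : ∀ i, FiniteDimensional k (𝒜 i)) {M : GrMod 𝒜}
    (hM : IsKoszul M) : Module.Projective (Gam 𝒜) (extGr 𝒜 (ModuleCat.of A (Head M))) := by
  obtain ⟨n, f, g, hfg⟩ := hM.exists_dualBasis_head hA
  exact ExtMod.projective_of_dualBasis (fun i => ModuleCat.ofHom (f i))
    (fun i => ModuleCat.ofHom (g i)) (by
      refine ModuleCat.hom_ext ?_
      rw [ModuleCat.hom_sum]
      exact hfg)

theorem IsKoszul.extHead_generatedIn (hA : ∀ i, FiniteDimensional k (𝒜 i)) {M : GrMod 𝒜}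
    (hM : IsKoszul M) : (extGr 𝒜 (ModuleCat.of A (Head M))).GeneratedIn 0 := by
  obtain ⟨n, f, g, hfg⟩ := hM.exists_dualBasis_head hA
  refine eq_top_iff.2 fun x _ => ?_
  have := ExtMod.eq_sum_of_dualBasis (fun i => ModuleCat.ofHom (f i))
    (fun i => ModuleCat.ofHom (g i)) (by
      refine ModuleCat.hom_ext ?_
      rw [ModuleCat.hom_sum]
      exact hfg) x
  rw [this]
  exact Submodule.sum_mem _ fun i _ => Submodule.smul_mem _ _
    (Submodule.subset_span (grOf_mem (j := 0) _))

variable (k) in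
/-- Precomposition with an extension class as a `k`-linear map. -/
noncomputable def clsLinear {X Y Z : Type u} [AddCommGroup X] [Module A X] [AddCommGroup Y]
    [Module A Y] [AddCommGroup Z] [Module A Z] {f : X →ₗ[A] Y} {g : Y →ₗ[A] Z} (S : SES f g)
    (W : ModuleCat.{u} A) (n : ℕ) :
    Ext (ModuleCat.of A X) W n →ₗ[k] Ext (ModuleCat.of A Z) W (n + 1) where
  toFun y := S.cls.comp y (add_comm 1 n)
  map_add' _ _ := Ext.comp_add _ _ _ _
  map_smul' r x := Ext.comp_smul _ _ _ _

/-- Homomorphisms `M → A_0` embed in the `k`-linear maps `M_0 → A_0` by restriction to the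
generators. -/
theorem GeneratedIn.finite_ext_zero (hA : FiniteDimensional k (𝒜 0)) {M : GrMod 𝒜}
    (hM : M.GeneratedIn 0) (hf : FiniteDimensional k (M.deg 0)) :
    FiniteDimensional k (Ext M.toModuleCat (degZero 𝒜).toModuleCat 0) := by
  letI : Module k (M.toModuleCat ⟶ (degZero 𝒜).toModuleCat) := Linear.homModule _ _
  let ev : (M.toModuleCat ⟶ (degZero 𝒜).toModuleCat) →ₗ[k] (M.deg 0 →ₗ[k] degZero 𝒜) :=
    { toFun := fun f =>
        { toFun := fun m => f.hom m.1
          map_add' := fun x y => map_add f.hom x.1 y.1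
          map_smul' := fun r x => lin_smul_base (N := degZero 𝒜) f.hom r x.1 }
      map_add' := fun f g => rfl
      map_smul' := fun r f => LinearMap.ext fun m => (degZero 𝒜).lin_algebraMap r (f.hom m.1) }
  have hev : Function.Injective ev := fun f g h => ModuleCat.hom_ext
    (hM.hom_ext (N := degZero 𝒜) fun m hm => LinearMap.congr_fun h ⟨m, hm⟩)
  have : FiniteDimensional k (degZero 𝒜) := hA
  have := Module.Finite.of_injective ev hev
  exact Module.Finite.equiv (Ext.linearEquiv₀ (R := k)).symm

/-- Dimension shift along syzygies: `Ext^n` of the syzygy surjects onto `Ext^{n+1}(M, A_0)`. -/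
theorem IsKoszul.finite_ext (hA : ∀ i, FiniteDimensional k (𝒜 i)) (n : ℕ) :
    ∀ {M : GrMod 𝒜}, IsKoszul M →
      FiniteDimensional k (Ext M.toModuleCat (degZero 𝒜).toModuleCat n) := by
  induction n with
  | zero => exact fun hM => hM.generatedIn.finite_ext_zero (hA 0) (hM.locallyFinite 0)
  | succ n ih =>
    intro M hM
    obtain ⟨P, π, hc, -, hs⟩ := hM.exists_cover hA
    have := hc.projective
    have := ih hs
    exact Module.Finite.of_surjective (clsLinear k (syz_ses hc.surjective) (degZero 𝒜).toModuleCat n)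
      fun y => (syz_ses hc.surjective).exists_cls_of_pre y
        (ext_eq_zero_of_projective _ (by omega)) (add_comm 1 n)

theorem objOf_smul {M : GrMod 𝒜} {n : ℕ} (r : k)
    (y : Ext M.toModuleCat (degZero 𝒜).toModuleCat n) :
    objOf 𝒜 M n (r • y) = r • objOf 𝒜 M n y :=
  (ExtMod.smul_of k M.toModuleCat (degZero 𝒜).toModuleCat n r y).symm

/-- The inclusion of `Ext^n(M, A_0)` as a `k`-linear map. -/
noncomputable def objLof (M : GrMod 𝒜) (n : ℕ) :
    Ext M.toModuleCat (degZero 𝒜).toModuleCat n →ₗ[k] extObj 𝒜 M where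
  toFun := objOf 𝒜 M n
  map_add' := map_add _
  map_smul' := objOf_smul

theorem IsKoszul.locallyFinite_extObj (hA : ∀ i, FiniteDimensional k (𝒜 i)) {M : GrMod 𝒜}
    (hM : IsKoszul M) : (extObj 𝒜 M).LocallyFinite := fun n => by
  rcases lt_or_ge n 0 with hn | hn
  · have : (extObj 𝒜 M).deg n = ⊥ :=
      (Submodule.eq_bot_iff _).2 fun x hx => ExtMod.eq_zero_of_neg hn hx
    rw [this]; infer_instance
  · lift n to ℕ using hn
    have := hM.finite_ext hA n
    refine Module.Finite.of_surjective
      ((objLof M n).codRestrict ((extObj 𝒜 M).deg n) objOf_mem) fun x => ?_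
    obtain ⟨y, hy⟩ := ExtMod.exists_of x.2
    exact ⟨y, Subtype.ext hy⟩

theorem IsKoszul.generatedIn_extObj (hA : ∀ i, FiniteDimensional k (𝒜 i))
    (hS : LeftSplitting (𝒜 0)) (hK : IsKoszulAlgebra 𝒜) {M : GrMod 𝒜} (hM : IsKoszul M) :
    (extObj 𝒜 M).GeneratedIn 0 :=
  (hM.extHead_generatedIn hA).of_surjective (extHead 𝒜 M) (hM.ext_ses hA hS hK).surjective

/-- `Ext_A^*(-, A_0)` sends Koszul modules to Koszul modules. -/
theorem IsKoszul.extObj (hA : ∀ i, FiniteDimensional k (𝒜 i)) (hS : LeftSplitting (𝒜 0))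
    (hK : IsKoszulAlgebra 𝒜) {M : GrMod 𝒜} (hM : IsKoszul M) : IsKoszul (extObj 𝒜 M) := by
  -- The class consists of everything isomorphic to some `E(M)`; the syzygy of `E(M)` with respect
  -- to the cover `E(M / J M)` is isomorphic to `E(tail M)`.
  refine IsKoszul.coinduction (fun N : GrMod (gamGrading 𝒜) => ∃ M : GrMod 𝒜, IsKoszul M ∧
    Nonempty (GenKoszul.extObj 𝒜 M ≅ N)) ?_ ?_ ⟨M, hM, ⟨Iso.refl _⟩⟩
  · rintro N ⟨M, hM, ⟨e⟩⟩
    exact ⟨(hM.locallyFinite_extObj hA).of_surjective e.hom (iso_bijective e).2,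
      (hM.generatedIn_extObj hA hS hK).of_surjective e.hom (iso_bijective e).2⟩
  · rintro N ⟨M, hM, ⟨e⟩⟩
    have S := hM.ext_ses hA hS hK
    have he := iso_bijective e
    refine ⟨extGr 𝒜 (ModuleCat.of A (Head M)), extHead 𝒜 M ≫ e.hom,
      ⟨hM.extHead_projective hA, hM.extHead_generatedIn hA, he.2.comp S.surjective⟩,
      GrMod.tail M, hM.isKoszul_tail hA hS hK, ⟨isoOfBijective (syzLift (extHead 𝒜 M ≫ e.hom) (extConn 𝒜 M)
        (extConn_mem M) fun m => by
          rw [lin_comp, (S.exact _).2 ⟨m, rfl⟩, map_zero]) ⟨fun x y h => ?_, fun y => ?_⟩⟩⟩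
    · exact S.injective (congrArg (syzι _) h)
    · have h := lin_syzι (extHead 𝒜 M ≫ e.hom) y
      rw [lin_comp] at h
      obtain ⟨x, hx⟩ := (S.exact _).1 (he.1 (h.trans (map_zero _).symm))
      exact ⟨x, syzι_injective _ hx⟩

end GrMod
end GenKoszul

/-! ### The Yoneda algebra satisfies the same hypotheses. -/

namespace GenKoszul
open Abelian

theorem LeftSplitting.of_ringEquiv {R S : Type u} [Ring R] [Ring S] (e : R ≃+* S)
    (hS : LeftSplitting S) : LeftSplitting R := by
  intro P Q N _ _ _ _ _ _ f g hf hfg hg hP hQ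
  letI := RingHomInvPair.of_ringEquiv e
  letI := RingHomInvPair.of_ringEquiv e.symm
  letI : Module S P := Module.compHom P (e.symm : S →+* R)
  letI : Module S Q := Module.compHom Q (e.symm : S →+* R)
  letI : Module S N := Module.compHom N (e.symm : S →+* R)
  have hP' : Module.Projective S P := Module.Projective.of_equiv (R := R)
    ({ AddEquiv.refl P with
      map_smul' := fun r x => by
        change r • x = e.symm (e r) • x
        rw [e.symm_apply_apply] } : P ≃ₛₗ[(e : R →+* S)] P)
  have hQ' : Module.Projective S Q := Module.Projective.of_equiv (R := R)
    ({ AddEquiv.refl Q with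
      map_smul' := fun r x => by
        change r • x = e.symm (e r) • x
        rw [e.symm_apply_apply] } : Q ≃ₛₗ[(e : R →+* S)] Q)
  obtain ⟨s, hs⟩ := hS P Q N { f with map_smul' := fun r x => map_smul f (e.symm r) x }
    { g with map_smul' := fun r x => map_smul g (e.symm r) x } hf hfg hg hP' hQ'
  refine ⟨{ s with map_smul' := fun r x => ?_ }, LinearMap.ext fun x => LinearMap.congr_fun hs x⟩
  have := map_smul s (e r) x
  change s (e.symm (e r) • x) = e.symm (e r) • s x at this
  rw [e.symm_apply_apply] at this
  exact this

/-- An anti-isomorphism exchanges left and right modules; the two-sided form of (S) is what makes it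
survive the passage from `A_0` to `Γ_0`. -/
theorem SplittingCondition.of_antiEquiv {R S : Type u} [Ring R] [Ring S] (e : R ≃+* Sᵐᵒᵖ)
    (hS : SplittingCondition S) : SplittingCondition R :=
  ⟨hS.2.of_ringEquiv e, hS.1.of_ringEquiv (e.op.trans (RingEquiv.opOp S).symm)⟩

namespace GrMod

variable {k : Type v} [Field k] {A : Type u} [Ring A] [Algebra k A] {𝒜 : ℕ → Submodule k A}
variable [GradedAlgebra 𝒜]

/-- Right multiplication on `A_0`. -/
def rightMul (c : 𝒜 0) : degZero 𝒜 →ₗ[A] degZero 𝒜 where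
  toFun x := degZeroMk 𝒜 ((show 𝒜 0 from x) * c)
  map_add' x y := congrArg (degZeroMk 𝒜) (add_mul (show 𝒜 0 from x) (show 𝒜 0 from y) c)
  map_smul' a x := by
    obtain ⟨b, rfl⟩ := degZeroMk_surjective x
    rw [RingHom.id_apply, smul_degZeroMk, smul_degZeroMk]
    exact congrArg (degZeroMk 𝒜) (mul_assoc _ _ _)

@[simp] theorem rightMul_degZeroMk (c b : 𝒜 0) :
    rightMul c (degZeroMk 𝒜 b) = degZeroMk 𝒜 (b * c) := rfl

theorem smul_degZeroMk_one (b : 𝒜 0) : (b : A) • degZeroMk 𝒜 1 = degZeroMk 𝒜 b := by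
  rw [smul_degZeroMk, projZero_coe, mul_one]

theorem degZero_hom_ext {V : Type*} [AddCommGroup V] [Module A V] {f g : degZero 𝒜 →ₗ[A] V}
    (h : f (degZeroMk 𝒜 1) = g (degZeroMk 𝒜 1)) : f = g := LinearMap.ext fun x => by
  obtain ⟨b, rfl⟩ := degZeroMk_surjective x
  rw [← smul_degZeroMk_one, map_smul, map_smul, h]

theorem exists_rightMul (f : degZero 𝒜 →ₗ[A] degZero 𝒜) : ∃ c, rightMul c = f := by
  obtain ⟨c, hc⟩ := degZeroMk_surjective (f (degZeroMk 𝒜 1))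
  exact ⟨c, degZero_hom_ext (by rw [rightMul_degZeroMk, one_mul, hc])⟩

/-- Right multiplication as an element of `Γ_0`. -/
noncomputable def gamMk (c : 𝒜 0) : gamGrading 𝒜 0 :=
  ⟨ExtAlg.of _ 0 (Ext.mk₀ (ModuleCat.ofHom (rightMul c))), ExtAlg.of_mem k _ 0 _⟩

/-- `A_0` is generated over `A` by 1, so its endomorphisms are the right multiplications by the
images of 1. -/
theorem gamMk_bijective : Function.Bijective (gamMk (𝒜 := 𝒜)) := by
  refine ⟨fun c d h => ?_, fun x => ?_⟩
  · have h1 := ExtAlg.of_injective _ _ (congrArg Subtype.val h)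
    have h2 := congrArg ModuleCat.Hom.hom ((Ext.mk₀_bijective _ _).1 h1)
    have h3 := LinearMap.congr_fun (show rightMul c = rightMul d from h2) (degZeroMk 𝒜 1)
    rw [rightMul_degZeroMk, rightMul_degZeroMk, one_mul, one_mul] at h3
    exact degZeroMk_injective h3
  · obtain ⟨y, hy⟩ := ExtAlg.exists_of x.2
    obtain ⟨f, rfl⟩ := (Ext.mk₀_bijective _ _).2 y
    obtain ⟨c, hc⟩ := exists_rightMul (𝒜 := 𝒜) f.hom
    refine ⟨c, Subtype.ext (Eq.trans ?_ hy)⟩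
    change ExtAlg.of _ 0 (Ext.mk₀ (ModuleCat.ofHom (rightMul c))) = _
    rw [hc]; rfl

variable (𝒜) in
/-- `Γ_0` is the opposite of `A_0`. -/
noncomputable def gamZeroEquiv : gamGrading 𝒜 0 ≃+* (𝒜 0)ᵐᵒᵖ :=
  RingEquiv.symm
    { Equiv.ofBijective (fun c : (𝒜 0)ᵐᵒᵖ => gamMk c.unop)
        (gamMk_bijective.comp MulOpposite.unop_bijective) with
      map_mul' := fun c d => Subtype.ext (by
        change ExtAlg.of _ 0 _ = ExtAlg.of _ 0 _ * ExtAlg.of _ 0 _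
        rw [ExtAlg.of_mul_of, Ext.mk₀_comp_mk₀]
        congr 2
        refine ModuleCat.hom_ext (degZero_hom_ext ?_)
        change rightMul (d.unop * c.unop) (degZeroMk 𝒜 1) =
          rightMul c.unop (rightMul d.unop (degZeroMk 𝒜 1))
        rw [rightMul_degZeroMk, rightMul_degZeroMk, rightMul_degZeroMk, one_mul, one_mul])
      map_add' := fun c d => Subtype.ext (by
        change ExtAlg.of _ 0 _ = ExtAlg.of _ 0 _ + ExtAlg.of _ 0 _
        rw [← map_add, ← Ext.mk₀_add]
        congr 2
        refine ModuleCat.hom_ext (degZero_hom_ext ?_)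
        change rightMul (c.unop + d.unop) (degZeroMk 𝒜 1) =
          rightMul c.unop (degZeroMk 𝒜 1) + rightMul d.unop (degZeroMk 𝒜 1)
        simp only [rightMul_degZeroMk, one_mul, degZeroMk_add]) }

/-! ### `E(A)` is `Γ_0` -/

variable (𝒜) in
/-- The surjection from `Γ` to `E(A)`. -/
noncomputable def gamToExtReg : Gam 𝒜 →ₗ[Gam 𝒜] extObj 𝒜 (reg 𝒜) :=
  ExtMod.map (ModuleCat.ofHom (lin (regProj 𝒜))) (degZero 𝒜).toModuleCat ∘ₗ
    (ExtMod.toAlg (degZero 𝒜).toModuleCat).symm.toLinearMap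

theorem gamToExtReg_of {n : ℕ} (y : Ext (degZero 𝒜).toModuleCat (degZero 𝒜).toModuleCat n) :
    gamToExtReg 𝒜 (ExtAlg.of _ n y) = objOf 𝒜 _ n (pre (lin (regProj 𝒜)) y) :=
  ExtMod.map_of _ _ _ _

/-- `A` is projective, so `Ext^n(A, A_0) = 0` for `n > 0` and the positive degrees of `Γ` die. This
makes the map from the quotient `Γ_0` linear over `Γ`. -/
theorem gamToExtReg_proj (x : Gam 𝒜) :
    gamToExtReg 𝒜 (GradedRing.projZeroRingHom' (gamGrading 𝒜) x : Gam 𝒜) = gamToExtReg 𝒜 x := by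
  change gamToExtReg 𝒜 (decompose (gamGrading 𝒜) x 0 : Gam 𝒜) = _
  induction x using ExtAlg.induction with
  | h0 => simp
  | hadd y z hy hz => rw [decompose_add, DirectSum.add_apply, Submodule.coe_add, map_add, hy, hz, map_add]
  | hof n y =>
    by_cases hn : n = 0
    · subst hn
      rw [DirectSum.decompose_of_mem_same (gamGrading 𝒜) (ExtAlg.of_mem k _ 0 y)]
    · rw [DirectSum.decompose_of_mem_ne (gamGrading 𝒜) (ExtAlg.of_mem k _ n y) hn, map_zero,
        gamToExtReg_of, ext_eq_zero_of_projective (pre (lin (regProj 𝒜)) y) hn, map_zero]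

/-- Elements of `E(A)` are homogeneous of degree zero. -/
theorem extObj_reg_cases (x : extObj 𝒜 (reg 𝒜)) :
    ∃ f : reg 𝒜 →ₗ[A] degZero 𝒜, x = objOf 𝒜 _ 0 (Ext.mk₀ (ModuleCat.ofHom f)) := by
  induction x using objOf_induction with
  | h0 => exact ⟨0, by rw [ModuleCat.ofHom_zero, Ext.mk₀_zero, map_zero]⟩
  | hadd y z hy hz =>
    obtain ⟨f, rfl⟩ := hy
    obtain ⟨g, rfl⟩ := hz
    exact ⟨f + g, by rw [ModuleCat.ofHom_add, Ext.mk₀_add, map_add]⟩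
  | hof n y =>
    by_cases hn : n = 0
    · subst hn
      obtain ⟨f, rfl⟩ := (Ext.mk₀_bijective _ _).2 y
      exact ⟨f.hom, rfl⟩
    · exact ⟨0, by rw [ModuleCat.ofHom_zero, Ext.mk₀_zero, map_zero, ext_eq_zero_of_projective y hn,
        map_zero]⟩

variable (𝒜) in
/-- The map from `Γ_0` to `E(A)`. -/
noncomputable def degZeroToExtReg : degZero (gamGrading 𝒜) ⟶ extObj 𝒜 (reg 𝒜) :=
  mkHom (M := degZero (gamGrading 𝒜)) (N := extObj 𝒜 (reg 𝒜))
    { toFun := fun x => gamToExtReg 𝒜 (show gamGrading 𝒜 0 from x : Gam 𝒜)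
      map_add' := fun x y => map_add (gamToExtReg 𝒜) _ _
      map_smul' := fun c x => by
        obtain ⟨b, rfl⟩ := degZeroMk_surjective x
        rw [smul_degZeroMk, RingHom.id_apply, ← map_smul]
        change gamToExtReg 𝒜 ((GradedRing.projZeroRingHom' (gamGrading 𝒜) c : Gam 𝒜) * b.1) =
          gamToExtReg 𝒜 (c * b.1)
        rw [← gamToExtReg_proj ((GradedRing.projZeroRingHom' (gamGrading 𝒜) c : Gam 𝒜) * b.1),
          ← gamToExtReg_proj (c * b.1), map_mul, map_mul, projZero_coe] }
    fun n m hm => by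
      by_cases hn : n = 0
      · subst hn
        obtain ⟨f, hf⟩ := extObj_reg_cases (gamToExtReg 𝒜 (show gamGrading 𝒜 0 from m : Gam 𝒜))
        change gamToExtReg 𝒜 (show gamGrading 𝒜 0 from m : Gam 𝒜) ∈ _
        rw [hf]
        exact objOf_mem (j := 0) _
      · rw [eq_zero_of_mem_deg hn hm (mem_degZero_deg m), map_zero]
        exact Submodule.zero_mem _

theorem degZeroToExtReg_mk (c : 𝒜 0) : lin (degZeroToExtReg 𝒜) (degZeroMk _ (gamMk c)) =
    objOf 𝒜 _ 0 (Ext.mk₀ (ModuleCat.ofHom (regLin 𝒜 (degZeroMk 𝒜 c)))) := by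
  refine (gamToExtReg_of _).trans ?_
  rw [pre_mk₀]
  congr 2
  refine ModuleCat.hom_ext ?_
  change rightMul c ∘ₗ lin (regProj 𝒜) = regLin 𝒜 (degZeroMk 𝒜 c)
  rw [← regLin_one (rightMul c ∘ₗ lin (regProj 𝒜)), LinearMap.comp_apply, lin_regProj, map_one,
    rightMul_degZeroMk, one_mul]

/-- Both sides are copies of `A_0`: on the left by `gamMk`, and on the right because `E(A) =
Hom_A(A, A_0)`. -/
theorem degZeroToExtReg_bijective : Function.Bijective (lin (degZeroToExtReg 𝒜)) := by
  refine ⟨(injective_iff_map_eq_zero _).2 fun x hx => ?_, fun x => ?_⟩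
  · obtain ⟨b, rfl⟩ := degZeroMk_surjective x
    obtain ⟨c, rfl⟩ := gamMk_bijective.2 b
    rw [degZeroToExtReg_mk, ← map_zero (objOf 𝒜 _ 0)] at hx
    have h1 := (Ext.mk₀_eq_zero_iff _).1 (objOf_injective hx)
    have h2 := LinearMap.congr_fun (congrArg ModuleCat.Hom.hom h1) (regMk 𝒜 1)
    have h3 : degZeroMk 𝒜 c = 0 := by
      refine Eq.trans ?_ h2
      change _ = regLin 𝒜 (degZeroMk 𝒜 c) (regMk 𝒜 1)
      rw [regLin_regMk, one_smul]
    have h4 : c = 0 := h3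
    have h5 : gamMk (0 : 𝒜 0) = 0 := by
      refine Subtype.ext ?_
      change ExtAlg.of _ 0 (Ext.mk₀ (ModuleCat.ofHom (rightMul (0 : 𝒜 0)))) = 0
      have : rightMul (0 : 𝒜 0) = 0 := degZero_hom_ext (by rw [rightMul_degZeroMk, mul_zero]; rfl)
      rw [this, ModuleCat.ofHom_zero, Ext.mk₀_zero, map_zero]
    rw [h4, h5]; rfl
  · obtain ⟨f, rfl⟩ := extObj_reg_cases x
    obtain ⟨c, hc⟩ := degZeroMk_surjective (f (regMk 𝒜 1))
    exact ⟨degZeroMk _ (gamMk c), by rw [degZeroToExtReg_mk, hc, regLin_one]⟩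

variable (𝒜) in
/-- The isomorphism of `Γ_0` with `E(A)`. -/
noncomputable def degZeroIso : degZero (gamGrading 𝒜) ≅ extObj 𝒜 (reg 𝒜) :=
  isoOfBijective (degZeroToExtReg 𝒜) degZeroToExtReg_bijective

end GrMod

open GrMod

/-- The standing assumptions on a generalized Koszul algebra. -/
class IsGenKoszul {k : Type v} [Field k] {A : Type u} [Ring A] [Algebra k A]
    (𝒜 : ℕ → Submodule k A) [GradedAlgebra 𝒜] : Prop where
  finite : ∀ i : ℕ, FiniteDimensional k (𝒜 i)
  splitting : SplittingCondition (𝒜 0)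
  koszul : IsKoszulAlgebra 𝒜

variable {k : Type v} [Field k] {A : Type u} [Ring A] [Algebra k A] {𝒜 : ℕ → Submodule k A}
variable [GradedAlgebra 𝒜]

theorem IsGenKoszul.isKoszul_extObj [h : IsGenKoszul 𝒜] {M : GrMod 𝒜} (hM : IsKoszul M) :
    IsKoszul (extObj 𝒜 M) := hM.extObj h.finite h.splitting.1 h.koszul

/-- The Yoneda algebra satisfies the same assumptions. -/
instance IsGenKoszul.gam [h : IsGenKoszul 𝒜] : IsGenKoszul (gamGrading 𝒜) where
  finite n := by
    have := h.koszul.finite_ext h.finite n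
    let f : Ext (degZero 𝒜).toModuleCat (degZero 𝒜).toModuleCat n →ₗ[k] Gam 𝒜 :=
      { toFun := ExtAlg.of _ n
        map_add' := map_add _
        map_smul' := fun r x => (ExtAlg.smul_of k _ n r x).symm }
    refine Module.Finite.of_surjective
      (f.codRestrict (gamGrading 𝒜 n) (ExtAlg.of_mem k _ n)) fun x => ?_
    obtain ⟨y, hy⟩ := ExtAlg.exists_of x.2
    exact ⟨y, Subtype.ext hy⟩
  splitting := h.splitting.of_antiEquiv (gamZeroEquiv 𝒜)
  -- `A` is a Koszul module over itself, so `E(A)` is Koszul over `Γ`, and it is `Γ_0`.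
  koszul := (IsGenKoszul.isKoszul_extObj (reg_isKoszul h.finite)).of_iso (degZeroIso 𝒜).symm

end GenKoszul

namespace GenKoszul
open Abelian
namespace GrMod

/-! ### The double dual of a Koszul module -/

variable {k : Type v} [Field k] {A : Type u} [Ring A] [Algebra k A] {𝒜 : ℕ → Submodule k A}

/-- The component of degree `n + 1`, as an element of the tail. -/
noncomputable def tailPr (M : GrMod 𝒜) [GradedAlgebra 𝒜] (n : ℕ) : M →ₗ[k] tail M :=
  LinearMap.codRestrict (M.tailSub.restrictScalars k) (M.pr (n + 1))
    fun m => mem_tailSub_of_mem_deg (by omega) (M.pr_mem (n + 1) m)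

variable [GradedAlgebra 𝒜]

@[simp] theorem tailι_tailPr (M : GrMod 𝒜) (n : ℕ) (m : M) :
    tailι M (tailPr M n m) = M.pr (n + 1) m := rfl

theorem tailPr_mem (M : GrMod 𝒜) (n : ℕ) (m : M) : tailPr M n m ∈ (tail M).deg n :=
  mem_tail_deg.2 (M.pr_mem _ m)

variable (𝒜) in
/-- The degree zero elements of `E(A)`. -/
noncomputable def extRegMk (x : degZero 𝒜) : extObj 𝒜 (reg 𝒜) :=
  objOf 𝒜 _ 0 (Ext.mk₀ (ModuleCat.ofHom (regLin 𝒜 x)))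

theorem extRegMk_surjective (x : extObj 𝒜 (reg 𝒜)) : ∃ y, extRegMk 𝒜 y = x := by
  obtain ⟨f, rfl⟩ := extObj_reg_cases x
  exact ⟨f (regMk 𝒜 1), by rw [extRegMk, regLin_one]⟩

theorem extRegMk_injective : Function.Injective (extRegMk 𝒜) := fun x y h => by
  have h1 := (Ext.mk₀_bijective _ _).1 (objOf_injective h)
  have h2 := LinearMap.congr_fun (show regLin 𝒜 x = regLin 𝒜 y from
    congrArg ModuleCat.Hom.hom h1) (regMk 𝒜 1)
  rwa [regLin_regMk, regLin_regMk, one_smul, one_smul] at h2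

theorem extRegMk_add (x y : degZero 𝒜) : extRegMk 𝒜 (x + y) = extRegMk 𝒜 x + extRegMk 𝒜 y := by
  have : regLin 𝒜 (x + y) = regLin 𝒜 x + regLin 𝒜 y :=
    LinearMap.ext fun a => smul_add _ _ _
  rw [extRegMk, this, ModuleCat.ofHom_add, Ext.mk₀_add, map_add]; rfl

theorem extRegMk_zero : extRegMk 𝒜 (0 : degZero 𝒜) = 0 :=
  map_zero (AddMonoidHom.mk' (extRegMk 𝒜) extRegMk_add)

theorem of_smul_extRegMk (f : degZero 𝒜 →ₗ[A] degZero 𝒜) (x : degZero 𝒜) :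
    (ExtAlg.of _ 0 (Ext.mk₀ (ModuleCat.ofHom f)) : Gam 𝒜) • extRegMk 𝒜 x = extRegMk 𝒜 (f x) := by
  rw [extRegMk, of_smul_objOf, Ext.mk₀_comp_mk₀]
  refine congrArg (objOf 𝒜 _ 0) (congrArg Ext.mk₀ (ModuleCat.hom_ext ?_))
  exact LinearMap.ext fun a => map_smul f _ _

/-- Evaluation at an element of `M`, as a map `E(M) → E(A)`. -/
noncomputable def evalHom (M : GrMod 𝒜) (m : M) : extObj 𝒜 M →ₗ[Gam 𝒜] extObj 𝒜 (reg 𝒜) :=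
  ExtMod.map (ModuleCat.ofHom (regLin 𝒜 m)) (degZero 𝒜).toModuleCat

theorem evalHom_mk₀ (M : GrMod 𝒜) (m : M) (f : M →ₗ[A] degZero 𝒜) :
    evalHom M m (objOf 𝒜 M 0 (Ext.mk₀ (ModuleCat.ofHom f))) = extRegMk 𝒜 (f m) := by
  refine (ExtMod.map_of _ _ _ _).trans ?_
  rw [Ext.mk₀_comp_mk₀]
  refine congrArg (objOf 𝒜 _ 0) (congrArg Ext.mk₀ (ModuleCat.hom_ext ?_))
  exact LinearMap.ext fun a => map_smul f _ _

theorem evalHom_lin {M N : GrMod 𝒜} (f : M ⟶ N) (m : M) :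
    evalHom N (lin f m) = evalHom M m ∘ₗ lin (extMap 𝒜 f) := by
  refine LinearMap.ext fun x => ?_
  refine Eq.trans ?_ (ExtMod.map_comp (ModuleCat.ofHom (regLin 𝒜 m)) (ModuleCat.ofHom (lin f)) _ x)
  have : regLin 𝒜 (lin f m) = lin f ∘ₗ regLin 𝒜 m := LinearMap.ext fun a => (map_smul (lin f) _ _).symm
  rw [evalHom, this]; rfl

theorem evalHom_regHom {M : GrMod 𝒜} {m : M} (hm : m ∈ M.deg 0) :
    lin (extMap 𝒜 (regHom M m hm)) = evalHom M m := rfl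

/-- `E(M)` is generated over `Γ` by `Hom(M, A_0)`. Thus identities between maps out of `E(M)`, such
as additivity of evaluation in `m`, reduce to classes of degree 0, where `evalHom` is honest
evaluation. -/
theorem extObj_hom_ext [h : IsGenKoszul 𝒜] {M : GrMod 𝒜} (hM : IsKoszul M) {V : Type*}
    [AddCommGroup V] [Module (Gam 𝒜) V] {f g : extObj 𝒜 M →ₗ[Gam 𝒜] V}
    (hfg : ∀ e : M →ₗ[A] degZero 𝒜, f (objOf 𝒜 M 0 (Ext.mk₀ (ModuleCat.ofHom e))) =
      g (objOf 𝒜 M 0 (Ext.mk₀ (ModuleCat.ofHom e)))) : f = g := by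
  refine LinearMap.ext_on (hM.generatedIn_extObj h.finite h.splitting.1 h.koszul) fun x hx => ?_
  obtain rfl | ⟨j, y, hj, rfl⟩ := extObj_cases hx
  · rw [map_zero, map_zero]
  · obtain rfl : j = 0 := by exact_mod_cast hj.symm
    obtain ⟨e, rfl⟩ := (Ext.mk₀_bijective _ _).2 y
    exact hfg e.hom

theorem evalHom_add [IsGenKoszul 𝒜] {M : GrMod 𝒜} (hM : IsKoszul M) (x y : M) :
    evalHom M (x + y) = evalHom M x + evalHom M y := extObj_hom_ext hM fun e => by
  rw [LinearMap.add_apply, evalHom_mk₀, evalHom_mk₀, evalHom_mk₀, map_add, extRegMk_add]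

theorem evalHom_smul [IsGenKoszul 𝒜] {M : GrMod 𝒜} (hM : IsKoszul M) (r : k) (x : M)
    (z : extObj 𝒜 M) : evalHom M (r • x) z = r • evalHom M x z := by
  let g : extObj 𝒜 M →ₗ[Gam 𝒜] extObj 𝒜 (reg 𝒜) :=
    { toFun := fun z => r • evalHom M x z
      map_add' := fun x y => by rw [map_add, smul_add]
      map_smul' := fun a x => by
        rw [map_smul, RingHom.id_apply, ← lin_algebraMap, ← lin_algebraMap, smul_smul, smul_smul,
          Algebra.commutes] }
  refine LinearMap.congr_fun (g := g) (extObj_hom_ext hM fun e => ?_) z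
  change _ = r • evalHom M x (objOf 𝒜 M 0 (Ext.mk₀ (ModuleCat.ofHom e)))
  rw [evalHom_mk₀, evalHom_mk₀, lin_smul_base (N := degZero 𝒜) e, extRegMk, extRegMk, ← objOf_smul,
    ← Ext.mk₀_smul]
  refine congrArg (objOf 𝒜 _ 0) (congrArg Ext.mk₀ (ModuleCat.hom_ext (LinearMap.ext fun a => ?_)))
  change (show A from a) • r • e x = algebraMap k A r • (show A from a) • e x
  rw [← lin_algebraMap, smul_smul, smul_smul, Algebra.commutes]

/-- The dual basis shows that homomorphisms to `A_0` separate the elements of `M_0`. -/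
theorem evalHom_eq_zero [h : IsGenKoszul 𝒜] {M : GrMod 𝒜} (hM : IsKoszul M) {m : M}
    (hm : m ∈ M.deg 0) (h0 : evalHom M m = 0) : m = 0 := by
  obtain ⟨n, x, f, hx, hf⟩ := hM.exists_dualBasis h.finite
  refine (hf m hm (fun _ => 0) fun i => ?_).trans (by simp)
  have := evalHom_mk₀ M m (f i)
  rw [h0, LinearMap.zero_apply] at this
  refine extRegMk_injective (this.symm.trans extRegMk_zero.symm)

/-- Reflexivity of the finitely generated projective `A_0`-module `M_0`: for a dual basis `x i`, `f
i`, a functional `g` on the dual is evaluation at the sum of the `g (f i) • x i`. -/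
theorem exists_evalHom [h : IsGenKoszul 𝒜] {M : GrMod 𝒜} (hM : IsKoszul M)
    (g : extObj 𝒜 M →ₗ[Gam 𝒜] extObj 𝒜 (reg 𝒜)) : ∃ m ∈ M.deg 0, evalHom M m = g := by
  obtain ⟨n, x, f, hx, hf⟩ := hM.exists_dualBasis h.finite
  choose y hy using fun i => extRegMk_surjective (g (objOf 𝒜 M 0 (Ext.mk₀ (ModuleCat.ofHom (f i)))))
  choose a ha using fun i => degZeroMk_surjective (y i)
  refine ⟨∑ i, (a i : A) • x i, Submodule.sum_mem _ fun i _ => ?_, extObj_hom_ext hM fun e => ?_⟩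
  · simpa using M.smul_mem 0 0 _ _ (a i).2 (hx i)
  · choose c hc using fun i => degZeroMk_surjective (e (x i))
    -- The `f i` generate `Hom(M, A_0)` over `Γ_0`, with the coefficients of `e` given by right
    -- multiplication by `e (x i)`.
    have he : e = ∑ i, rightMul (c i) ∘ₗ f i := hM.generatedIn.hom_ext (N := degZero 𝒜) fun z hz => by
      choose b hb using fun i => degZeroMk_surjective (f i z)
      conv_lhs => rw [hf z hz b fun i => (hb i).symm]
      rw [map_sum, LinearMap.sum_apply]
      refine Finset.sum_congr rfl fun i _ => ?_
      rw [map_smul, LinearMap.comp_apply, ← hb, ← hc, rightMul_degZeroMk, smul_degZeroMk, projZero_coe]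
    have he' : objOf 𝒜 M 0 (Ext.mk₀ (ModuleCat.ofHom e)) =
        ∑ i, (ExtAlg.of _ 0 (Ext.mk₀ (ModuleCat.ofHom (rightMul (c i)))) : Gam 𝒜) •
          objOf 𝒜 M 0 (Ext.mk₀ (ModuleCat.ofHom (f i))) := by
      have : ModuleCat.ofHom e = ∑ i, ModuleCat.ofHom (rightMul (c i) ∘ₗ f i) := by
        refine ModuleCat.hom_ext ?_
        rw [ModuleCat.hom_sum]; exact he
      rw [this, Ext.mk₀_sum, map_sum]
      refine Finset.sum_congr rfl fun i _ => ?_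
      rw [of_smul_objOf, Ext.mk₀_comp_mk₀]; rfl
    rw [evalHom_mk₀, he', map_sum, map_sum]
    have hadd : ∀ s : Finset (Fin n), extRegMk 𝒜 (∑ i ∈ s, e ((a i : A) • x i)) =
        ∑ i ∈ s, extRegMk 𝒜 (e ((a i : A) • x i)) := fun s =>
      map_sum (AddMonoidHom.mk' (extRegMk 𝒜) extRegMk_add) _ _
    rw [hadd]
    refine Finset.sum_congr rfl fun i _ => ?_
    rw [map_smul, map_smul, ← hy, of_smul_extRegMk, ← hc, ← ha, rightMul_degZeroMk, smul_degZeroMk,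
      projZero_coe]

end GrMod
end GenKoszul

/-! ### The comparison map from a Koszul module to its double dual. -/

namespace GenKoszul
open Abelian
namespace GrMod

variable {k : Type v} [Field k] {A : Type u} [Ring A] [Algebra k A] {𝒜 : ℕ → Submodule k A}
variable [GradedAlgebra 𝒜]

/-- The short exact sequence of `Ext_A^*(A_0, A_0)`-modules that starts with `E(M_{≥ 1})`. -/
theorem IsKoszul.ses [h : IsGenKoszul 𝒜] {M : GrMod 𝒜} (hM : IsKoszul M) :
    SES (extConn 𝒜 M) (lin (extHead 𝒜 M)) := hM.ext_ses h.finite h.splitting.1 h.koszul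

theorem IsKoszul.tail [h : IsGenKoszul 𝒜] {M : GrMod 𝒜} (hM : IsKoszul M) :
    IsKoszul (GrMod.tail M) := hM.isKoszul_tail h.finite h.splitting.1 h.koszul

/-- Evaluation at an element of `M`, as a homomorphism `E(M) → Γ_0`. -/
noncomputable def evalZero [IsGenKoszul 𝒜] {M : GrMod 𝒜} (hM : IsKoszul M) :
    M →ₗ[k] Ext (extObj 𝒜 M).toModuleCat (degZero (gamGrading 𝒜)).toModuleCat 0 where
  toFun m := Ext.mk₀ (ModuleCat.ofHom (lin (degZeroIso 𝒜).inv ∘ₗ evalHom M m))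
  map_add' x y := by
    rw [evalHom_add hM, LinearMap.comp_add, ModuleCat.ofHom_add, Ext.mk₀_add]
  map_smul' r x := by
    rw [RingHom.id_apply, ← Ext.mk₀_smul]
    refine congrArg Ext.mk₀ (ModuleCat.hom_ext (LinearMap.ext fun z => ?_))
    change lin (degZeroIso 𝒜).inv (evalHom M (r • x) z) =
      algebraMap k (Gam 𝒜) r • lin (degZeroIso 𝒜).inv (evalHom M x z)
    rw [evalHom_smul hM, lin_smul_base, lin_algebraMap]

variable (k) in
/-- The components of the map from a Koszul module to its double dual. -/
noncomputable def theta [IsGenKoszul 𝒜] : (n : ℕ) → {M : GrMod 𝒜} → IsKoszul M →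
    M →ₗ[k] Ext (extObj 𝒜 M).toModuleCat (degZero (gamGrading 𝒜)).toModuleCat n
  | 0, _, hM => evalZero hM
  -- The component of degree `n + 1` of `M` is that of degree `n` of `tail M`; the connecting map of
  -- `0 → E(tail M) → E(M / J M) → E(M) → 0` raises the cohomological degree back.
  | n + 1, M, hM => clsLinear k hM.ses _ n ∘ₗ theta n hM.tail ∘ₗ tailPr M n

section

variable [IsGenKoszul 𝒜] {M N : GrMod 𝒜}

theorem theta_zero (hM : IsKoszul M) (m : M) : theta k 0 hM m =
    Ext.mk₀ (ModuleCat.ofHom (lin (degZeroIso 𝒜).inv ∘ₗ evalHom M m)) := rfl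

theorem theta_succ (n : ℕ) (hM : IsKoszul M) (m : M) : theta k (n + 1) hM m =
    hM.ses.cls.comp (theta k n hM.tail (tailPr M n m)) (add_comm 1 n) := rfl

theorem extObj_nonneg (M : GrMod 𝒜) : (extObj 𝒜 M).Nonneg := fun _ hn _ hx =>
  ExtMod.eq_zero_of_neg hn hx

theorem extConn_mem_tailSub (M : GrMod 𝒜) (x : extObj 𝒜 (tail M)) :
    extConn 𝒜 M x ∈ (extGr 𝒜 (ModuleCat.of A (Head M))).tailSub := by
  induction x using induction_deg with
  | h0 => rw [map_zero]; exact Submodule.zero_mem _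
  | hadd x y hx hy => rw [map_add]; exact Submodule.add_mem _ hx hy
  | hdeg n x hx =>
    rcases lt_or_ge n 0 with hn | hn
    · rw [extObj_nonneg _ n hn x hx, map_zero]; exact Submodule.zero_mem _
    · exact mem_tailSub_of_mem_deg (by omega) (extConn_mem M n x hx)

/-- The kernel of the connecting map is the image of `Ext^n` of the projective module `E(M / J M)`,
which is zero for `n > 0`. For `n = 0`, a map from `E(M / J M)` to `Γ_0` kills positive degrees, and
`E(tail M)` sits in positive degrees. -/
theorem cls_comp_injective (hM : IsKoszul M) {n m : ℕ}
    (y : Ext (extObj 𝒜 (tail M)).toModuleCat (degZero (gamGrading 𝒜)).toModuleCat n)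
    (h : 1 + n = m) (hy : hM.ses.cls.comp y h = 0) : y = 0 := by
  have hA := IsGenKoszul.finite (𝒜 := 𝒜)
  obtain ⟨x, rfl⟩ := hM.ses.exists_pre_of_cls y h hy
  have := hM.extHead_projective hA
  by_cases hn : n = 0
  · subst hn
    obtain ⟨f, rfl⟩ := (Ext.mk₀_bijective _ _).2 x
    rw [pre_mk₀, Ext.mk₀_eq_zero_iff]
    refine ModuleCat.hom_ext (LinearMap.ext fun x => ?_)
    exact (hM.extHead_generatedIn hA).map_eq_zero f.hom (extConn_mem_tailSub M x)
  · rw [ext_eq_zero_of_projective x hn, pre_zero]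

/-- The obstruction lies in `Ext^{n+1}` of the projective module `E(M / J M)`. With
`cls_comp_injective`, the connecting map is bijective. -/
theorem exists_cls_comp (hM : IsKoszul M) {n : ℕ}
    (y : Ext (extObj 𝒜 M).toModuleCat (degZero (gamGrading 𝒜)).toModuleCat (n + 1)) :
    ∃ x, hM.ses.cls.comp x (add_comm 1 n) = y := by
  have := hM.extHead_projective (IsGenKoszul.finite (𝒜 := 𝒜))
  exact hM.ses.exists_cls_of_pre y (ext_eq_zero_of_projective _ (by omega)) _

theorem theta_eq_zero (n : ℕ) : ∀ {M : GrMod 𝒜} (hM : IsKoszul M) {m : M}, m ∈ M.deg n →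
    theta k n hM m = 0 → m = 0 := by
  induction n with
  | zero =>
    intro M hM m hm h
    rw [theta_zero, Ext.mk₀_eq_zero_iff] at h
    refine evalHom_eq_zero hM hm (LinearMap.ext fun x => (iso_bijective (degZeroIso 𝒜).symm).1 ?_)
    exact (LinearMap.congr_fun (congrArg ModuleCat.Hom.hom h) x).trans (map_zero _).symm
  | succ n ih =>
    intro M hM m hm h
    have h1 := ih hM.tail (tailPr_mem M n m) (cls_comp_injective hM _ (add_comm 1 n) h)
    have h2 := congrArg (tailι M) h1
    rw [tailι_tailPr, map_zero] at h2
    exact (pr_of_mem hm).symm.trans h2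

/-- Degree 0 is the reflexivity of `exists_evalHom`; each further degree is reached by lifting
through the connecting map and applying the induction hypothesis to `tail M`. -/
theorem exists_theta (n : ℕ) : ∀ {M : GrMod 𝒜} (hM : IsKoszul M)
    (y : Ext (extObj 𝒜 M).toModuleCat (degZero (gamGrading 𝒜)).toModuleCat n),
    ∃ m ∈ M.deg n, theta k n hM m = y := by
  induction n with
  | zero =>
    intro M hM y
    obtain ⟨f, rfl⟩ := (Ext.mk₀_bijective _ _).2 y
    obtain ⟨m, hm, hf⟩ := exists_evalHom hM (lin (degZeroIso 𝒜).hom ∘ₗ f.hom)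
    refine ⟨m, hm, congrArg Ext.mk₀ (ModuleCat.hom_ext (LinearMap.ext fun x => ?_))⟩
    change lin (degZeroIso 𝒜).inv (evalHom M m x) = f.hom x
    rw [hf, LinearMap.comp_apply, ← lin_comp, Iso.hom_inv_id, lin_id]
  | succ n ih =>
    intro M hM y
    obtain ⟨x, rfl⟩ := exists_cls_comp hM y
    obtain ⟨z, hz, rfl⟩ := ih hM.tail x
    have hz' : tailι M z ∈ M.deg (n + 1) := mem_tail_deg.1 hz
    refine ⟨tailι M z, by exact_mod_cast hz', ?_⟩
    rw [theta_succ]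
    congr 2
    exact tailι_injective M (by rw [tailι_tailPr, pr_of_mem hz'])

/-- The map induced on `Ext^*(M / M_{≥ 1}, A_0)`. -/
noncomputable def extHeadMap (f : M ⟶ N) : extGr 𝒜 (ModuleCat.of A (Head N)) →ₗ[Gam 𝒜]
    extGr 𝒜 (ModuleCat.of A (Head M)) :=
  ExtMod.map (ModuleCat.ofHom (Submodule.mapQ M.tailSub N.tailSub (lin f)
    fun _ hm => lin_mem_tailSub f hm)) (degZero 𝒜).toModuleCat

theorem extHeadMap_of (f : M ⟶ N) {n : ℕ} (y) : extHeadMap f (grOf 𝒜 _ n y) =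
    grOf 𝒜 _ n (pre (Submodule.mapQ M.tailSub N.tailSub (lin f)
      fun _ hm => lin_mem_tailSub f hm) y) := ExtMod.map_of _ _ _ _

theorem extHeadMap_extConn (f : M ⟶ N) (x : extObj 𝒜 (tail N)) :
    extHeadMap f (extConn 𝒜 N x) = extConn 𝒜 M (lin (extMap 𝒜 (tailMap f)) x) := by
  induction x using objOf_induction with
  | h0 => simp only [map_zero]
  | hadd x y hx hy => simp only [map_add, hx, hy]
  | hof n y =>
    rw [extConn_of, extHeadMap_of, extMap_objOf, extConn_of]
    exact congrArg (grOf 𝒜 _ _) ((head_ses M).cls_naturality (head_ses N) (lin (tailMap f)) (lin f) _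
      (fun x => rfl) (fun x => rfl) y rfl)

theorem extHead_extHeadMap (f : M ⟶ N) (x : extGr 𝒜 (ModuleCat.of A (Head N))) :
    lin (extMap 𝒜 f) (lin (extHead 𝒜 N) x) = lin (extHead 𝒜 M) (extHeadMap f x) := by
  refine (ExtMod.map_comp (ModuleCat.ofHom (lin f)) (ModuleCat.ofHom N.tailSub.mkQ) _ x).symm.trans ?_
  refine Eq.trans ?_ (ExtMod.map_comp (ModuleCat.ofHom M.tailSub.mkQ) (ModuleCat.ofHom _) _ x)
  rfl

theorem tailPr_lin (f : M ⟶ N) (n : ℕ) (m : M) :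
    tailPr N n (lin f m) = lin (tailMap f) (tailPr M n m) :=
  tailι_injective N (by rw [tailι_tailPr, tailι_tailMap, tailι_tailPr, pr_lin])

/-- A map `f : M ⟶ N` induces a morphism from the sequence of `N` to that of `M`, so the recursion
defining `theta` is compatible with it by naturality of the connecting class. -/
theorem theta_lin (n : ℕ) : ∀ {M N : GrMod 𝒜} (hM : IsKoszul M) (hN : IsKoszul N) (f : M ⟶ N) (m : M),
    theta k n hN (lin f m) = pre (lin (extMap 𝒜 f)) (theta k n hM m) := by
  induction n with
  | zero =>
    intro M N hM hN f m
    rw [theta_zero, theta_zero, pre_mk₀, evalHom_lin]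
    rfl
  | succ n ih =>
    intro M N hM hN f m
    rw [theta_succ, theta_succ, tailPr_lin, ih hM.tail hN.tail]
    exact (hN.ses.cls_naturality hM.ses (lin (extMap 𝒜 (tailMap f))) (extHeadMap f)
      (lin (extMap 𝒜 f)) (extHeadMap_extConn f) (extHead_extHeadMap f) _ _).symm

variable (𝒜) in
theorem reg_koszul : IsKoszul (reg 𝒜) := reg_isKoszul (IsGenKoszul.finite (𝒜 := 𝒜))

variable (𝒜) in
/-- The components of the map from `A` to `Ext_Γ^*(Γ_0, Γ_0)`. -/
noncomputable def phiComp (n : ℕ) (a : A) : Ext (degZero (gamGrading 𝒜)).toModuleCat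
    (degZero (gamGrading 𝒜)).toModuleCat n :=
  pre (lin (degZeroIso 𝒜).hom) (theta k n (reg_koszul 𝒜) (regMk 𝒜 a))

theorem tailPr_smul {i : ℕ} {a : A} (ha : a ∈ 𝒜 i) (j : ℕ) {n : ℕ} (h : j + i = n) (m : M) :
    tailPr M n (a • m) = a • tailPr M j m := tailι_injective M (by
  rw [tailι_tailPr, (tailι M).map_smul, tailι_tailPr, pr_smul ha]
  congr 3
  omega)

/-- For `m` of degree 0, `a • m` is the image of `a` under the graded map `A ⟶ M` with `1 ↦ m`, and
naturality reduces to `A`, where `phiComp` is defined. Higher degrees pass to `tail M` and use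
associativity of the Yoneda product. -/
theorem theta_smul {i : ℕ} {a : A} (ha : a ∈ 𝒜 i) (j : ℕ) : ∀ {M : GrMod 𝒜} (hM : IsKoszul M) {m : M},
    m ∈ M.deg j → ∀ {n : ℕ} (h : j + i = n),
    theta k n hM (a • m) = (theta k j hM m).comp (phiComp 𝒜 i a) h := by
  induction j with
  | zero =>
    intro M hM m hm n h
    obtain rfl : i = n := by omega
    have h1 := theta_lin (k := k) i (reg_koszul 𝒜) hM (regHom M m hm) (regMk 𝒜 a)
    rw [lin_regHom, regLin_regMk] at h1
    rw [h1, evalHom_regHom, phiComp, theta_zero]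
    change _ = pre _ (pre _ _)
    rw [pre_pre]
    congr 1
    refine LinearMap.ext fun x => ?_
    change _ = lin (degZeroIso 𝒜).hom (lin (degZeroIso 𝒜).inv (evalHom M m x))
    rw [← lin_comp, Iso.inv_hom_id, lin_id]
  | succ j ih =>
    intro M hM m hm n h
    obtain ⟨n, rfl⟩ : ∃ n', n = n' + 1 := ⟨n - 1, by omega⟩
    rw [theta_succ, theta_succ, tailPr_smul ha j (by omega), ih hM.tail (tailPr_mem M j m) (by omega),
      Ext.comp_assoc _ _ _ _ _ (by omega)]

end

/-- Assemble bijections between the graded pieces. -/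
theorem exists_glue {B : Type*} [Ring B] [Algebra k B] {ℬ : ℕ → Submodule k B} {M : GrMod 𝒜}
    {N : GrMod ℬ} (hM : M.Nonneg) (hN : N.Nonneg) (f : ℕ → M →ₗ[k] N)
    (hf : ∀ n : ℕ, ∀ m ∈ M.deg n, f n m ∈ N.deg n)
    (hinj : ∀ n : ℕ, ∀ m ∈ M.deg n, f n m = 0 → m = 0)
    (hsurj : ∀ n : ℕ, ∀ y ∈ N.deg n, ∃ m ∈ M.deg n, f n m = y) :
    ∃ e : M ≃ₗ[k] N, (∀ (n : ℕ) (m : M), m ∈ M.deg n → e m = f n m) ∧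
      ∀ (n : ℤ) (m : M), m ∈ M.deg n ↔ e m ∈ N.deg n := by
  let _ := M.isInternal.chooseDecomposition
  -- Negative degrees of `M` vanish, so the value of `Int.toNat` there is immaterial.
  let L : M →ₗ[k] N := DirectSum.toModule k ℤ N (fun n => f n.toNat ∘ₗ (M.deg n).subtype) ∘ₗ
      (DirectSum.decomposeLinearEquiv M.deg).toLinearMap
  have hL : ∀ (n : ℕ) (m : M), m ∈ M.deg n → L m = f n m := fun n m hm => by
    change DirectSum.toModule k ℤ N _ (DirectSum.decompose M.deg m) = _
    rw [DirectSum.decompose_of_mem M.deg hm]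
    exact DirectSum.toModule_lof k (n : ℤ) _
  have hpr : ∀ (n : ℕ) (m : M), N.pr n (L m) = f n (M.pr n m) := fun n m => by
    induction m using induction_deg with
    | h0 => simp only [map_zero]
    | hadd x y hx hy => simp only [map_add, hx, hy]
    | hdeg j x hx =>
      rcases lt_or_ge j 0 with hj | hj
      · rw [hM j hj x hx]; simp only [map_zero]
      · lift j to ℕ using hj
        rw [hL j x hx]
        by_cases h : (n : ℤ) = j
        · obtain rfl : n = j := by exact_mod_cast h
          rw [pr_of_mem hx, pr_of_mem (hf n x hx)]
        · rw [pr_of_mem_ne hx h, pr_of_mem_ne (hf j x hx) h, map_zero]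
  have hpr0 : ∀ (n : ℤ) (m : M), N.pr n (L m) = 0 → M.pr n m = 0 := fun n m h => by
    rcases lt_or_ge n 0 with hn | hn
    · exact hM n hn _ (M.pr_mem n m)
    · lift n to ℕ using hn
      rw [hpr] at h
      exact hinj n _ (M.pr_mem n m) h
  refine ⟨LinearEquiv.ofBijective L ⟨(injective_iff_map_eq_zero L).2 fun m hm => ext_pr fun n => ?_,
    fun y => ?_⟩, hL, fun n m => ⟨fun hm => ?_, fun hm => ?_⟩⟩
  · rw [map_zero]
    exact hpr0 n m (by rw [hm, map_zero])
  · induction y using induction_deg with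
    | h0 => exact ⟨0, map_zero L⟩
    | hadd x y hx hy =>
      obtain ⟨x, rfl⟩ := hx
      obtain ⟨y, rfl⟩ := hy
      exact ⟨x + y, map_add L x y⟩
    | hdeg n y hy =>
      rcases lt_or_ge n 0 with hn | hn
      · exact ⟨0, by rw [map_zero, hN n hn y hy]⟩
      · lift n to ℕ using hn
        obtain ⟨m, hm, rfl⟩ := hsurj n y hy
        exact ⟨m, hL n m hm⟩
  · rcases lt_or_ge n 0 with hn | hn
    · rw [hM n hn m hm, map_zero]; exact Submodule.zero_mem _
    · lift n to ℕ using hn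
      change L m ∈ _
      rw [hL n m hm]; exact hf n m hm
  · refine mem_deg_iff.2 (ext_pr fun j => ?_)
    by_cases h : j = n
    · subst h; exact pr_of_mem (M.pr_mem j m)
    · rw [pr_of_mem_ne (M.pr_mem n m) h, hpr0 j m (pr_of_mem_ne hm h)]

section

variable [IsGenKoszul 𝒜] {M N : GrMod 𝒜}

theorem exists_thetaEquiv (hM : IsKoszul M) :
    ∃ e : M ≃ₗ[k] extObj (gamGrading 𝒜) (extObj 𝒜 M),
      (∀ (n : ℕ) (m : M), m ∈ M.deg n → e m = objOf (gamGrading 𝒜) _ n (theta k n hM m)) ∧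
      ∀ (n : ℤ) (m : M), m ∈ M.deg n ↔ e m ∈ (extObj (gamGrading 𝒜) (extObj 𝒜 M)).deg n := by
  refine exists_glue hM.nonneg (extObj_nonneg _) (fun n => objLof _ n ∘ₗ theta k n hM)
    (fun n m hm => objOf_mem _) (fun n m hm h => ?_) fun n y hy => ?_
  · refine theta_eq_zero n hM hm (objOf_injective (𝒜 := gamGrading 𝒜) (M := extObj 𝒜 M) ?_)
    rw [map_zero]; exact h
  · obtain rfl | ⟨j, y, hj, rfl⟩ := extObj_cases hy
    · exact ⟨0, Submodule.zero_mem _, map_zero _⟩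
    · obtain rfl : n = j := by exact_mod_cast hj
      obtain ⟨m, hm, rfl⟩ := exists_theta (k := k) n hM y
      exact ⟨m, hm, rfl⟩

/-- The isomorphism of a Koszul module with its double dual. -/
noncomputable def thetaEquiv (hM : IsKoszul M) : M ≃ₗ[k] extObj (gamGrading 𝒜) (extObj 𝒜 M) :=
  (exists_thetaEquiv hM).choose

theorem thetaEquiv_of_mem (hM : IsKoszul M) {n : ℕ} {m : M} (hm : m ∈ M.deg n) :
    thetaEquiv hM m = objOf (gamGrading 𝒜) _ n (theta k n hM m) :=
  (exists_thetaEquiv hM).choose_spec.1 n m hm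

theorem thetaEquiv_mem_iff (hM : IsKoszul M) {n : ℤ} {m : M} :
    m ∈ M.deg n ↔ thetaEquiv hM m ∈ (extObj (gamGrading 𝒜) (extObj 𝒜 M)).deg n :=
  (exists_thetaEquiv hM).choose_spec.2 n m

/-- Induction on homogeneous elements of a nonnegatively graded module. -/
theorem Nonneg.induction (hM : M.Nonneg) {p : M → Prop} (m : M) (h0 : p 0)
    (hdeg : ∀ (n : ℕ) (x : M), x ∈ M.deg n → p x) (hadd : ∀ x y, p x → p y → p (x + y)) : p m := by
  induction m using induction_deg with
  | h0 => exact h0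
  | hadd x y hx hy => exact hadd x y hx hy
  | hdeg n x hx =>
    rcases lt_or_ge n 0 with hn | hn
    · rw [hM n hn x hx]; exact h0
    · lift n to ℕ using hn
      exact hdeg n x hx

theorem thetaEquiv_lin (hM : IsKoszul M) (hN : IsKoszul N) (f : M ⟶ N) (m : M) :
    thetaEquiv hN (lin f m) = lin (extMap (gamGrading 𝒜) (extMap 𝒜 f)) (thetaEquiv hM m) := by
  induction m using hM.nonneg.induction with
  | h0 => simp only [map_zero]
  | hadd x y hx hy => simp only [map_add, hx, hy]
  | hdeg n x hx =>
    rw [thetaEquiv_of_mem hM hx, thetaEquiv_of_mem hN (lin_mem f hx), theta_lin n hM hN f,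
      extMap_objOf]

variable (𝒜) in
/-- The identification of the double dual of `A` with `Ext_Γ^*(Γ_0, Γ_0)`. -/
noncomputable def toGamGam : extObj (gamGrading 𝒜) (extObj 𝒜 (reg 𝒜)) →ₗ[Gam (gamGrading 𝒜)]
    Gam (gamGrading 𝒜) :=
  (ExtMod.toAlg _).toLinearMap ∘ₗ lin (extMap (gamGrading 𝒜) (degZeroIso 𝒜).hom)

theorem toGamGam_objOf {n : ℕ} (y) : toGamGam 𝒜 (objOf (gamGrading 𝒜) _ n y) =
    ExtAlg.of _ n (pre (lin (degZeroIso 𝒜).hom) y) := by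
  refine (congrArg (ExtMod.toAlg _) (extMap_objOf (𝒜 := gamGrading 𝒜) (degZeroIso 𝒜).hom y)).trans ?_
  exact ExtMod.toAlg_of _ _ _

theorem toGamGam_bijective : Function.Bijective (toGamGam 𝒜) := by
  have : Function.Bijective (lin (extMap (gamGrading 𝒜) (degZeroIso 𝒜).hom)) := ?_
  · exact (ExtMod.toAlg (degZero (gamGrading 𝒜)).toModuleCat).bijective.comp this
  refine Function.bijective_iff_has_inverse.2
    ⟨lin (extMap (gamGrading 𝒜) (degZeroIso 𝒜).inv), fun x => ?_, fun x => ?_⟩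
  · rw [← lin_comp, ← extMap_comp, Iso.inv_hom_id, extMap_id, lin_id]
  · rw [← lin_comp, ← extMap_comp, Iso.hom_inv_id, extMap_id, lin_id]

variable (𝒜) in
/-- The isomorphism of `A` with `Ext_Γ^*(Γ_0, Γ_0)`, as a linear map. -/
noncomputable def phiLin : A ≃ₗ[k] Gam (gamGrading 𝒜) :=
  LinearEquiv.ofBijective ((toGamGam 𝒜).restrictScalars k ∘ₗ (thetaEquiv (reg_koszul 𝒜)).toLinearMap ∘ₗ
      { toFun := regMk 𝒜, map_add' := fun _ _ => rfl, map_smul' := fun _ _ => rfl })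
    (toGamGam_bijective.comp ((thetaEquiv (reg_koszul 𝒜)).bijective.comp
      ⟨fun _ _ h => h, regMk_surjective⟩))

theorem phiLin_apply (a : A) :
    phiLin 𝒜 a = toGamGam 𝒜 (thetaEquiv (reg_koszul 𝒜) (regMk 𝒜 a)) := rfl

theorem phiLin_of_mem {n : ℕ} {a : A} (ha : a ∈ 𝒜 n) :
    phiLin 𝒜 a = ExtAlg.of _ n (phiComp 𝒜 n a) := by
  rw [phiLin_apply, thetaEquiv_of_mem _ (mem_reg_deg.2 ha), toGamGam_objOf]; rfl

/-- Both sides are additive in `a` and in `m`, so the homogeneous statement `theta_smul` suffices.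
-/
theorem thetaEquiv_smul (hM : IsKoszul M) (a : A) (m : M) :
    thetaEquiv hM (a • m) = phiLin 𝒜 a • thetaEquiv hM m := by
  induction a using DirectSum.Decomposition.inductionOn 𝒜 with
  | zero => simp only [zero_smul, map_zero]
  | add x y hx hy => simp only [add_smul, map_add, hx, hy]
  | @homogeneous i a =>
    induction m using hM.nonneg.induction with
    | h0 => simp only [smul_zero, map_zero]
    | hadd x y hx hy => simp only [smul_add, map_add, hx, hy]
    | hdeg n x hx =>
      have h := M.smul_mem i n a x a.2 hx
      rw [phiLin_of_mem a.2, thetaEquiv_of_mem hM hx, of_smul_objOf,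
        thetaEquiv_of_mem hM (n := i + n) (by exact_mod_cast h),
        theta_smul a.2 n hM hx (add_comm n i)]

/-- This is `thetaEquiv_smul` for the module `A`, followed by the linear identification of `E(E(A))`
with the regular module. -/
theorem phiLin_mul (a b : A) : phiLin 𝒜 (a * b) = phiLin 𝒜 a * phiLin 𝒜 b := by
  rw [phiLin_apply, ← smul_regMk, thetaEquiv_smul, map_smul, phiLin_apply b]; rfl

/-- A surjective multiplicative map sends 1 to a left identity, which can only be 1. -/
theorem phiLin_one : phiLin 𝒜 1 = 1 := by
  obtain ⟨a, ha⟩ := (phiLin 𝒜).surjective 1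
  have := phiLin_mul (𝒜 := 𝒜) 1 a
  rw [one_mul, ha, mul_one] at this
  exact this.symm

variable (𝒜) in
/-- The isomorphism of `A` with `Ext_Γ^*(Γ_0, Γ_0)`. -/
noncomputable def phiEquiv : A ≃ₐ[k] Gam (gamGrading 𝒜) :=
  AlgEquiv.ofLinearEquiv (phiLin 𝒜) phiLin_one phiLin_mul

theorem phiEquiv_mem_iff {n : ℕ} {a : A} :
    a ∈ 𝒜 n ↔ phiEquiv 𝒜 a ∈ gamGrading (gamGrading 𝒜) n := by
  refine ⟨fun h => ?_, fun h => ?_⟩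
  · change phiLin 𝒜 a ∈ _
    rw [phiLin_of_mem h]; exact ExtAlg.of_mem k _ n _
  · refine mem_reg_deg.1 ((thetaEquiv_mem_iff (reg_koszul 𝒜)).2 ?_)
    obtain ⟨y, hy⟩ := ExtAlg.exists_of h
    have h1 : toGamGam 𝒜 (objOf (gamGrading 𝒜) _ n (pre (lin (degZeroIso 𝒜).inv) y)) =
        phiEquiv 𝒜 a := by
      rw [toGamGam_objOf, pre_pre, ← hy]
      have : lin (degZeroIso 𝒜).inv ∘ₗ lin (degZeroIso 𝒜).hom = LinearMap.id :=
        LinearMap.ext fun x => by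
          rw [LinearMap.comp_apply, ← lin_comp, Iso.hom_inv_id, lin_id, LinearMap.id_apply]
      rw [this, pre_id]
    have h2 : toGamGam 𝒜 (thetaEquiv (reg_koszul 𝒜) (regMk 𝒜 a)) = phiEquiv 𝒜 a := rfl
    rw [← toGamGam_bijective.1 (h1.trans h2.symm)]
    exact objOf_mem _

end

end GrMod
end GenKoszul

namespace GenKoszul
open Abelian

/-! ### Transport of `Ext` along exact equivalences -/

section Transport

variable {C : Type*} [Category* C] [Abelian C] [HasExt.{w} C]
  {D : Type*} [Category* D] [Abelian D] [HasExt.{w} D]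
  (F : C ⥤ D) [F.Additive] [Limits.PreservesFiniteLimits F] [Limits.PreservesFiniteColimits F]

/-- Transport of extension classes along an exact functor. -/
noncomputable def extTransport {X Y : C} {X' Y' : D} (i : X' ≅ F.obj X) (j : Y' ≅ F.obj Y) (n : ℕ) :
    Ext X Y n →+ Ext X' Y' n where
  toFun y := (Ext.mk₀ i.hom).comp ((y.mapExactFunctor F).comp (Ext.mk₀ j.inv) (add_zero n)) (zero_add n)
  map_zero' := by rw [Ext.mapExactFunctor_zero, Ext.zero_comp, Ext.comp_zero]
  map_add' y z := by rw [Ext.mapExactFunctor_add, Ext.add_comp, Ext.comp_add]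

theorem extTransport_apply {X Y : C} {X' Y' : D} (i : X' ≅ F.obj X) (j : Y' ≅ F.obj Y) {n : ℕ}
    (y : Ext X Y n) : extTransport F i j n y = (Ext.mk₀ i.hom).comp
      ((y.mapExactFunctor F).comp (Ext.mk₀ j.inv) (add_zero n)) (zero_add n) := rfl

theorem extTransport_mk₀ {X Y : C} {X' Y' : D} (i : X' ≅ F.obj X) (j : Y' ≅ F.obj Y) (f : X ⟶ Y) :
    extTransport F i j 0 (Ext.mk₀ f) = Ext.mk₀ (i.hom ≫ F.map f ≫ j.inv) := by
  rw [extTransport_apply, Ext.mapExactFunctor_mk₀, Ext.mk₀_comp_mk₀, Ext.mk₀_comp_mk₀]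

theorem extTransport_comp {X Y Z : C} {X' Y' Z' : D} (i : X' ≅ F.obj X) (j : Y' ≅ F.obj Y)
    (l : Z' ≅ F.obj Z) {a b c : ℕ} (y : Ext X Y a) (z : Ext Y Z b) (h : a + b = c) :
    extTransport F i l c (y.comp z h) = (extTransport F i j a y).comp (extTransport F j l b z) h := by
  simp only [extTransport_apply]
  rw [Ext.mapExactFunctor_comp, Ext.comp_assoc (Ext.mk₀ i.hom) _ _ (zero_add a) h (by omega),
    Ext.comp_assoc _ (Ext.mk₀ j.inv) _ (add_zero a) (zero_add b) (by omega),
    Ext.mk₀_comp_mk₀_assoc, Iso.inv_hom_id, Ext.mk₀_id_comp,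
    Ext.comp_assoc _ _ (Ext.mk₀ l.inv) h (add_zero b) (by omega)]

/-- A fully faithful exact functor that preserves projectives is bijective on `Ext`; composing with
isomorphisms at both ends changes nothing. -/
theorem extTransport_bijective [F.Full] [F.Faithful] [EnoughProjectives C]
    [F.PreservesProjectiveObjects] {X Y : C} {X' Y' : D} (i : X' ≅ F.obj X) (j : Y' ≅ F.obj Y) (n : ℕ) :
    Function.Bijective (extTransport F i j n) := by
  have h := F.mapExt_bijective_of_preservesProjectiveObjects X Y n
  have h' : Function.Bijective fun y : Ext (F.obj X) (F.obj Y) n =>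
      (Ext.mk₀ i.hom).comp (y.comp (Ext.mk₀ j.inv) (add_zero n)) (zero_add n) := by
    refine Function.bijective_iff_has_inverse.2 ⟨fun y =>
      (Ext.mk₀ i.inv).comp (y.comp (Ext.mk₀ j.hom) (add_zero n)) (zero_add n), fun y => ?_, fun y => ?_⟩
    · dsimp only
      rw [Ext.comp_assoc (Ext.mk₀ i.hom) _ _ (zero_add n) (add_zero n) (by omega),
        Ext.comp_assoc y _ _ (add_zero n) (add_zero 0) (by omega), Ext.mk₀_comp_mk₀, Iso.inv_hom_id,
        Ext.comp_mk₀_id, Ext.mk₀_comp_mk₀_assoc, Iso.inv_hom_id, Ext.mk₀_id_comp]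
    · dsimp only
      rw [Ext.comp_assoc (Ext.mk₀ i.inv) _ _ (zero_add n) (add_zero n) (by omega),
        Ext.comp_assoc y _ _ (add_zero n) (add_zero 0) (by omega), Ext.mk₀_comp_mk₀, Iso.hom_inv_id,
        Ext.comp_mk₀_id, Ext.mk₀_comp_mk₀_assoc, Iso.hom_inv_id, Ext.mk₀_id_comp]
  exact h'.comp h

variable [F.Full] [F.Faithful] [EnoughProjectives C] [F.PreservesProjectiveObjects]

/-- Transport of `Ext^*(X, Y)` along an exact equivalence. -/
noncomputable def ExtMod.transport {X Y : C} {X' Y' : D} (i : X' ≅ F.obj X) (j : Y' ≅ F.obj Y) :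
    ExtMod X Y ≃+ ExtMod X' Y' :=
  DFinsupp.mapRange.addEquiv fun n => AddEquiv.ofBijective _ (extTransport_bijective F i j n)

theorem ExtMod.transport_of {X Y : C} {X' Y' : D} (i : X' ≅ F.obj X) (j : Y' ≅ F.obj Y) {n : ℕ}
    (y : Ext X Y n) :
    ExtMod.transport F i j (ExtMod.of X Y n y) = ExtMod.of X' Y' n (extTransport F i j n y) :=
  DFinsupp.mapRange_single (hf := fun n => map_zero (extTransport F i j n))

/-- Transport of `Ext^*(Y, Y)` along an exact equivalence, as an additive map. -/
noncomputable def ExtAlg.transportAdd {Y : C} {Y' : D} (j : Y' ≅ F.obj Y) : ExtAlg Y ≃+ ExtAlg Y' :=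
  DFinsupp.mapRange.addEquiv fun n => AddEquiv.ofBijective _ (extTransport_bijective F j j n)

theorem ExtAlg.transportAdd_of {Y : C} {Y' : D} (j : Y' ≅ F.obj Y) {n : ℕ} (y : Ext Y Y n) :
    ExtAlg.transportAdd F j (ExtAlg.of Y n y) = ExtAlg.of Y' n (extTransport F j j n y) :=
  DFinsupp.mapRange_single (hf := fun n => map_zero (extTransport F j j n))

theorem ExtMod.transport_smul {X Y : C} {X' Y' : D} (i : X' ≅ F.obj X) (j : Y' ≅ F.obj Y)
    (a : ExtAlg Y) (m : ExtMod X Y) : ExtMod.transport F i j (a • m) =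
      ExtAlg.transportAdd F j a • ExtMod.transport F i j m := by
  induction a using ExtAlg.induction with
  | h0 => simp only [zero_smul, map_zero]
  | hadd y z hy hz => simp only [add_smul, map_add, hy, hz]
  | hof p x =>
    induction m using ExtMod.induction with
    | h0 => simp only [smul_zero, map_zero]
    | hadd y z hy hz => simp only [smul_add, map_add, hy, hz]
    | hof q y =>
      rw [ExtMod.of_smul_of, ExtMod.transport_of, ExtAlg.transportAdd_of, ExtMod.transport_of,
        ExtMod.of_smul_of, extTransport_comp F i j j]

theorem ExtAlg.transportAdd_mul {Y : C} {Y' : D} (j : Y' ≅ F.obj Y) (a b : ExtAlg Y) :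
    ExtAlg.transportAdd F j (a * b) = ExtAlg.transportAdd F j a * ExtAlg.transportAdd F j b := by
  induction a using ExtAlg.induction with
  | h0 => simp only [zero_mul, map_zero]
  | hadd y z hy hz => simp only [add_mul, map_add, hy, hz]
  | hof p x =>
    induction b using ExtAlg.induction with
    | h0 => simp only [mul_zero, map_zero]
    | hadd y z hy hz => simp only [mul_add, map_add, hy, hz]
    | hof q y =>
      rw [ExtAlg.of_mul_of, ExtAlg.transportAdd_of, ExtAlg.transportAdd_of, ExtAlg.transportAdd_of,
        ExtAlg.of_mul_of, extTransport_comp F j j j]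

variable {k : Type*} [Field k] [Linear k C] [Linear k D] [F.Linear k]

variable (k) in
/-- Transport of the algebra `Ext^*(Y, Y)` along an exact equivalence. -/
noncomputable def ExtAlg.transport {Y : C} {Y' : D} (j : Y' ≅ F.obj Y) : ExtAlg Y ≃ₐ[k] ExtAlg Y' :=
  AlgEquiv.ofRingEquiv (f := { ExtAlg.transportAdd F j with map_mul' := ExtAlg.transportAdd_mul F j })
    fun r => by
      change ExtAlg.transportAdd F j (ExtAlg.of Y 0 (r • Ext.mk₀ (𝟙 Y))) =
        ExtAlg.of Y' 0 (r • Ext.mk₀ (𝟙 Y'))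
      rw [ExtAlg.transportAdd_of, ← Ext.mk₀_smul, ← Ext.mk₀_smul, extTransport_mk₀, Functor.map_smul,
        F.map_id, Linear.smul_comp, Linear.comp_smul, Category.id_comp, Iso.hom_inv_id]

theorem ExtAlg.transport_of {Y : C} {Y' : D} (j : Y' ≅ F.obj Y) {n : ℕ} (y : Ext Y Y n) :
    ExtAlg.transport F k j (ExtAlg.of Y n y) = ExtAlg.of Y' n (extTransport F j j n y) :=
  ExtAlg.transportAdd_of F j y

theorem ExtAlg.transport_mem_iff {Y : C} {Y' : D} (j : Y' ≅ F.obj Y) {n : ℕ} {x : ExtAlg Y} :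
    x ∈ extAlgGrading k Y n ↔ ExtAlg.transport F k j x ∈ extAlgGrading k Y' n := by
  refine ⟨fun h => ?_, fun h => ?_⟩
  · obtain ⟨y, rfl⟩ := ExtAlg.exists_of h
    rw [ExtAlg.transport_of]; exact ExtAlg.of_mem k _ n _
  · obtain ⟨y, hy⟩ := ExtAlg.exists_of h
    obtain ⟨z, rfl⟩ := (extTransport_bijective F j j n).2 y
    rw [← ExtAlg.transport_of F (k := k)] at hy
    rw [← (ExtAlg.transport F k j).injective hy]; exact ExtAlg.of_mem k _ n _

end Transport

end GenKoszul

namespace GenKoszul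
open Abelian

/-! ### Restriction along an isomorphism of graded algebras -/

/-- Isomorphisms of graded algebras. -/
structure GrEquiv {k : Type v} [Field k] {A B : Type u} [Ring A] [Algebra k A] [Ring B] [Algebra k B]
    (𝒜 : ℕ → Submodule k A) (ℬ : ℕ → Submodule k B) where
  equiv : A ≃ₐ[k] B
  mem_iff : ∀ (n : ℕ) (a : A), a ∈ 𝒜 n ↔ equiv a ∈ ℬ n

namespace GrMod

variable {k : Type v} [Field k] {A : Type u} [Ring A] [Algebra k A] {𝒜 : ℕ → Submodule k A}
variable {B : Type u} [Ring B] [Algebra k B] {ℬ : ℕ → Submodule k B}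
variable (e : GrEquiv 𝒜 ℬ)

/-- Restriction of scalars along an isomorphism of graded algebras. -/
def comap (X : GrMod ℬ) : GrMod 𝒜 :=
  letI : Module A X := Module.compHom X (e.equiv : A →+* B)
  { carrier := X
    isScalarTower := ⟨fun r a x => by
      change e.equiv (r • a) • x = r • e.equiv a • x
      rw [map_smul, smul_assoc]⟩
    deg := X.deg
    isInternal := X.isInternal
    smul_mem := fun i j a m ha hm => X.smul_mem i j _ _ ((e.mem_iff i a).1 ha) hm }

/-- The identity map, as an additive map to the restriction. -/
def comapMk (X : GrMod ℬ) : X ≃+ comap e X := AddEquiv.refl X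

variable {e}

theorem comapMk_surjective {X : GrMod ℬ} (x : comap e X) : ∃ y, comapMk e X y = x :=
  (comapMk e X).surjective x

theorem smul_comapMk {X : GrMod ℬ} (a : A) (x : X) :
    a • comapMk e X x = comapMk e X (e.equiv a • x) := rfl

theorem comapMk_mem {X : GrMod ℬ} {n : ℤ} {x : X} : comapMk e X x ∈ (comap e X).deg n ↔ x ∈ X.deg n :=
  Iff.rfl

variable (e) in
/-- Restriction of a homomorphism. -/
def comapHom {X Y : GrMod ℬ} (f : X ⟶ Y) : comap e X ⟶ comap e Y :=
  mkHom (M := comap e X) (N := comap e Y)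
    { toFun := fun x => comapMk e Y (lin f ((comapMk e X).symm x))
      map_add' := fun x y => by rw [map_add, map_add, map_add]
      map_smul' := fun a x => by
        obtain ⟨x, rfl⟩ := comapMk_surjective x
        rw [smul_comapMk, AddEquiv.symm_apply_apply, AddEquiv.symm_apply_apply, map_smul]
        rfl }
    fun n x hx => lin_mem f hx

theorem GeneratedIn.comap {X : GrMod ℬ} {s : ℤ} (h : X.GeneratedIn s) :
    (GrMod.comap e X).GeneratedIn s := by
  refine eq_top_iff.2 fun x hx' => ?_
  clear hx'
  obtain ⟨x, rfl⟩ := comapMk_surjective x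
  have hx : x ∈ Submodule.span B (X.deg s : Set X) := by rw [h]; trivial
  induction hx using Submodule.span_induction with
  | mem x hx => exact Submodule.subset_span (comapMk_mem.2 hx)
  | zero => rw [map_zero]; exact Submodule.zero_mem _
  | add x y _ _ hx hy => rw [map_add]; exact Submodule.add_mem _ hx hy
  | smul b x _ hx =>
    obtain ⟨a, rfl⟩ := e.equiv.surjective b
    rw [← smul_comapMk]
    exact Submodule.smul_mem _ a hx

theorem comap_projective {X : GrMod ℬ} (h : Module.Projective B X) :
    Module.Projective A (comap e X) := by
  letI := RingHomInvPair.of_ringEquiv (e.equiv.symm : B ≃+* A)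
  letI := RingHomInvPair.of_ringEquiv (e.equiv.symm : B ≃+* A).symm
  exact Module.Projective.of_equiv (R := B)
    ({ comapMk e X with
      map_smul' := fun b x => by
        obtain ⟨a, rfl⟩ := e.equiv.surjective b
        refine Eq.trans ?_ (congrArg (· • comapMk e X x) (e.equiv.symm_apply_apply a).symm)
        exact (smul_comapMk a x).symm } : X ≃ₛₗ[((e.equiv.symm : B ≃+* A) : B →+* A)] comap e X)

theorem IsKoszul.comap {X : GrMod ℬ} (hX : IsKoszul X) : IsKoszul (GrMod.comap e X) := by
  obtain ⟨hf, hg, ⟨R⟩⟩ := hX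
  exact ⟨hf, hg.comap, ⟨
    { P := fun n => GrMod.comap e (R.P n)
      d := fun n => comapHom e (R.d n)
      ε := comapHom e R.ε
      projective := fun n => comap_projective (R.projective n)
      generatedIn := fun n => (R.generatedIn n).comap
      surjective := R.surjective
      exact_zero := R.exact_zero
      exact_succ := R.exact_succ }⟩⟩

end GrMod

end GenKoszul

/-! ### The Yoneda algebra and `E` under isomorphisms of graded algebras. -/

namespace GenKoszul
open Abelian

/-- Composition of isomorphisms of graded algebras. -/
def GrEquiv.trans {k : Type v} [Field k] {A B C : Type u} [Ring A] [Algebra k A] [Ring B] [Algebra k B]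
    [Ring C] [Algebra k C] {𝒜 : ℕ → Submodule k A} {ℬ : ℕ → Submodule k B} {𝒞 : ℕ → Submodule k C}
    (e : GrEquiv 𝒜 ℬ) (f : GrEquiv ℬ 𝒞) : GrEquiv 𝒜 𝒞 :=
  ⟨e.equiv.trans f.equiv, fun n a => (e.mem_iff n a).trans (f.mem_iff n _)⟩

namespace GrMod

variable {k : Type v} [Field k] {A : Type u} [Ring A] [Algebra k A] {𝒜 : ℕ → Submodule k A}
variable {B : Type u} [Ring B] [Algebra k B] {ℬ : ℕ → Submodule k B}
variable (e : GrEquiv 𝒜 ℬ)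

/-- Restriction of scalars for ungraded modules. -/
noncomputable def resFunctor : ModuleCat.{u} B ⥤ ModuleCat.{u} A :=
  ModuleCat.restrictScalars (e.equiv : A →ₐ[k] B).toRingHom

noncomputable instance : (resFunctor e).IsEquivalence :=
  inferInstanceAs (ModuleCat.restrictScalars.{u} (e.equiv : A ≃+* B).toRingHom).IsEquivalence

noncomputable instance : (resFunctor e).Additive :=
  inferInstanceAs (ModuleCat.restrictScalars.{u} _).Additive

noncomputable instance : (resFunctor e).Linear k :=
  inferInstanceAs ((ModuleCat.restrictScalars.{u} (e.equiv : A →ₐ[k] B).toRingHom).Linear k)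

/-- The underlying module of a restriction. -/
noncomputable def comapIso (X : GrMod ℬ) : (comap e X).toModuleCat ≅ (resFunctor e).obj X.toModuleCat :=
  Iso.refl _

variable [GradedAlgebra 𝒜] [GradedAlgebra ℬ]

theorem decompose_equiv (a : A) (n : ℕ) :
    (decompose ℬ (e.equiv a) n : B) = e.equiv (decompose 𝒜 a n : A) := by
  induction a using DirectSum.Decomposition.inductionOn 𝒜 with
  | zero => simp
  | add x y hx hy => simp only [map_add, decompose_add, DirectSum.add_apply, Submodule.coe_add, hx, hy]
  | @homogeneous i a =>
    have ha := (e.mem_iff i a).1 a.2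
    by_cases h : i = n
    · subst h
      rw [decompose_of_mem_same ℬ ha, decompose_of_mem_same 𝒜 a.2]
    · rw [decompose_of_mem_ne ℬ ha h, decompose_of_mem_ne 𝒜 a.2 h, map_zero]

/-- An isomorphism of graded algebras in degree zero. -/
def zeroMap (b : 𝒜 0) : ℬ 0 := ⟨e.equiv b, (e.mem_iff 0 _).1 b.2⟩

/-- The map `A_0 → B_0`. -/
noncomputable def degZeroLin : degZero 𝒜 →ₗ[A] comap e (degZero ℬ) where
  toFun x := comapMk e _ (degZeroMk ℬ (zeroMap e (show 𝒜 0 from x)))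
  map_add' x y := congrArg (fun z => comapMk e _ (degZeroMk ℬ z))
    (Subtype.ext (map_add e.equiv (show 𝒜 0 from x : A) (show 𝒜 0 from y : A)))
  map_smul' a x := by
    obtain ⟨b, rfl⟩ := degZeroMk_surjective x
    rw [RingHom.id_apply, smul_comapMk, smul_degZeroMk, smul_degZeroMk]
    refine congrArg (fun z => comapMk e _ (degZeroMk ℬ z)) (Subtype.ext ?_)
    change e.equiv ((decompose 𝒜 a 0 : A) * b) = (decompose ℬ (e.equiv a) 0 : B) * e.equiv b
    rw [decompose_equiv, map_mul]

theorem degZeroLin_bijective : Function.Bijective (degZeroLin e) := by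
  have hz : Function.Bijective (zeroMap e) :=
    ⟨fun x y h => Subtype.ext (e.equiv.injective (congrArg Subtype.val h)), fun y =>
      ⟨⟨e.equiv.symm y, (e.mem_iff 0 _).2 (by rw [AlgEquiv.apply_symm_apply]; exact y.2)⟩,
        Subtype.ext (e.equiv.apply_symm_apply _)⟩⟩
  exact hz

/-- The isomorphism `A_0 ≅ B_0`. -/
noncomputable def degZeroEquiv : degZero 𝒜 ≃ₗ[A] comap e (degZero ℬ) :=
  LinearEquiv.ofBijective (degZeroLin e) (degZeroLin_bijective e)

/-- The isomorphism `A_0 ≅ B_0`, for the underlying modules. -/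
noncomputable def degZeroResIso : (degZero 𝒜).toModuleCat ≅ (resFunctor e).obj (degZero ℬ).toModuleCat :=
  (degZeroEquiv e).toModuleIso ≪≫ comapIso e (degZero ℬ)

/-- The isomorphism of Yoneda algebras induced by an isomorphism of graded algebras. -/
noncomputable def gamEquiv : GrEquiv (gamGrading ℬ) (gamGrading 𝒜) :=
  ⟨ExtAlg.transport (resFunctor e) k (degZeroResIso e), fun _ _ => ExtAlg.transport_mem_iff _ _⟩

/-- `E(X)` for an isomorphic graded algebra. -/
noncomputable def extComap (X : GrMod ℬ) : extObj ℬ X ≃+ extObj 𝒜 (comap e X) :=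
  ExtMod.transport (resFunctor e) (comapIso e X) (degZeroResIso e)

theorem extComap_smul {X : GrMod ℬ} (a : Gam ℬ) (x : extObj ℬ X) :
    extComap e X (a • x) = (gamEquiv e).equiv a • extComap e X x :=
  ExtMod.transport_smul (resFunctor e) (comapIso e X) (degZeroResIso e) a x

theorem extComap_mem {X : GrMod ℬ} {n : ℤ} {x : extObj ℬ X} (hx : x ∈ (extObj ℬ X).deg n) :
    extComap e X x ∈ (extObj 𝒜 (comap e X)).deg n := by
  obtain rfl | ⟨j, y, rfl, rfl⟩ := extObj_cases hx
  · rw [map_zero]; exact Submodule.zero_mem _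
  · exact Set.mem_of_eq_of_mem
      (ExtMod.transport_of (resFunctor e) (comapIso e X) (degZeroResIso e) y) (objOf_mem _)

variable (𝒜) in
/-- The isomorphism of `A` with the double Yoneda algebra. -/
noncomputable def phiGr [IsGenKoszul 𝒜] : GrEquiv 𝒜 (gamGrading (gamGrading 𝒜)) :=
  ⟨phiEquiv 𝒜, fun _ _ => phiEquiv_mem_iff⟩

end GrMod

/-! ### Full faithfulness and essential surjectivity of `E`. -/

open GrMod

variable {k : Type v} [Field k] {A : Type u} [Ring A] [Algebra k A] {𝒜 : ℕ → Submodule k A}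
variable [GradedAlgebra 𝒜] [IsGenKoszul 𝒜]

/-- `E ∘ E` is faithful, being isomorphic to the identity through `θ`. -/
theorem extMap_injective {M N : GrMod 𝒜} (hM : IsKoszul M) (hN : IsKoszul N) {f g : M ⟶ N}
    (h : extMap 𝒜 f = extMap 𝒜 g) : f = g := hom_ext_apply fun m => by
  apply (thetaEquiv hN).injective
  rw [thetaEquiv_lin hM hN, thetaEquiv_lin hM hN, h]

theorem exists_extMap {M N : GrMod 𝒜} (hM : IsKoszul M) (hN : IsKoszul N)
    (g : extObj 𝒜 N ⟶ extObj 𝒜 M) : ∃ f : M ⟶ N, extMap 𝒜 f = g := by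
  let f : M ⟶ N := mkHom
    { toFun := fun m => (thetaEquiv hN).symm (lin (extMap (gamGrading 𝒜) g) (thetaEquiv hM m))
      map_add' := fun x y => by simp only [map_add]
      map_smul' := fun a x => by
        rw [thetaEquiv_smul, map_smul, RingHom.id_apply, LinearEquiv.symm_apply_eq, thetaEquiv_smul,
          LinearEquiv.apply_symm_apply] }
    fun n m hm => by
      refine (thetaEquiv_mem_iff hN).2 ?_
      change thetaEquiv hN ((thetaEquiv hN).symm _) ∈ _
      rw [LinearEquiv.apply_symm_apply]
      exact lin_mem _ ((thetaEquiv_mem_iff hM).1 hm)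
  have hf : ∀ m, thetaEquiv hN (lin f m) = lin (extMap (gamGrading 𝒜) g) (thetaEquiv hM m) := fun m =>
    (thetaEquiv hN).apply_symm_apply _
  -- By construction `E(f)` and `g` agree after a further application of `E`; faithfulness over `Γ`
  -- gives `E(f) = g`.
  refine ⟨f, extMap_injective (IsGenKoszul.isKoszul_extObj hN) (IsGenKoszul.isKoszul_extObj hM)
    (hom_ext_apply fun x => ?_)⟩
  obtain ⟨m, rfl⟩ := (thetaEquiv hM).surjective x
  rw [← hf, thetaEquiv_lin hM hN]

/-- The candidate is `E(N)`, made an `A`-module through `A ≅ Ext_Γ^*(Γ_0, Γ_0)`. Two identifications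
of `Γ` with its double Yoneda algebra are involved, one from `θ` over `Γ` and one transported from
`A`; they differ by an automorphism `σ` of `Γ` that is not shown to be trivial. Twisting `N` by `σ`
beforehand compensates for it and makes the final map `Γ`-linear. -/
theorem exists_extObj_iso {N : GrMod (gamGrading 𝒜)} (hN : IsKoszul N) :
    ∃ M : GrMod 𝒜, IsKoszul M ∧ Nonempty (extObj 𝒜 M ≅ N) := by
  let σ : GrEquiv (gamGrading 𝒜) (gamGrading 𝒜) := (phiGr (gamGrading 𝒜)).trans (gamEquiv (phiGr 𝒜))
  have hN' : IsKoszul (comap σ N) := hN.comap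
  have hX := IsGenKoszul.isKoszul_extObj hN'
  refine ⟨comap (phiGr 𝒜) (extObj (gamGrading 𝒜) (comap σ N)), hX.comap, ⟨Iso.symm ?_⟩⟩
  let F : N ≃+ extObj 𝒜 (comap (phiGr 𝒜) (extObj (gamGrading 𝒜) (comap σ N))) :=
    ((comapMk σ N).trans (thetaEquiv hN').toAddEquiv).trans (extComap (phiGr 𝒜) _)
  refine isoOfBijective (mkHom { F with map_smul' := fun c x => ?_ } fun n x hx => ?_) F.bijective
  · obtain ⟨c, rfl⟩ := σ.equiv.surjective c
    change extComap (phiGr 𝒜) _ (thetaEquiv hN' (comapMk σ N (σ.equiv c • x))) =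
      σ.equiv c • extComap (phiGr 𝒜) _ (thetaEquiv hN' (comapMk σ N x))
    rw [← smul_comapMk, thetaEquiv_smul, extComap_smul]
    rfl
  · exact extComap_mem (phiGr 𝒜) ((thetaEquiv_mem_iff hN').1 (comapMk_mem.2 hx))

variable (𝒜) in
theorem koszulFunctor_isEquivalence
    (hE : ∀ M : GrMod 𝒜, IsKoszul M → IsKoszul (extObj 𝒜 M)) :
    (koszulFunctor 𝒜 hE).IsEquivalence where
  faithful := ⟨fun {X Y f g} h => by
    refine Quiver.Hom.unop_inj (ObjectProperty.hom_ext _ (extMap_injective Y.unop.property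
      X.unop.property ?_))
    exact congrArg (fun z => z.hom) h⟩
  full := ⟨fun {X Y} g => by
    obtain ⟨f, hf⟩ := exists_extMap Y.unop.property X.unop.property g.hom
    exact ⟨(ObjectProperty.homMk f).op, ObjectProperty.hom_ext _ hf⟩⟩
  essSurj := ⟨fun N => by
    obtain ⟨M, hM, ⟨i⟩⟩ := exists_extObj_iso N.property
    exact ⟨Opposite.op ⟨M, hM⟩, ⟨ObjectProperty.isoMk _ i⟩⟩⟩

end GenKoszul

theorem theorem2p3p1 {k : Type v} [Field k] {A : Type u} [Ring A] [Algebra k A]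
    (𝒜 : ℕ → Submodule k A) [GradedAlgebra 𝒜]
    (hfin : ∀ i : ℕ, FiniteDimensional k (𝒜 i))
    (hgen : ∀ i : ℕ, 𝒜 1 * 𝒜 i = 𝒜 (i + 1))
    (hS : SplittingCondition (𝒜 0))
    (hK : IsKoszulAlgebra 𝒜) :
    -- `E` maps Koszul `A`-modules to Koszul `Γ`-modules,
    ∃ hE : ∀ M : GrMod 𝒜, GrMod.IsKoszul M → GrMod.IsKoszul (extObj 𝒜 M),
      -- it is a contravariant equivalence between the two categories of Koszul modules,
      (koszulFunctor 𝒜 hE).IsEquivalence ∧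
      -- and `A ≅ Ext_Γ^*(Γ_0, Γ_0)` as graded algebras,
      ∃ φ : A ≃ₐ[k] Gam (gamGrading 𝒜),
        (∀ (n : ℕ) (a : A), a ∈ 𝒜 n ↔ φ a ∈ gamGrading (gamGrading 𝒜) n) ∧
        -- in such a way that `M ≅ Ext_Γ^*(E M, Γ_0)` as graded `A`-modules, naturally in `M`.
        ∃ θ : ∀ M : KoszulMod 𝒜, M.obj ≃ₗ[k] extObj (gamGrading 𝒜) (extObj 𝒜 M.obj),
          (∀ (M : KoszulMod 𝒜) (a : A) (m : M.obj), θ M (a • m) = φ a • θ M m) ∧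
          (∀ (M : KoszulMod 𝒜) (n : ℤ) (m : M.obj), m ∈ M.obj.deg n ↔
            θ M m ∈ (extObj (gamGrading 𝒜) (extObj 𝒜 M.obj)).deg n) ∧
          (∀ (M N : KoszulMod 𝒜) (f : M ⟶ N) (m : M.obj),
            θ N (GrMod.lin f.hom m) =
              GrMod.lin (extMap (gamGrading 𝒜) (extMap 𝒜 f.hom)) (θ M m)) := by
  have : IsGenKoszul 𝒜 := ⟨hfin, hS, hK⟩
  exact ⟨fun _ hM => IsGenKoszul.isKoszul_extObj hM, koszulFunctor_isEquivalence 𝒜 _,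
    GrMod.phiEquiv 𝒜, fun _ _ => GrMod.phiEquiv_mem_iff, fun M => GrMod.thetaEquiv M.property,
    fun M => GrMod.thetaEquiv_smul M.property, fun M _ _ => GrMod.thetaEquiv_mem_iff M.property,
    fun M N f => GrMod.thetaEquiv_lin M.property N.property f.hom⟩
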